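/- Let $(W,S)$ be a finite Coxeter system with longest element $w_\circ$, $N=\ell(w_\circ)$, and let $Q=(q_1,\dots,q_r)$ be a word in $S$ that contains a reduced expression of $w_\circ$ as a subword. The (spherical) subword complex $\mathcal{SC}(Q)$ has as faces the sets $I\subseteq[r]$ (including $I=\emptyset$) such that the letters of $Q$ at the positions $[r]\smallsetminus I$ contain a reduced expression of $w_\circ$. Let $M\in\mathbb R^{(r-N)\times r}$ have full rank $r-N$, and let $M^G\in\mathbb R^{N\times r}$ be a Gale dual matrix of $M$, i.e. its rows form a basis of $\ker M$. Let $\mathcal F_{Q,M}$ be the collection of cones in $\mathbb R^{r-N}$ consisting, for each face $I$ of $\mathcal{SC}(Q)$, of the cone spanned by the columns of $M$ with index in $I$. A sign function on the reduced expressions of $w_\circ$ is a map $\operatorname{sign}$ to $\{1,-1\}$ such that $\operatorname{sign}(w')=(-1)^{m_{ij}-1}\operatorname{sign}(w)$ whenever $w,w'$ are related by a braid move of length $m_{ij}$ between distinct generators $s_i,s_j$; it is unique up to a global factor $-1$. The matrix $M^G$ is a Coxeter signature matrix for $(Q,w_\circ)$ if, for one of the sign functions, $\operatorname{sign}(w)\cdot\det(M^G|_w)>0$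 for every occurrence $w\subset Q$ of a reduced expression of $w_\circ$, where $M^G|_w$ is the restriction of $M^G$ to the columns at the positions of $w$ (in increasing order). Then $\mathcal F_{Q,M}$ is a complete simplicial fan realizing $\mathcal{SC}(Q)$ (that is, $\mathcal F_{Q,M}$ is a complete simplicial fan in $\mathbb R^{r-N}$ and sending a face to its cone is an isomorphism from the face poset of $\mathcal{SC}(Q)$ to the poset of cones of $\mathcal F_{Q,M}$) if and only if (S) $M^G$ is a Coxeter signature matrix for $(Q,w_\circ)$, and (I) there is a facet of $\mathcal{SC}(Q)$ such that the interior of its cone is not intersected by the cone of any other face of $\mathcal{SC}(Q)$. -/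

import Mathlib

namespace SubwordFan

/-! ### Reduced expressions, longest element, sign function -/

section Words

variable {B W : Type*} [Group W] {C : CoxeterMatrix B} (cs : CoxeterSystem C W)

/-- `w₀` is a longest element of the Coxeter system (when `W` is finite there is exactly one). -/
def IsLongest (w₀ : W) : Prop := ∀ w : W, cs.length w ≤ cs.length w₀

/-- The reduced expressions of `π`. -/
def ReducedExpr (π : W) : Type _ := {ω : List B // cs.IsReduced ω ∧ cs.wordProd ω = π}

/-- `ω'` is obtained from `ω` by a single braid move between the letters `i` and `j`, that is,
by replacing a consecutive factor `… i j i j` of length `m_{ij}` by the factor `… j i j i` of the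
same length. -/
def IsBraidMove (C : CoxeterMatrix B) (i j : B) (ω ω' : List B) : Prop :=
  ∃ u v : List B, ω = u ++ CoxeterSystem.braidWord C i j ++ v ∧
    ω' = u ++ CoxeterSystem.braidWord C j i ++ v

/-- `σ` is a sign function on the reduced expressions of `π`: a braid move `m_{ij}` multiplies it
by `(-1)^(m_{ij} - 1)`. -/
def IsSignFunction (π : W) (σ : ReducedExpr cs π → ℤˣ) : Prop :=
  ∀ (i j : B) (ω ω' : ReducedExpr cs π), i ≠ j → IsBraidMove C i j ω.1 ω'.1 →
    σ ω' = (-1) ^ (C i j - 1) * σ ω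

variable {r : ℕ}

/-- The occurrences of reduced expressions of `π` as subwords of the word `Q = (q_1, …, q_r)`: an
occurrence is the increasing sequence of the `ℓ(π)` positions which it uses. -/
def Occurrence (π : W) (Q : Fin r → B) : Type :=
  {f : Fin (cs.length π) ↪o Fin r // cs.wordProd (List.ofFn (Q ∘ f)) = π}

variable {cs} in
/-- The reduced expression spelled by an occurrence. -/
noncomputable def Occurrence.word {π : W} {Q : Fin r → B} (f : Occurrence cs π Q) : ReducedExpr cs π :=
  ⟨List.ofFn (Q ∘ f.1), by rw [CoxeterSystem.IsReduced, f.2, List.length_ofFn], f.2⟩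

/-- The subword complex of `Q` and `π`, given by its set of faces (the empty face included): a set
`I` of positions is a face if the positions outside `I` contain a reduced expression of `π`. -/
def subwordComplex (π : W) (Q : Fin r → B) : Set (Finset (Fin r)) :=
  {I | ∃ f : Occurrence cs π Q, ∀ k, f.1 k ∉ I}

/-- A subset of a face is a face. -/
theorem isLowerSet_subwordComplex (π : W) (Q : Fin r → B) :
    IsLowerSet (subwordComplex cs π Q) := by
  rintro I J hJI ⟨f, hf⟩
  exact ⟨f, fun k hk => hf k (hJI hk)⟩

/-- A facet: an inclusion-maximal face. -/
def IsFacet (K : Set (Finset (Fin r))) (I : Finset (Fin r)) : Prop := Maximal (· ∈ K) I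

/-- `D` is a Coxeter signature matrix for `(Q, π)`: for every reduced expression `w ⊆ Q` of `π`, the
determinant of the columns of `D` at the positions of `w` has the sign `sign(w)`, where `sign` is
the sign function (which is only determined up to a global factor `-1`). -/
def IsSignatureMatrix (π : W) (Q : Fin r → B)
    (D : Matrix (Fin (cs.length π)) (Fin r) ℝ) : Prop :=
  ∃ σ : ReducedExpr cs π → ℤˣ, IsSignFunction cs π σ ∧
    ∀ f : Occurrence cs π Q, 0 < (((σ f.word : ℤˣ) : ℤ) : ℝ) * (D.submatrix id f.1).det

end Words

/-! ### Gale duality and fans -/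

/-- `G` is a Gale dual matrix of `A`: the rows of `G` form a basis of the kernel of `A`. -/
def IsGaleDual {m n k : Type*} [Fintype m] [Fintype n] [Fintype k]
    (A : Matrix m n ℝ) (G : Matrix k n ℝ) : Prop :=
  LinearIndependent ℝ G.row ∧ Submodule.span ℝ (Set.range G.row) = LinearMap.ker A.mulVecLin

/-- A collection `F` of convex cones in `E` is a complete simplicial fan. -/
structure IsCompleteSimplicialFan {E : Type*} [AddCommGroup E] [Module ℝ E]
    (F : Set (PointedCone ℝ E)) : Prop where
  finite : F.Finite
  simplicial : ∀ σ ∈ F, σ.IsSimplicial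
  face_mem : ∀ σ ∈ F, ∀ τ : PointedCone ℝ E, τ.IsFaceOf σ → τ ∈ F
  inter_isFaceOf : ∀ σ ∈ F, ∀ τ ∈ F, (σ ⊓ τ).IsFaceOf σ ∧ (σ ⊓ τ).IsFaceOf τ
  complete : ∀ x : E, ∃ σ ∈ F, x ∈ σ

/-- The cone in `ℝ^d` spanned by the columns of `M` with indices in `I`. -/
def colCone {d r : ℕ} (M : Matrix (Fin d) (Fin r) ℝ) (I : Finset (Fin r)) :
    PointedCone ℝ (Fin d → ℝ) :=
  PointedCone.hull ℝ (M.col '' (I : Set (Fin r)))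

/-- The collection of cones spanned by the columns of `M` corresponding to the faces of `K`. -/
def coneCollection {d r : ℕ} (K : Set (Finset (Fin r))) (M : Matrix (Fin d) (Fin r) ℝ) :
    Set (PointedCone ℝ (Fin d → ℝ)) :=
  colCone M '' K

/-- The collection of cones of `K` and `M` is a complete simplicial fan, and it realizes `K`: the
assignment of its cone to each face of `K` is an isomorphism from the face poset of `K` to the
poset of cones of the fan. -/
structure IsCompleteSimplicialFanRealization {d r : ℕ} (K : Set (Finset (Fin r)))
    (M : Matrix (Fin d) (Fin r) ℝ) : Prop where
  fan : IsCompleteSimplicialFan (coneCollection K M)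
  realizes : ∀ I ∈ K, ∀ J ∈ K, colCone M I ≤ colCone M J ↔ I ⊆ J

/-- Some facet of `K` has a cone whose interior is met by the cone of no other face of `K`. -/
def HasInjectiveFacet {d r : ℕ} (K : Set (Finset (Fin r)))
    (M : Matrix (Fin d) (Fin r) ℝ) : Prop :=
  ∃ I, IsFacet K I ∧ ∀ J ∈ K, J ≠ I →
    Disjoint (interior (colCone M I : Set (Fin d → ℝ))) (colCone M J : Set (Fin d → ℝ))

end SubwordFan

/-! Gale duality turns statements about the columns of `M` into statements about minors of `MG`. The
columns of `M` outside an occurrence `w` form a basis iff the minor of `MG` at `w` is nonzero. For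
two facets sharing a ridge, the essentially unique linear relation among the columns involved has,
at the two exchanged vertices, the two minors as coefficients, up to signs recording the positions
of the exchanged letters. The sign function is built to absorb these signs: moving a letter through
a factor of length `n` of a reduced word multiplies it by `(-1)^n` (`IsBraidSign.flip`). Hence (S)
amounts to two things: every facet spans a full-dimensional simplicial cone, and two facets with a
common ridge lie on opposite sides of it (`IsSignFunction.exists_circuit`).

A realizing fan has both properties, with one global sign because the occurrences are connected by
flips (`reflTransGen_flipAdj`). Property (I) then holds for every facet, since a face of a cone that
meets its interior is the whole cone. A sign function is available to begin with by
`exists_isSignFunction`.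

Conversely, since `w₀` is longest, every ridge lies in exactly two facets (`existsUnique_exchange`),
on opposite sides by (S). When a generic point crosses a wall it leaves one cone and enters another,
or moves between walls without changing the count, so the number of cones covering a generic point
is constant. Thus (S) alone gives a multiple covering; (I) forces its degree to be one. The same
count inside the star of a face shows that a point determines the support of its positive expression
(`IsFlipSystem.eq_of_sum_eq_sum`), and this gives the fan axioms and the injectivity of the face
map.

The facts used about Coxeter groups are proved here: strong exchange by a parity cocycle, the order
of a product of two simple reflections by the geometric representation, and a version of Matsumoto's
theorem that keeps track of signs. -/

namespace SubwordFan

/-! ### Inversion parities and the strong exchange condition. -/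

section Exchange

variable {B W : Type*} [Group W] {C : CoxeterMatrix B} (cs : CoxeterSystem C W)

/-- The alternating word of length `n` in the letters `i` and `j` that starts with `i`. -/
def altWord (i j : B) : ℕ → List B
  | 0 => []
  | n + 1 => i :: altWord j i n

@[simp] theorem altWord_zero (i j : B) : altWord i j 0 = [] := rfl

theorem altWord_succ (i j : B) (n : ℕ) : altWord i j (n + 1) = i :: altWord j i n := rfl

@[simp] theorem length_altWord (i j : B) (n : ℕ) : (altWord i j n).length = n := by
  induction n generalizing i j with
  | zero => rfl
  | succ n ih => simp [altWord, ih]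

theorem altWord_eq_alternatingWord (i j : B) (n : ℕ) :
    altWord i j n =
      if Even n then CoxeterSystem.alternatingWord i j n
      else CoxeterSystem.alternatingWord j i n := by
  induction n generalizing i j with
  | zero => simp [CoxeterSystem.alternatingWord]
  | succ n ih =>
    rw [altWord, ih]
    by_cases h : Even n <;>
      simp [h, Nat.even_add_one, CoxeterSystem.alternatingWord_succ']

theorem wordProd_altWord_two_mul (i j : B) (k : ℕ) :
    cs.wordProd (altWord i j (2 * k)) = (cs.simple i * cs.simple j) ^ k := by
  induction k with
  | zero => simp
  | succ k ih =>
    rw [show 2 * (k + 1) = 2 * k + 1 + 1 by ring, altWord, altWord, cs.wordProd_cons,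
      cs.wordProd_cons, ih, pow_succ', mul_assoc]

theorem mul_pow_mul_comm (i j : B) (k : ℕ) :
    cs.simple i * (cs.simple j * cs.simple i) ^ k =
      (cs.simple i * cs.simple j) ^ k * cs.simple i := by
  induction k with
  | zero => simp
  | succ k ih => rw [pow_succ, ← mul_assoc, ih, pow_succ]; simp only [mul_assoc]

theorem wordProd_altWord_two_mul_add_one (i j : B) (k : ℕ) :
    cs.wordProd (altWord i j (2 * k + 1)) = (cs.simple i * cs.simple j) ^ k * cs.simple i := by
  rw [altWord, cs.wordProd_cons, wordProd_altWord_two_mul, mul_pow_mul_comm]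

theorem leftInvSeq_altWord (i j : B) (n : ℕ) :
    cs.leftInvSeq (altWord i j n) =
      (List.range n).map fun k => (cs.simple i * cs.simple j) ^ k * cs.simple i := by
  induction n generalizing i j with
  | zero => rfl
  | succ n ih =>
    rw [altWord, CoxeterSystem.leftInvSeq, ih, List.range_succ_eq_map]
    simp only [List.map_cons, pow_zero, one_mul, List.map_map, List.cons.injEq, true_and]
    refine List.map_congr_left fun k _ => ?_
    simp only [Function.comp_apply, MulAut.conj_apply, cs.inv_simple]
    rw [← mul_assoc, mul_pow_mul_comm, pow_succ]
    simp only [mul_assoc]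

theorem leftInvSeq_append (ω ω' : List B) :
    cs.leftInvSeq (ω ++ ω') =
      cs.leftInvSeq ω ++ (cs.leftInvSeq ω').map (MulAut.conj (cs.wordProd ω)) := by
  induction ω with
  | nil => simp
  | cons i ω ih =>
    simp [CoxeterSystem.leftInvSeq, ih, cs.wordProd_cons]

open Classical in
/-- The action of a simple reflection on pairs of a group element and a parity. -/
noncomputable def parityStep (i : B) : Function.End (W × ZMod 2) :=
  fun p => (cs.simple i * p.1 * cs.simple i, p.2 + if p.1 = cs.simple i then 1 else 0)

-- Letting the letters act one after another conjugates `t` step by step; the parity flips exactly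
-- when the current conjugate is the current letter, that is, when `t` is the corresponding entry of
-- the left inversion sequence.
open Classical in
theorem prod_parityStep (ω : List B) (t : W) (e : ZMod 2) :
    (ω.reverse.map (parityStep cs)).prod (t, e) =
      ((cs.wordProd ω)⁻¹ * t * cs.wordProd ω, e + ((cs.leftInvSeq ω).count t : ZMod 2)) := by
  induction ω generalizing t e with
  | nil => simp [Function.End.one_def]
  | cons i ω ih =>
    simp only [List.reverse_cons, List.map_append, List.map_cons, List.map_nil, List.prod_append,
      List.prod_cons, List.prod_nil, mul_one]
    change (ω.reverse.map (parityStep cs)).prod (parityStep cs i (t, e)) = _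
    rw [parityStep, ih]
    refine Prod.ext ?_ ?_
    · simp [cs.wordProd_cons, mul_assoc]
    · simp only [CoxeterSystem.leftInvSeq, List.count_cons, Nat.cast_add]
      have h : cs.simple i * t * cs.simple i = (MulAut.conj (cs.simple i)) t := by simp
      rw [h, ← List.count_map_of_injective _ _ (MulAut.conj (cs.simple i)).injective]
      have h' : List.map (MulAut.conj (cs.simple i)) (cs.leftInvSeq ω) =
        List.map (MulAut.conj (cs.simple i)) (cs.leftInvSeq ω) := rfl
      have hc : (MulAut.conj (cs.simple i)) ((MulAut.conj (cs.simple i)) t) = t := by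
        simp [mul_assoc]
      rw [hc]
      have : (cs.simple i == t) = decide (t = cs.simple i) := by
        by_cases hh : t = cs.simple i
        · simp [hh]
        · simp [hh, Ne.symm hh]
      rw [this]
      by_cases hh : t = cs.simple i
      · simp [hh]; ring
      · simp [hh]

/-- The inversion sequence of an alternating word of length `2 * C i j` is a list of length `C i j`
repeated twice, so all counts are even. Hence the parity of a count depends only on the group
element and not on the word. -/
theorem isLiftable_parityStep : C.IsLiftable (parityStep cs) := by
  classical
  intro i j
  have key : ∀ n : ℕ, ((altWord j i (2 * n)).reverse.map (parityStep cs)).prod =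
      (parityStep cs i * parityStep cs j) ^ n := by
    intro n
    induction n with
    | zero => simp
    | succ n ih =>
      rw [show 2 * (n + 1) = 2 * n + 1 + 1 by ring, altWord, altWord]
      simp only [List.reverse_cons, List.map_append, List.prod_append, List.map_cons, List.map_nil,
        List.prod_cons, List.prod_nil, mul_one, ih, pow_succ, mul_assoc]
  rw [← key]
  funext ⟨t, e⟩
  rw [prod_parityStep, leftInvSeq_altWord, wordProd_altWord_two_mul, two_mul, List.range_add,
    List.map_append, List.map_map, List.count_append]
  have h : ((fun k => (cs.simple j * cs.simple i) ^ k * cs.simple j) ∘ fun x => C i j + x) =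
      fun k => (cs.simple j * cs.simple i) ^ k * cs.simple j := by
    funext k
    simp [pow_add]
  rw [h]
  refine Prod.ext ?_ ?_
  · simp
    rfl
  · simp only [Nat.cast_add, Function.End.one_def, id]
    rw [CharTwo.add_self_eq_zero, add_zero]

/-- The parity of the number of occurrences of `t` in the left inversion sequence of any word
for `w`. -/
noncomputable def invParity (w t : W) : ZMod 2 :=
  (cs.lift ⟨parityStep cs, isLiftable_parityStep cs⟩ w⁻¹ (t, 0)).2

theorem lift_parityStep_inv (ω : List B) :
    cs.lift ⟨parityStep cs, isLiftable_parityStep cs⟩ (cs.wordProd ω)⁻¹ =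
      (ω.reverse.map (parityStep cs)).prod := by
  rw [← cs.wordProd_reverse, CoxeterSystem.wordProd, map_list_prod, List.map_map]
  congr 1
  refine List.map_congr_left fun i _ => ?_
  simp

open Classical in
theorem invParity_wordProd (ω : List B) (t : W) :
    invParity cs (cs.wordProd ω) t = ((cs.leftInvSeq ω).count t : ZMod 2) := by
  rw [invParity, lift_parityStep_inv, prod_parityStep, zero_add]

theorem invParity_mul (u v t : W) :
    invParity cs (u * v) t = invParity cs u t + invParity cs v (u⁻¹ * t * u) := by
  classical
  obtain ⟨ω, rfl⟩ := cs.wordProd_surjective u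
  obtain ⟨ω', rfl⟩ := cs.wordProd_surjective v
  rw [← cs.wordProd_append, invParity_wordProd, invParity_wordProd, invParity_wordProd,
    leftInvSeq_append, List.count_append, Nat.cast_add]
  have h := List.count_map_of_injective (cs.leftInvSeq ω') _
    (MulAut.conj (cs.wordProd ω)).injective ((cs.wordProd ω)⁻¹ * t * cs.wordProd ω)
  rw [← h]
  simp [mul_assoc]

@[simp] theorem invParity_one (t : W) : invParity cs 1 t = 0 := by
  classical
  simpa using invParity_wordProd cs [] t

theorem invParity_simple_self (i : B) : invParity cs (cs.simple i) (cs.simple i) = 1 := by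
  classical
  have := invParity_wordProd cs [i] (cs.simple i)
  simpa using this

/-- For `t = w s w⁻¹` the cocycle rule yields contributions of `w`, `s` and `w⁻¹`. Those of `w` and
`w⁻¹` cancel because `w⁻¹ * w = 1`, and `s` contributes one. -/
theorem invParity_self {t : W} (ht : cs.IsReflection t) : invParity cs t t = 1 := by
  obtain ⟨w, i, rfl⟩ := ht
  have h1 : invParity cs (w⁻¹ * w) (cs.simple i) = 0 := by simp
  rw [invParity_mul] at h1
  simp only [inv_inv] at h1
  rw [mul_assoc, invParity_mul, invParity_mul]
  have h2 : w⁻¹ * (w * (cs.simple i * w⁻¹)) * w = cs.simple i := by group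
  rw [h2]
  have h3 : (cs.simple i)⁻¹ * cs.simple i * cs.simple i = cs.simple i := by simp
  have h4 : w * (cs.simple i * w⁻¹) = w * cs.simple i * w⁻¹ := by group
  rw [h3, h4, invParity_simple_self]
  linear_combination h1

/-- Parity one puts `t` into the inversion sequence of a reduced word, so `t` shortens `w`. Parity
zero for `w` means parity one for `t * w`, so `t` shortens `t * w` to `w`. -/
theorem invParity_eq_one_iff {t : W} (ht : cs.IsReflection t) (w : W) :
    invParity cs w t = 1 ↔ cs.length (t * w) < cs.length w := by
  classical
  have key : ∀ w : W, invParity cs w t = 1 → cs.length (t * w) < cs.length w := by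
    intro w h
    obtain ⟨ω, hω, rfl⟩ := cs.exists_isReduced w
    rw [invParity_wordProd] at h
    have : t ∈ cs.leftInvSeq ω := by
      by_contra hn
      rw [List.count_eq_zero_of_not_mem hn] at h
      simp at h
    exact (cs.isLeftInversion_of_mem_leftInvSeq hω this).2
  refine ⟨key w, fun h => ?_⟩
  by_contra hn
  have h0 : invParity cs w t = 0 := by
    generalize invParity cs w t = x at hn ⊢
    revert x; decide
  have h1 : invParity cs (t * w) t = 1 := by
    rw [invParity_mul, invParity_self cs ht]
    simp [h0]
  have h2 := key _ h1
  rw [← mul_assoc, ht.mul_self, one_mul] at h2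
  omega

/-- The strong exchange condition. -/
theorem mem_leftInvSeq_of_length_lt {t : W} (ht : cs.IsReflection t) (ω : List B)
    (h : cs.length (t * cs.wordProd ω) < cs.length (cs.wordProd ω)) : t ∈ cs.leftInvSeq ω := by
  classical
  rw [← invParity_eq_one_iff cs ht, invParity_wordProd] at h
  by_contra hn
  rw [List.count_eq_zero_of_not_mem hn] at h
  simp at h

/-- A left inversion deletes a letter. -/
theorem exists_eraseIdx_of_length_lt {t : W} (ht : cs.IsReflection t) (ω : List B)
    (h : cs.length (t * cs.wordProd ω) < cs.length (cs.wordProd ω)) :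
    ∃ u i v, ω = u ++ i :: v ∧ t * cs.wordProd ω = cs.wordProd (u ++ v) ∧
      t = cs.wordProd u * cs.simple i * (cs.wordProd u)⁻¹ := by
  obtain ⟨k, hk, hkt⟩ := List.mem_iff_getElem.1 (mem_leftInvSeq_of_length_lt cs ht ω h)
  have hk' : k < ω.length := by simpa using hk
  rw [cs.getElem_leftInvSeq ω k hk'] at hkt
  have hsplit : ω = ω.take k ++ ω[k] :: ω.drop (k + 1) := by simp
  refine ⟨ω.take k, ω[k], ω.drop (k + 1), hsplit, ?_, hkt.symm⟩
  have hprod := congrArg cs.wordProd hsplit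
  rw [cs.wordProd_append, cs.wordProd_cons] at hprod
  rw [← hkt, hprod]
  simp [cs.wordProd_append, mul_assoc]

/-- Without repetitions every entry has parity one, hence is an inversion of the element and occurs
in the inversion sequence of any reduced word for it. So `ω` is no longer than a reduced word. -/
theorem isReduced_of_nodup_leftInvSeq {ω : List B} (h : (cs.leftInvSeq ω).Nodup) :
    cs.IsReduced ω := by
  classical
  obtain ⟨ω', hω', heq⟩ := cs.exists_isReduced (cs.wordProd ω)
  refine le_antisymm (cs.length_wordProd_le ω) ?_
  rw [heq, hω', ← cs.length_leftInvSeq ω, ← cs.length_leftInvSeq ω']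
  refine (List.subperm_of_subset h fun t ht => ?_).length_le
  have hr := cs.isReflection_of_mem_leftInvSeq ω ht
  refine mem_leftInvSeq_of_length_lt cs hr ω' ?_
  rw [← invParity_eq_one_iff cs hr, ← heq, invParity_wordProd,
    List.count_eq_one_of_mem h ht, Nat.cast_one]

end Exchange

end SubwordFan

namespace SubwordFan

/-! ### The order of a product of two simple reflections, by the geometric representation. -/

section Order

open Real

theorem sin_add_one_mul (a θ : ℝ) :
    sin ((a + 1) * θ) = 2 * cos θ * sin (a * θ) - sin ((a - 1) * θ) := by
  rw [add_mul, sub_mul, one_mul, sin_add, sin_sub]; ring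

variable {E : Type*} [AddCommGroup E] [Module ℝ E]

theorem preReflection_mul_apply_left {f g : Module.Dual ℝ E} {x y : E} {θ : ℝ}
    (hfx : f x = 2) (hfy : f y = -2 * cos θ) (hgx : g x = -2 * cos θ) :
    (Module.preReflection x f * Module.preReflection y g) x =
      (4 * cos θ ^ 2 - 1) • x + (2 * cos θ) • y := by
  simp only [Module.End.mul_apply, Module.preReflection_apply, map_sub, map_smul, hfx, hfy, hgx]
  module

theorem preReflection_mul_apply_right {f g : Module.Dual ℝ E} {x y : E} {θ : ℝ}
    (hgy : g y = 2) (hfy : f y = -2 * cos θ) :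
    (Module.preReflection x f * Module.preReflection y g) y = (-2 * cos θ) • x - y := by
  simp only [Module.End.mul_apply, Module.preReflection_apply, map_sub, map_smul, hgy, hfy]
  module

section Plane

variable {f g : Module.Dual ℝ E} {x y : E} {θ : ℝ}
  (hfx : f x = 2) (hgy : g y = 2) (hfy : f y = -2 * cos θ) (hgx : g x = -2 * cos θ)

include hfx hgy hfy hgx

/-- The product of the two reflections acts on the plane of `x` and `y` as a rotation by `2θ`.
Multiplying by `sin θ` avoids division and turns the induction into the recursion `sin_add_one_mul`.
-/
theorem preReflection_mul_pow_apply (k : ℕ) :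
    sin θ • ((Module.preReflection x f * Module.preReflection y g) ^ k) x =
        sin ((2 * k + 1) * θ) • x + sin (2 * k * θ) • y ∧
      sin θ • ((Module.preReflection x f * Module.preReflection y g) ^ k) y =
        -(sin (2 * k * θ) • x) - sin ((2 * k - 1) * θ) • y := by
  induction k with
  | zero => simp
  | succ k ih =>
    have h1 := sin_add_one_mul (2 * k) θ
    have h2 := sin_add_one_mul (2 * k + 1) θ
    have h3 := sin_add_one_mul (2 * k + 1 + 1) θ
    have hx := preReflection_mul_apply_left hfx hfy hgx
    have hy := preReflection_mul_apply_right (x := x) hgy hfy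
    generalize Module.preReflection x f * Module.preReflection y g = T at *
    rw [show (2 * (k : ℝ) + 1 - 1) = 2 * k by ring] at h2
    rw [show (2 * (k : ℝ) + 1 + 1 - 1) = 2 * k + 1 by ring] at h3
    rw [pow_succ', Module.End.mul_apply, Module.End.mul_apply, ← map_smul T, ← map_smul T, ih.1, ih.2]
    simp only [map_add, map_sub, map_neg, map_smul, hx, hy]
    push_cast
    rw [show (2 * ((k : ℝ) + 1) + 1) = 2 * k + 1 + 1 + 1 by ring,
      show (2 * ((k : ℝ) + 1)) = 2 * k + 1 + 1 by ring,
      show (2 * (k : ℝ) + 1 + 1 - 1) = 2 * k + 1 by ring, h3, h2, h1]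
    constructor <;> module

theorem preReflection_mul_pow_eq_one {k : ℕ} (hs : sin θ ≠ 0) (hk : k * θ = π) :
    (Module.preReflection x f * Module.preReflection y g) ^ k = 1 := by
  have hP := preReflection_mul_pow_apply hfx hgy hfy hgx k
  have e1 : (2 * k + 1) * θ = θ + 2 * π := by linear_combination 2 * hk
  have e2 : (2 * k - 1) * θ = -θ + 2 * π := by linear_combination 2 * hk
  have e3 : 2 * k * θ = 2 * π := by linear_combination 2 * hk
  rw [e1, e2, e3, sin_add_two_pi, sin_add_two_pi, sin_two_pi, sin_neg] at hP
  have hx : ((Module.preReflection x f * Module.preReflection y g) ^ k) x = x := by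
    have := hP.1
    rw [zero_smul, add_zero] at this
    exact smul_right_injective E hs this
  have hy : ((Module.preReflection x f * Module.preReflection y g) ^ k) y = y := by
    have := hP.2
    rw [zero_smul, neg_zero, zero_sub, neg_smul, neg_neg] at this
    exact smul_right_injective E hs this
  ext v
  -- `a` and `b` solve the linear system `f (a • x + b • y) = f v`, `g (a • x + b • y) = g v`, of
  -- determinant `4 sin² θ`. The remainder `v₀` is killed by `f` and `g`, hence fixed by both
  -- reflections.
  set a := (f v + cos θ * g v) / (2 * sin θ ^ 2) with ha
  set b := (g v + cos θ * f v) / (2 * sin θ ^ 2) with hb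
  have hsc : sin θ ^ 2 = 1 - cos θ ^ 2 := by rw [← sin_sq_add_cos_sq θ]; ring
  have hs2 : 1 - cos θ ^ 2 ≠ 0 := by rw [← hsc]; positivity
  set v₀ := v - a • x - b • y with hv₀
  have hf0 : f v₀ = 0 := by
    simp only [hv₀, map_sub, map_smul, hfx, hfy, smul_eq_mul, ha, hb, hsc]
    field_simp
    ring
  have hg0 : g v₀ = 0 := by
    simp only [hv₀, map_sub, map_smul, hgx, hgy, smul_eq_mul, ha, hb, hsc]
    field_simp
    ring
  have hT : ∀ n : ℕ, ((Module.preReflection x f * Module.preReflection y g) ^ n) v₀ = v₀ := by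
    intro n
    induction n with
    | zero => simp
    | succ n ih =>
      rw [pow_succ', Module.End.mul_apply, ih]
      simp [Module.End.mul_apply, Module.preReflection_apply, hf0, hg0]
  have hv : v = v₀ + a • x + b • y := by rw [hv₀]; abel
  rw [hv, map_add, map_add, map_smul, map_smul, hT, hx, hy, Module.End.one_apply]

/-- Applying `f` and `g` to the image of `x` gives `sin (2kθ) = 0` and `sin ((2k+1)θ) = sin θ`.
Together they force `cos (2kθ) = 1`, so the rotation angle `2kπ/m` is a multiple of `2π`. -/
theorem dvd_of_preReflection_mul_pow_eq_one {k m : ℕ} (hm : 2 ≤ m) (hθ : θ = π / m)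
    (hk : (Module.preReflection x f * Module.preReflection y g) ^ k = 1) : m ∣ k := by
  have hm0 : (0 : ℝ) < m := by positivity
  have hmθ : m * θ = π := by rw [hθ]; field_simp
  have hs : 0 < sin θ := by
    have h2 : (2 : ℝ) ≤ m := by exact_mod_cast hm
    refine sin_pos_of_pos_of_lt_pi (by rw [hθ]; positivity) ?_
    nlinarith [pi_pos]
  have hsc : sin θ ^ 2 = 1 - cos θ ^ 2 := by rw [← sin_sq_add_cos_sq θ]; ring
  have hP := (preReflection_mul_pow_apply hfx hgy hfy hgx k).1
  rw [hk, Module.End.one_apply] at hP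
  have h1 := congrArg f hP
  have h2 := congrArg g hP
  simp only [map_add, map_smul, smul_eq_mul, hfx, hfy, hgx, hgy] at h1 h2
  have h3 : sin (2 * k * θ) = 0 := by
    have : sin (2 * k * θ) * sin θ ^ 2 = 0 := by
      rw [hsc]; linear_combination (-1 / 2) * h2 - cos θ / 2 * h1
    rcases mul_eq_zero.1 this with h | h
    · exact h
    · exact absurd h (by positivity)
  have h4 : sin ((2 * k + 1) * θ) = sin θ := by
    rw [h3] at h1; linarith
  obtain ⟨n, hn⟩ := sin_eq_zero_iff.1 h3
  have h5 : cos (2 * k * θ) = 1 := by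
    rw [add_mul, one_mul, sin_add, h3, zero_mul, zero_add] at h4
    exact mul_right_cancel₀ hs.ne' (by linarith)
  obtain ⟨c, hc⟩ := (cos_eq_one_iff _).1 h5
  have h6 : (k : ℝ) = c * m := by
    have h7 : (c : ℝ) * (2 * π) = 2 * k * θ := hc
    have : (k : ℝ) * π = c * m * π := by
      rw [← hmθ] at h7 ⊢
      have hθ0 : θ ≠ 0 := by rintro h; simp [h] at hs
      linear_combination (-(m : ℝ) / 2) * h7
    exact mul_right_cancel₀ pi_ne_zero this
  have h7 : (k : ℤ) = c * m := by exact_mod_cast h6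
  exact Int.natCast_dvd_natCast.1 ⟨c, by rw [h7]; ring⟩

end Plane

variable {B W : Type*} [Group W] {C : CoxeterMatrix B} (cs : CoxeterSystem C W)

/-- The Coxeter matrix entries, with `0` (no relation) replaced by `n`. -/
def finiteEntry (C : CoxeterMatrix B) (n : ℕ) (i j : B) : ℕ := if C i j = 0 then n else C i j

/-- The vector of the reflection with index `i` in the contragredient geometric representation. -/
noncomputable def geomVector (C : CoxeterMatrix B) (n : ℕ) (i : B) : B → ℝ :=
  fun j => -2 * cos (π / finiteEntry C n i j)

/-- The reflection with index `i` in the contragredient geometric representation. -/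
noncomputable def geomReflection (C : CoxeterMatrix B) (n : ℕ) (i : B) : Module.End ℝ (B → ℝ) :=
  Module.preReflection (geomVector C n i) (LinearMap.proj i)

theorem geomVector_self (n : ℕ) (i : B) : geomVector C n i i = 2 := by
  simp [geomVector, finiteEntry]

theorem geomVector_comm (n : ℕ) (i j : B) : geomVector C n i j = geomVector C n j i := by
  simp only [geomVector, finiteEntry, C.symmetric i j]

theorem isLiftable_geomReflection (n : ℕ) : C.IsLiftable (geomReflection C n) := by
  intro i j
  by_cases hij : i = j
  · subst hij
    rw [C.diagonal, pow_one]
    ext1 v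
    exact Module.involutive_preReflection (geomVector_self n i) v
  by_cases h0 : C i j = 0
  · rw [h0, pow_zero]
  have h1 := C.off_diagonal i j hij
  have hm : 2 ≤ C i j := by
    have : C i j ≠ 1 := h1
    omega
  have h2 : (2 : ℝ) ≤ C i j := by exact_mod_cast hm
  have hmul : (C i j : ℝ) * (π / C i j) = π := by field_simp
  refine preReflection_mul_pow_eq_one (θ := π / C i j) (geomVector_self n i) (geomVector_self n j)
    ?_ ?_ ?_ hmul
  · rw [LinearMap.proj_apply, geomVector_comm]
    simp [geomVector, finiteEntry, h0]
  · simp [geomVector, finiteEntry, h0]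
  · refine (sin_pos_of_pos_of_lt_pi (by positivity) ?_).ne'
    nlinarith [pi_pos, show 0 < π / C i j by positivity]

/-- The order of a product of two distinct simple reflections is a multiple of the entry of the
Coxeter matrix. -/
theorem dvd_of_simple_mul_simple_pow_eq_one {i j : B} (hij : i ≠ j) {k : ℕ}
    (h : (cs.simple i * cs.simple j) ^ k = 1) : C i j ∣ k := by
  have key : ∀ n, 2 ≤ n → finiteEntry C n i j ∣ k := by
    intro n hn
    have hh := congrArg (cs.lift ⟨geomReflection C n, isLiftable_geomReflection n⟩) h
    rw [map_pow, map_mul, cs.lift_apply_simple, cs.lift_apply_simple, map_one] at hh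
    refine dvd_of_preReflection_mul_pow_eq_one (geomVector_self n i) (geomVector_self n j)
      ?_ ?_ ?_ rfl hh
    · rw [LinearMap.proj_apply, geomVector_comm, geomVector]
    · rw [LinearMap.proj_apply, geomVector]
    · have h1 : C i j ≠ 1 := C.off_diagonal i j hij
      rw [finiteEntry]
      split_ifs <;> omega
  by_cases h0 : C i j = 0
  -- Without a relation the missing entry may be replaced by any `n ≥ 2`; a positive `k` is not
  -- divisible by `k + 2`.
  · have := key (k + 2) (by omega)
    rw [finiteEntry, if_pos h0] at this
    rw [h0, zero_dvd_iff]
    by_contra hk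
    have := Nat.le_of_dvd (Nat.pos_of_ne_zero hk) this
    omega
  · simpa [finiteEntry, h0] using key 2 le_rfl

end Order

end SubwordFan

namespace SubwordFan

/-! ### Reduced words, braid moves and the behaviour of sign functions. -/

section Matsumoto

variable {B W : Type*} [Group W] {C : CoxeterMatrix B} (cs : CoxeterSystem C W)

theorem simple_injective {i j : B} (h : cs.simple i = cs.simple j) : i = j := by
  by_contra hij
  have h1 : (cs.simple i * cs.simple j) ^ 1 = 1 := by rw [h]; simp
  exact C.off_diagonal i j hij (Nat.dvd_one.1 (dvd_of_simple_mul_simple_pow_eq_one cs hij h1))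

theorem altWord_succ_last (i j : B) (n : ℕ) :
    altWord i j (n + 1) = altWord i j n ++ [if Even n then i else j] := by
  induction n generalizing i j with
  | zero => rfl
  | succ n ih =>
    rw [altWord_succ, ih, altWord_succ i j n, List.cons_append]
    by_cases h : Even n <;> simp [h, Nat.even_add_one]

theorem wordProd_altWord_comm (i j : B) :
    cs.wordProd (altWord i j (C i j)) = cs.wordProd (altWord j i (C i j)) := by
  have h := cs.wordProd_braidWord_eq i j
  rw [altWord_eq_alternatingWord, altWord_eq_alternatingWord]
  unfold CoxeterSystem.braidWord at h
  rw [C.symmetric j i] at h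
  split_ifs
  · exact h
  · exact h.symm

/-- `ω` is a reduced word for `w`. -/
def IsReducedWord (w : W) (ω : List B) : Prop := cs.wordProd ω = w ∧ ω.length = cs.length w

variable {cs}

theorem IsReducedWord.isReduced {w : W} {ω : List B} (h : IsReducedWord cs w ω) :
    cs.IsReduced ω := by
  rw [CoxeterSystem.IsReduced, h.1, h.2]

theorem IsReducedWord.congr {w : W} {ω ω' : List B} (h : IsReducedWord cs w ω)
    (hp : cs.wordProd ω' = cs.wordProd ω) (hl : ω'.length = ω.length) :
    IsReducedWord cs w ω' :=
  ⟨hp.trans h.1, hl.trans h.2⟩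

theorem isReduced_of_wordProd_eq {ω ω' : List B} (h : cs.IsReduced ω)
    (hp : cs.wordProd ω' = cs.wordProd ω) (hl : ω'.length = ω.length) : cs.IsReduced ω' := by
  rw [CoxeterSystem.IsReduced, hp, h.eq, hl]

theorem isReduced_of_append_left {ω ω' : List B} (h : cs.IsReduced (ω ++ ω')) :
    cs.IsReduced ω := by
  simpa using h.take ω.length

theorem isReduced_of_append_right {ω ω' : List B} (h : cs.IsReduced (ω ++ ω')) :
    cs.IsReduced ω' := by
  simpa using h.drop ω.length

theorem isLeftDescent_of_isReduced_cons {i : B} {ω : List B} (h : cs.IsReduced (i :: ω)) :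
    cs.IsLeftDescent (cs.wordProd (i :: ω)) i := by
  rw [CoxeterSystem.IsLeftDescent, h.eq, cs.wordProd_cons, cs.simple_mul_simple_cancel_left]
  exact lt_of_le_of_lt (cs.length_wordProd_le ω) (by simp)

variable (cs)

/-- Exchanging `j` into the word deletes some letter. A letter of the alternating prefix cannot be
deleted: then `s_j` would be an inversion `(s_i s_j)^l s_i` of the prefix, giving `(s_i s_j)^(l+1) =
1` with `l < k`. So the prefix survives and grows by `j` in front. -/
theorem exists_altWord_succ_prefix {i j : B} {k : ℕ} {η : List B} {x : W}
    (hx : cs.wordProd (altWord i j k ++ η) = x) (hl : cs.length x = k + η.length)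
    (hj : cs.IsLeftDescent x j) (hk : ∀ l < k, (cs.simple i * cs.simple j) ^ (l + 1) ≠ 1) :
    ∃ η', cs.wordProd (altWord j i (k + 1) ++ η') = x ∧ cs.length x = k + 1 + η'.length := by
  subst hx
  obtain ⟨u, c, v, hω, hprod, ht⟩ :=
    exists_eraseIdx_of_length_lt cs (cs.isReflection_simple j) _ hj
  have key : ∀ as, u = altWord i j k ++ as → η = as ++ c :: v →
      ∃ η', cs.wordProd (altWord j i (k + 1) ++ η') = cs.wordProd (altWord i j k ++ η) ∧
        cs.length (cs.wordProd (altWord i j k ++ η)) = k + 1 + η'.length := by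
    rintro as rfl rfl
    refine ⟨as ++ v, ?_, ?_⟩
    · rw [altWord_succ, List.cons_append, cs.wordProd_cons, ← List.append_assoc, ← hprod,
        cs.simple_mul_simple_cancel_left]
    · rw [hl]; simp; omega
  rcases List.append_eq_append_iff.1 hω with ⟨as, h1, h2⟩ | ⟨bs, h1, h2⟩
  · exact key as h1 h2
  · rcases bs with _ | ⟨c', bs⟩
    · exact key [] (by simpa using h1.symm) (by simpa using h2.symm)
    · obtain ⟨rfl, rfl⟩ : c = c' ∧ v = bs ++ η := by simpa using h2
      exfalso
      have hmem : cs.simple j ∈ cs.leftInvSeq (altWord i j k) := by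
        rw [h1, leftInvSeq_append, ht]
        simp [CoxeterSystem.leftInvSeq]
      rw [leftInvSeq_altWord] at hmem
      obtain ⟨l, hlk, hl'⟩ := List.mem_map.1 hmem
      refine hk l (List.mem_range.1 hlk) ?_
      rw [pow_succ, ← mul_assoc, hl', cs.simple_mul_simple_self]

theorem exists_altWord_prefix {i j : B} (hij : i ≠ j) {x : W} (hi : cs.IsLeftDescent x i)
    (hj : cs.IsLeftDescent x j) (k : ℕ) (hk : C i j = 0 ∨ k ≤ C i j) :
    (∃ η, cs.wordProd (altWord i j k ++ η) = x ∧ cs.length x = k + η.length) ∧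
      ∃ η, cs.wordProd (altWord j i k ++ η) = x ∧ cs.length x = k + η.length := by
  induction k with
  | zero =>
    obtain ⟨ω, hω, rfl⟩ := cs.exists_isReduced x
    exact ⟨⟨ω, by simp, by simpa using hω.eq⟩, ⟨ω, by simp, by simpa using hω.eq⟩⟩
  | succ k ih =>
    obtain ⟨⟨η₁, h1, h1'⟩, ⟨η₂, h2, h2'⟩⟩ := ih (by omega)
    have hne : ∀ l < k, (cs.simple i * cs.simple j) ^ (l + 1) ≠ 1 := by
      intro l hl h
      have hd := dvd_of_simple_mul_simple_pow_eq_one cs hij h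
      rcases hk with h0 | h0
      · rw [h0, zero_dvd_iff] at hd; omega
      · have := Nat.le_of_dvd (by omega) hd; omega
    have hne' : ∀ l < k, (cs.simple j * cs.simple i) ^ (l + 1) ≠ 1 := by
      intro l hl h
      refine hne l hl ?_
      have := congrArg (·⁻¹) h
      simpa [← inv_pow] using this
    exact ⟨exists_altWord_succ_prefix cs h2 h2' hi hne',
      exists_altWord_succ_prefix cs h1 h1' hj hne⟩

/-- An element with two distinct left descents `i`, `j` has reduced words starting with either
alternating word of length `m_{ij}`. -/
theorem exists_braid_prefix {i j : B} (hij : i ≠ j) {x : W} (hi : cs.IsLeftDescent x i)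
    (hj : cs.IsLeftDescent x j) :
    C i j ≠ 0 ∧ ∃ η, cs.wordProd (altWord i j (C i j) ++ η) = x ∧
      cs.wordProd (altWord j i (C i j) ++ η) = x ∧ cs.length x = C i j + η.length := by
  have h0 : C i j ≠ 0 := by
    intro h0
    obtain ⟨⟨η, -, h⟩, -⟩ := exists_altWord_prefix cs hij hi hj (cs.length x + 1) (.inl h0)
    omega
  obtain ⟨⟨η, h1, h2⟩, -⟩ := exists_altWord_prefix cs hij hi hj (C i j) (.inr le_rfl)
  refine ⟨h0, η, h1, ?_, h2⟩
  rw [cs.wordProd_append, ← wordProd_altWord_comm, ← cs.wordProd_append, h1]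

/-- `τ` behaves like a sign function on the reduced words for `w`. -/
def IsBraidSign (w : W) (τ : List B → ℤˣ) : Prop :=
  ∀ i j a b, i ≠ j → IsReducedWord cs w (a ++ altWord i j (C i j) ++ b) →
    τ (a ++ altWord j i (C i j) ++ b) = (-1) ^ (C i j - 1) * τ (a ++ altWord i j (C i j) ++ b)

variable {cs}

/-- A contextual form of Matsumoto's theorem: replacing a factor of a reduced word by another
reduced word for the same element changes the sign by a factor that depends only on these two
factors. -/
theorem IsBraidSign.exists_unit {w : W} {τ : List B → ℤˣ} (hτ : IsBraidSign cs w τ) (n : ℕ) :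
    ∀ v v' : List B, v.length = n → v'.length = n → cs.IsReduced v →
      cs.wordProd v = cs.wordProd v' → ∃ ε : ℤˣ, ∀ a b, IsReducedWord cs w (a ++ v ++ b) →
        τ (a ++ v ++ b) = ε * τ (a ++ v' ++ b) := by
  induction n with
  | zero =>
    intro v v' hv hv' _ _
    rw [List.length_eq_zero_iff] at hv hv'
    subst hv hv'
    exact ⟨1, by simp⟩
  | succ n ih =>
    intro v v' hv hv' hred hprod
    obtain ⟨i, v, rfl⟩ := List.exists_cons_of_length_eq_add_one hv
    obtain ⟨j, v', rfl⟩ := List.exists_cons_of_length_eq_add_one hv'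
    have hred' := isReduced_of_wordProd_eq hred hprod.symm (by rw [hv, hv'])
    simp only [List.length_cons, Nat.add_right_cancel_iff] at hv hv'
    have step : ∀ (i : B) (v v' : List B), v.length = n → v'.length = n →
        cs.IsReduced (i :: v) → cs.wordProd (i :: v) = cs.wordProd (i :: v') →
        ∃ ε : ℤˣ, ∀ a b, IsReducedWord cs w (a ++ (i :: v) ++ b) →
          τ (a ++ (i :: v) ++ b) = ε * τ (a ++ (i :: v') ++ b) := by
      intro i v v' hv hv' hr hp
      rw [cs.wordProd_cons, cs.wordProd_cons] at hp
      obtain ⟨ε, hε⟩ := ih v v' hv hv' (isReduced_of_append_right (ω := [i]) hr)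
        (mul_left_cancel hp)
      refine ⟨ε, fun a b h => ?_⟩
      have := hε (a ++ [i]) b (by simpa using h)
      simpa using this
    by_cases hij : i = j
    · subst hij
      exact step i v v' hv hv' hred hprod
    -- With different first letters, both are left descents. The words are then joined through two
    -- words with the same tail `η` and the two alternating prefixes: equal first letters allow the
    -- induction at either end, and a single braid move connects the middle.
    obtain ⟨h0, η, h1, h2, hlen⟩ := exists_braid_prefix cs hij
      (isLeftDescent_of_isReduced_cons hred) (hprod ▸ isLeftDescent_of_isReduced_cons hred')
    obtain ⟨p, hp⟩ := Nat.exists_eq_add_one_of_ne_zero h0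
    have hlen' : n = p + η.length := by
      rw [hred.eq, hp, List.length_cons, hv] at hlen; omega
    rw [hp, altWord_succ, List.cons_append] at h1 h2
    obtain ⟨ε₁, hε₁⟩ := step i v (altWord j i p ++ η) hv (by simp [hlen']) hred h1.symm
    obtain ⟨ε₂, hε₂⟩ := step j (altWord i j p ++ η) v' (by simp [hlen']) hv'
      (isReduced_of_wordProd_eq hred h2 (by simp [hlen', hv])) (h2.trans hprod)
    refine ⟨ε₁ * (-1) ^ p * ε₂, fun a b h => ?_⟩
    have e1 := hε₁ a b h
    have r1 : IsReducedWord cs w (a ++ (i :: (altWord j i p ++ η)) ++ b) :=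
      h.congr (by simp only [cs.wordProd_append, h1]) (by simp [hv, hlen']; omega)
    have r2 : IsReducedWord cs w (a ++ (j :: (altWord i j p ++ η)) ++ b) :=
      h.congr (by simp only [cs.wordProd_append, h2]) (by simp [hv, hlen']; omega)
    have e2 := hε₂ a b r2
    have e3 := hτ j i a (η ++ b) (Ne.symm hij) (by
      rw [C.symmetric, hp, altWord_succ]; simpa using r2)
    rw [C.symmetric, hp, altWord_succ, altWord_succ] at e3
    simp only [List.append_assoc, List.cons_append, Nat.add_sub_cancel] at e1 e2 e3 ⊢
    rw [e1, e3, e2]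
    simp only [mul_assoc]

/-- Moving a letter through a factor of length `n` of a reduced word multiplies a sign function
by `(-1)^n`. -/
theorem IsBraidSign.flip {w : W} {τ : List B → ℤˣ} (hτ : IsBraidSign cs w τ) (v : List B) :
    ∀ (s s' : B) (a b : List B), cs.simple s * cs.wordProd v = cs.wordProd v * cs.simple s' →
      IsReducedWord cs w (a ++ (s :: v) ++ b) →
      τ (a ++ (s :: v) ++ b) = (-1) ^ v.length * τ (a ++ (v ++ [s']) ++ b) := by
  induction hn : v.length using Nat.strong_induction_on generalizing v with
  | _ n ih =>
    subst hn
    intro s s' a b hprod h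
    rcases v with _ | ⟨t, v⟩
    · obtain rfl : s = s' := simple_injective cs (by simpa using hprod)
      simp
    have hred : cs.IsReduced (s :: t :: v) :=
      isReduced_of_append_right (isReduced_of_append_left h.isReduced)
    have hst : s ≠ t := by
      rintro rfl
      have := hred.eq
      rw [cs.wordProd_cons, cs.wordProd_cons, cs.simple_mul_simple_cancel_left] at this
      have h' := cs.length_wordProd_le v
      simp at this
      omega
    have hprod' : cs.wordProd (s :: t :: v) = cs.wordProd (t :: v ++ [s']) := by
      rw [cs.wordProd_cons, hprod, cs.wordProd_append, cs.wordProd_singleton]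
    have hred' : cs.IsReduced (t :: (v ++ [s'])) :=
      isReduced_of_wordProd_eq hred hprod'.symm (by simp)
    obtain ⟨h0, η, h1, h2, hlen⟩ := exists_braid_prefix cs hst
      (isLeftDescent_of_isReduced_cons hred) (hprod' ▸ isLeftDescent_of_isReduced_cons hred')
    obtain ⟨p, hp⟩ := Nat.exists_eq_add_one_of_ne_zero h0
    have hp1 : p ≠ 0 := by
      rintro rfl
      exact C.off_diagonal s t hst hp
    have hlen' : v.length + 1 = p + η.length := by
      rw [hred.eq, hp] at hlen
      simp at hlen
      omega
    rw [hp] at h1 h2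
    rw [altWord_succ, List.cons_append, cs.wordProd_cons, cs.wordProd_cons s] at h1
    have h1' := mul_left_cancel h1
    rw [altWord_succ_last] at h2
    set s'' := if Even p then t else s with hs''
    set c := altWord t s p with hc
    have hclen : c.length = p := by simp [hc]
    have hη : cs.simple s'' * cs.wordProd η = cs.wordProd η * cs.simple s' := by
      have e : cs.wordProd (c ++ [s''] ++ η) = cs.wordProd (c ++ η) * cs.simple s' := by
        rw [h2, h1', cs.wordProd_cons s, hprod]
      simp only [cs.wordProd_append, cs.wordProd_singleton, mul_assoc] at e
      exact mul_left_cancel e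
    -- The factor `t :: v` is replaced by `c ++ η` both before and after the letter has moved, so
    -- the unknown unit `ε` occurs twice and cancels. What remains is a braid move carrying the
    -- letter through `c`, with sign `(-1)^p`, and the induction carrying `s''` through the shorter
    -- `η`.
    obtain ⟨ε, hε⟩ := hτ.exists_unit (v.length + 1) (t :: v) (c ++ η) (by simp)
      (by simp [hlen', hclen]) (isReduced_of_append_right (ω := [s]) hred) h1'.symm
    have r1 : IsReducedWord cs w (a ++ (t :: v ++ [s']) ++ b) :=
      h.congr (by simp only [cs.wordProd_append a, cs.wordProd_append _ b, hprod']) (by simp; omega)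
    have r2 : IsReducedWord cs w (a ++ (s :: c) ++ (η ++ b)) := by
      refine h.congr ?_ (by simp [hclen]; omega)
      simp only [cs.wordProd_append, cs.wordProd_cons s] at h1' ⊢
      rw [← h1']
      simp only [mul_assoc]
    have r3 : IsReducedWord cs w (a ++ c ++ (s'' :: η) ++ b) := by
      refine h.congr ?_ (by simp [hclen]; omega)
      simp only [cs.wordProd_append] at h2 ⊢
      rw [← h2]
      simp only [mul_assoc, cs.wordProd_cons s'', cs.wordProd_nil, one_mul]
    have e1 := hε (a ++ [s]) b (by simpa using h)
    have e2 := hε a (s' :: b) (by simpa using r1)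
    have e3 := hτ s t a (η ++ b) hst (by rw [hp, altWord_succ]; exact r2)
    rw [hp, altWord_succ s t, altWord_succ_last t s, ← hc, ← hs''] at e3
    have e4 := ih η.length (by simp; omega) η rfl s'' s' (a ++ c) b hη r3
    simp only [List.append_assoc, List.cons_append, Nat.add_sub_cancel, List.nil_append,
      List.length_cons] at e1 e2 e3 e4 ⊢
    rw [e1, e2]
    have e5 : τ (a ++ s :: (c ++ (η ++ b))) = (-1) ^ p * τ (a ++ (c ++ s'' :: (η ++ b))) := by
      rw [e3, ← mul_assoc, ← pow_add, ← two_mul]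
      simp
    rw [e5, e4, hlen', pow_add]
    ac_rfl

end Matsumoto

end SubwordFan

namespace SubwordFan

/-! ### The effect of reversing a block of a list on the order of two entries. -/

section ListOrder

variable {α : Type*} [DecidableEq α]

/-- The sign recording whether `p.1` stands before `p.2` in the list `L`. -/
def orderSign (L : List α) (p : α × α) : ℤˣ := if L.idxOf p.1 < L.idxOf p.2 then 1 else -1

theorem idxOf_reverse_add {X : List α} (hX : X.Nodup) {t : α} (ht : t ∈ X) :
    X.reverse.idxOf t + X.idxOf t + 1 = X.length := by
  have h := List.idxOf_lt_length_of_mem ht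
  have h' : X.length - 1 - X.idxOf t < X.reverse.length := by simp; omega
  have hg : X.reverse[X.length - 1 - X.idxOf t] = t := by
    rw [List.getElem_reverse]
    have : X.length - 1 - (X.length - 1 - X.idxOf t) = X.idxOf t := by omega
    simp [this]
  have := (List.nodup_reverse.2 hX).idxOf_getElem _ h'
  rw [hg] at this
  omega

theorem idxOf_append_append {L₁ X L₂ : List α} (t : α) :
    (t ∈ L₁ ∧ (L₁ ++ X ++ L₂).idxOf t = L₁.idxOf t ∧ L₁.idxOf t < L₁.length) ∨
      (t ∉ L₁ ∧ t ∈ X ∧ (L₁ ++ X ++ L₂).idxOf t = L₁.length + X.idxOf t ∧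
        X.idxOf t < X.length) ∨
      (t ∉ L₁ ∧ t ∉ X ∧ (L₁ ++ X ++ L₂).idxOf t = L₁.length + X.length + L₂.idxOf t) := by
  by_cases h1 : t ∈ L₁
  · refine .inl ⟨h1, ?_, List.idxOf_lt_length_of_mem h1⟩
    rw [List.append_assoc, List.idxOf_append_of_mem h1]
  by_cases h2 : t ∈ X
  · refine .inr (.inl ⟨h1, h2, ?_, List.idxOf_lt_length_of_mem h2⟩)
    rw [List.append_assoc, List.idxOf_append_of_notMem h1, List.idxOf_append_of_mem h2]
  · refine .inr (.inr ⟨h1, h2, ?_⟩)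
    rw [List.append_assoc, List.idxOf_append_of_notMem h1, List.idxOf_append_of_notMem h2]
    omega

/-- Only pairs lying entirely in the block change their order. Entries need not occur in the list:
`idxOf` of an absent entry is the length, which the reversal preserves. -/
theorem orderSign_reverse {L₁ X L₂ : List α} (hL : (L₁ ++ X ++ L₂).Nodup) {p : α × α}
    (hp : p.1 ≠ p.2) [Decidable (p.1 ∈ X ∧ p.2 ∈ X)] :
    orderSign (L₁ ++ X.reverse ++ L₂) p =
      (if p.1 ∈ X ∧ p.2 ∈ X then -1 else 1) * orderSign (L₁ ++ X ++ L₂) p := by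
  have hX : X.Nodup := (List.nodup_append.1 (List.nodup_append.1 hL).1).2.1
  have hd : ∀ t ∈ L₁, t ∉ X := fun t ht ht' =>
    (List.nodup_append.1 (List.nodup_append.1 hL).1).2.2 t ht t ht' rfl
  have hne : p.1 ∈ X → p.2 ∈ X → X.idxOf p.1 ≠ X.idxOf p.2 := fun ha hb h =>
    hp ((List.idxOf_inj ha).1 h)
  have hr1 := fun h : p.1 ∈ X => idxOf_reverse_add hX h
  have hr2 := fun h : p.2 ∈ X => idxOf_reverse_add hX h
  have a1 := idxOf_append_append (L₁ := L₁) (X := X) (L₂ := L₂) p.1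
  have a2 := idxOf_append_append (L₁ := L₁) (X := X) (L₂ := L₂) p.2
  have a1' := idxOf_append_append (L₁ := L₁) (X := X.reverse) (L₂ := L₂) p.1
  have a2' := idxOf_append_append (L₁ := L₁) (X := X.reverse) (L₂ := L₂) p.2
  simp only [List.mem_reverse, List.length_reverse] at a1' a2'
  unfold orderSign
  by_cases hx1 : p.1 ∈ X <;> by_cases hx2 : p.2 ∈ X
  · have hn1 : p.1 ∉ L₁ := fun h => hd _ h hx1
    have hn2 : p.2 ∉ L₁ := fun h => hd _ h hx2
    have := hne hx1 hx2
    have := hr1 hx1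
    have := hr2 hx2
    simp only [hx1, hx2, hn1, hn2, not_true_eq_false, not_false_eq_true, true_and, false_and,
      false_or, or_false] at a1 a2 a1' a2'
    rw [a1.1, a2.1, a1'.1, a2'.1]
    simp only [hx1, hx2, and_self, if_true]
    split_ifs <;> first | rfl | omega
  all_goals
    simp only [hx1, hx2, not_true_eq_false, not_false_eq_true, true_and, false_and, and_false,
      false_or, or_false, if_false, one_mul] at a1 a2 a1' a2' ⊢
    congr 1
    simp only [eq_iff_iff]
    by_cases hl1 : p.1 ∈ L₁ <;> by_cases hl2 : p.2 ∈ L₁ <;>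
    · simp only [hl1, hl2, not_true_eq_false, not_false_eq_true, true_and, false_and,
        false_or, or_false] at a1 a2 a1' a2'
      omega

end ListOrder

/-! ### Standard dihedral subgroups and their conjugates. -/

section Dihedral

variable {B W : Type*} [Group W] {C : CoxeterMatrix B} (cs : CoxeterSystem C W)

theorem orderOf_simple_mul_simple {i j : B} (hij : i ≠ j) :
    orderOf (cs.simple i * cs.simple j) = C i j :=
  Nat.dvd_antisymm (orderOf_dvd_of_pow_eq_one (cs.simple_mul_simple_pow i j))
    (dvd_of_simple_mul_simple_pow_eq_one cs hij (pow_orderOf_eq_one _))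

theorem isReduced_altWord {i j : B} (hij : i ≠ j) {n : ℕ} (hn : n ≤ C i j) :
    cs.IsReduced (altWord i j n) := by
  refine isReduced_of_nodup_leftInvSeq cs ?_
  rw [leftInvSeq_altWord]
  refine List.Nodup.map_on (fun k hk l hl h => ?_) List.nodup_range
  rw [List.mem_range] at hk hl
  have := orderOf_simple_mul_simple cs hij
  exact pow_injOn_Iio_orderOf (by rw [Set.mem_Iio]; omega) (by rw [Set.mem_Iio]; omega)
    (mul_right_cancel h)

theorem wordProd_altWord_compl (i j : B) {n : ℕ} (hn : n ≤ 2 * C i j) :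
    cs.wordProd (altWord i j n) = cs.wordProd (altWord j i (2 * C i j - n)) := by
  have h1 := cs.prod_alternatingWord_eq_prod_alternatingWord_sub i j n (by omega)
  have h2 := cs.prod_alternatingWord_eq_prod_alternatingWord_sub j i n
    (by rw [C.symmetric j i]; omega)
  rw [C.symmetric j i] at h2
  rw [mul_comm] at h1 h2
  have hpar : Even (2 * C i j - n) ↔ Even n := by
    rw [Nat.even_sub hn]; simp
  rw [altWord_eq_alternatingWord, altWord_eq_alternatingWord]
  by_cases h : Even n
  · rw [if_pos h, if_pos (hpar.2 h), h1]
  · rw [if_neg h, if_neg (mt hpar.1 h), h2]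

/-- The entries are alternating words of odd length, and those of lengths `2k + 1` and `2m - (2k +
1)` with opposite first letters agree. So the two sides of a braid move list the same reflections in
opposite orders. -/
theorem leftInvSeq_altWord_comm (i j : B) :
    cs.leftInvSeq (altWord j i (C i j)) = (cs.leftInvSeq (altWord i j (C i j))).reverse := by
  rw [leftInvSeq_altWord, leftInvSeq_altWord]
  refine List.ext_getElem (by simp) fun k hk _ => ?_
  simp only [List.length_map, List.length_range] at hk
  simp only [List.getElem_map, List.getElem_range, List.getElem_reverse, List.length_map,
    List.length_range]
  rw [← wordProd_altWord_two_mul_add_one, ← wordProd_altWord_two_mul_add_one,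
    wordProd_altWord_compl cs i j (by omega)]
  congr 2
  omega

/-- The standard dihedral subgroup generated by two simple reflections. -/
def stdDihedral (i j : B) : Subgroup W := Subgroup.closure {cs.simple i, cs.simple j}

theorem simple_left_mem_stdDihedral (i j : B) : cs.simple i ∈ stdDihedral cs i j :=
  Subgroup.subset_closure (by simp)

theorem simple_right_mem_stdDihedral (i j : B) : cs.simple j ∈ stdDihedral cs i j :=
  Subgroup.subset_closure (by simp)

theorem exists_altWord_of_mem_stdDihedral {i j : B} (h0 : C i j ≠ 0) {d : W}
    (hd : d ∈ stdDihedral cs i j) :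
    ∃ n ≤ C i j, d = cs.wordProd (altWord i j n) ∨ d = cs.wordProd (altWord j i n) := by
  have step : ∀ (i j : B) (d : W), C i j ≠ 0 →
      (∃ n ≤ C i j, d = cs.wordProd (altWord i j n) ∨ d = cs.wordProd (altWord j i n)) →
      ∃ n ≤ C i j, cs.simple i * d = cs.wordProd (altWord i j n) ∨
        cs.simple i * d = cs.wordProd (altWord j i n) := by
    rintro i j d h0 ⟨n, hn, rfl | rfl⟩
    · rcases n with _ | n
      · exact ⟨1, by omega, .inl (by simp [altWord])⟩
      · refine ⟨n, by omega, .inr ?_⟩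
        rw [altWord_succ, cs.wordProd_cons, cs.simple_mul_simple_cancel_left]
    · by_cases hn' : n = C i j
      · refine ⟨2 * C i j - (n + 1), by omega, .inr ?_⟩
        rw [← wordProd_altWord_compl cs i j (by omega), altWord_succ, cs.wordProd_cons]
      · exact ⟨n + 1, by omega, .inl (by rw [altWord_succ, cs.wordProd_cons])⟩
  have step' : ∀ x ∈ ({cs.simple i, cs.simple j} : Set W), ∀ d : W,
      (∃ n ≤ C i j, d = cs.wordProd (altWord i j n) ∨ d = cs.wordProd (altWord j i n)) →
      ∃ n ≤ C i j, x * d = cs.wordProd (altWord i j n) ∨ x * d = cs.wordProd (altWord j i n) := by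
    rintro x (rfl | rfl) d h
    · exact step i j d h0 h
    · obtain ⟨n, hn, h⟩ := h
      obtain ⟨n', hn', h'⟩ := step j i d (by rwa [C.symmetric])
        ⟨n, by rwa [C.symmetric], h.symm⟩
      exact ⟨n', by rwa [C.symmetric], h'.symm⟩
  refine Subgroup.closure_induction_left (p := fun d _ => ∃ n ≤ C i j,
    d = cs.wordProd (altWord i j n) ∨ d = cs.wordProd (altWord j i n)) ?_ ?_ ?_ hd
  · exact ⟨0, by omega, by simp⟩
  · exact fun x hx y _ h => step' x hx y h
  · intro x hx y _ h
    have : x⁻¹ = x := by rcases hx with rfl | rfl <;> simp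
    rw [this]
    exact step' x hx y h

theorem exists_isLeftDescent_of_mem_stdDihedral {i j : B} (hij : i ≠ j) (h0 : C i j ≠ 0) {d : W}
    (hd : d ∈ stdDihedral cs i j) (h1 : d ≠ 1) :
    ∃ c, (c = i ∨ c = j) ∧ cs.IsLeftDescent d c := by
  obtain ⟨n, hn, h⟩ := exists_altWord_of_mem_stdDihedral cs h0 hd
  rcases n with _ | n
  · simp at h; contradiction
  rcases h with rfl | rfl
  · exact ⟨i, .inl rfl, isLeftDescent_of_isReduced_cons (isReduced_altWord cs hij hn)⟩
  · exact ⟨j, .inr rfl, isLeftDescent_of_isReduced_cons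
      (isReduced_altWord cs hij.symm (n := n + 1) (by rwa [C.symmetric]))⟩

/-- The reflections of a standard dihedral subgroup are the entries of the left inversion sequence
of its longest element. -/
theorem mem_leftInvSeq_of_mem_stdDihedral {i j : B} (hij : i ≠ j) (h0 : C i j ≠ 0) {t : W}
    (ht : cs.IsReflection t) (hd : t ∈ stdDihedral cs i j) :
    t ∈ cs.leftInvSeq (altWord i j (C i j)) := by
  have key : ∀ n < C i j, t = cs.wordProd (altWord i j (2 * n + 1)) →
      t ∈ cs.leftInvSeq (altWord i j (C i j)) := by
    intro n hn h
    rw [leftInvSeq_altWord, List.mem_map]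
    exact ⟨n, List.mem_range.2 hn, by rw [h, wordProd_altWord_two_mul_add_one]⟩
  obtain ⟨n, hn, h⟩ := exists_altWord_of_mem_stdDihedral cs h0 hd
  have hodd := ht.odd_length
  rcases h with h | h
  · rw [h, (isReduced_altWord cs hij hn).eq, length_altWord] at hodd
    obtain ⟨k, rfl⟩ := hodd
    exact key k (by omega) h
  · rw [h, (isReduced_altWord cs hij.symm (by rwa [C.symmetric])).eq, length_altWord] at hodd
    obtain ⟨k, rfl⟩ := hodd
    refine key (C i j - k - 1) (by omega) ?_
    rw [h, wordProd_altWord_compl cs i j (by omega)]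
    congr 2
    omega

theorem mem_stdDihedral_of_mem_leftInvSeq {i j : B} {n : ℕ} {t : W}
    (ht : t ∈ cs.leftInvSeq (altWord i j n)) : t ∈ stdDihedral cs i j := by
  rw [leftInvSeq_altWord, List.mem_map] at ht
  obtain ⟨k, -, rfl⟩ := ht
  exact mul_mem (pow_mem (mul_mem (simple_left_mem_stdDihedral cs i j)
    (simple_right_mem_stdDihedral cs i j)) k) (simple_left_mem_stdDihedral cs i j)

/-- If `y` is shortest in its coset of a standard dihedral subgroup, then a reflection of this
subgroup which is conjugate by `y` to a simple reflection is simple. -/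
theorem eq_simple_of_isMin {i j k : B} (hij : i ≠ j) (h0 : C i j ≠ 0) {y : W}
    (hy : ∀ d ∈ stdDihedral cs i j, cs.length y ≤ cs.length (d * y))
    (hk : y * cs.simple k * y⁻¹ ∈ stdDihedral cs i j) :
    y * cs.simple k * y⁻¹ = cs.simple i ∨ y * cs.simple k * y⁻¹ = cs.simple j := by
  have hsimple : ∀ c, c = i ∨ c = j → cs.simple c ∈ stdDihedral cs i j := by
    rintro c (rfl | rfl)
    · exact simple_left_mem_stdDihedral cs _ _
    · exact simple_right_mem_stdDihedral cs _ _
  -- A left descent of `d` remains one of `d * y`: in the parity cocycle the contribution of `y`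
  -- vanishes, because no reflection of the subgroup shortens the minimal `y`.
  have key : ∀ d ∈ stdDihedral cs i j, d ≠ 1 →
      ∃ c, (c = i ∨ c = j) ∧ cs.length (cs.simple c * (d * y)) < cs.length (d * y) := by
    intro d hd hd1
    obtain ⟨c, hc, hdesc⟩ := exists_isLeftDescent_of_mem_stdDihedral cs hij h0 hd hd1
    refine ⟨c, hc, ?_⟩
    have hr := cs.isReflection_simple c
    have hr' : cs.IsReflection (d⁻¹ * cs.simple c * d) := by simpa using hr.conj d⁻¹
    rw [← invParity_eq_one_iff cs hr, invParity_mul, (invParity_eq_one_iff cs hr d).2 hdesc]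
    have hn : invParity cs y (d⁻¹ * cs.simple c * d) ≠ 1 := by
      rw [Ne, invParity_eq_one_iff cs hr', not_lt]
      exact hy _ (mul_mem (mul_mem (inv_mem hd) (hsimple c hc)) hd)
    have : invParity cs y (d⁻¹ * cs.simple c * d) = 0 := by
      generalize invParity cs y (d⁻¹ * cs.simple c * d) = z at hn ⊢
      revert z; decide
    rw [this, add_zero]
  set t := y * cs.simple k * y⁻¹ with ht
  have hty : t * y = y * cs.simple k := by rw [ht]; group
  have ht1 : t ≠ 1 := by
    intro h
    rw [h, one_mul] at hty
    exact cs.length_mul_simple_ne y k (by rw [← hty])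
  obtain ⟨c, hc, hlt⟩ := key t hk ht1
  have hle : cs.length (t * y) ≤ cs.length y + 1 := by
    rw [hty]; simpa using cs.length_mul_le y (cs.simple k)
  -- Since `t * y = y * s_k` has length at most `ℓ(y) + 1`, one descent already brings it down to at
  -- most `ℓ(y)`. If `s_c * t ≠ 1`, a second descent would go below the minimum.
  have : cs.simple c * t = 1 := by
    by_contra hne
    obtain ⟨c', hc', hlt'⟩ := key _ (mul_mem (hsimple c hc) hk) hne
    have := hy _ (mul_mem (hsimple c' hc') (mul_mem (hsimple c hc) hk))
    simp only [mul_assoc] at hlt hlt' this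
    omega
  have hct : t = cs.simple c := by
    rw [← cs.inv_simple c]; exact eq_inv_of_mul_eq_one_right this
  rcases hc with rfl | rfl
  · exact .inl hct
  · exact .inr hct

/-- The conjugate by `u` of a standard dihedral subgroup. -/
def conjDihedral (u : W) (i j : B) : Subgroup W :=
  (stdDihedral cs i j).map (MulAut.conj u).toMonoidHom

theorem mem_conjDihedral {u : W} {i j : B} {g : W} :
    g ∈ conjDihedral cs u i j ↔ u⁻¹ * g * u ∈ stdDihedral cs i j := by
  constructor
  · rintro ⟨d, hd, rfl⟩
    have : u⁻¹ * (MulAut.conj u).toMonoidHom d * u = d := by simp [mul_assoc]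
    rw [this]
    exact hd
  · intro h
    exact ⟨_, h, by simp [mul_assoc]⟩

theorem conjDihedral_eq_closure (u : W) (i j : B) :
    conjDihedral cs u i j =
      Subgroup.closure {u * cs.simple i * u⁻¹, u * cs.simple j * u⁻¹} := by
  rw [conjDihedral, stdDihedral, MonoidHom.map_closure, Set.image_pair]
  rfl

/-- A conjugate of a standard dihedral subgroup is determined by two of its reflections. -/
theorem conjDihedral_rigid {i j k l : B} (hij : i ≠ j) (hkl : k ≠ l) (h0 : C i j ≠ 0) {u v : W}
    (hk : v * cs.simple k * v⁻¹ ∈ conjDihedral cs u i j)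
    (hl : v * cs.simple l * v⁻¹ ∈ conjDihedral cs u i j) :
    conjDihedral cs v k l = conjDihedral cs u i j ∧ C k l = C i j := by
  rw [mem_conjDihedral] at hk hl
  set f : stdDihedral cs i j → ℕ := fun d => cs.length (d * (u⁻¹ * v)) with hf
  -- Conjugating by `u⁻¹` and by an element of the subgroup reduces the problem to a shortest coset
  -- representative `y`. Then both reflections become simple, so they are the standard generators in
  -- some order.
  obtain ⟨⟨a, ha⟩, hmin⟩ : ∃ a, ∀ b, f a ≤ f b :=
    ⟨Function.argmin f, fun b => Function.argmin_le f b⟩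
  set y := a * (u⁻¹ * v) with hy
  have hv : v = u * a⁻¹ * y := by rw [hy]; group
  have hymin : ∀ d ∈ stdDihedral cs i j, cs.length y ≤ cs.length (d * y) := by
    intro d hd
    have := hmin ⟨d * a, mul_mem hd ha⟩
    simpa only [hf, hy, mul_assoc] using this
  have hconj : ∀ c, u⁻¹ * (v * cs.simple c * v⁻¹) * u ∈ stdDihedral cs i j →
      y * cs.simple c * y⁻¹ ∈ stdDihedral cs i j := by
    intro c hc
    have : y * cs.simple c * y⁻¹ = a * (u⁻¹ * (v * cs.simple c * v⁻¹) * u) * a⁻¹ := by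
      rw [hy]; group
    rw [this]
    exact mul_mem (mul_mem ha hc) (inv_mem ha)
  have hk' := eq_simple_of_isMin cs hij h0 hymin (hconj k hk)
  have hl' := eq_simple_of_isMin cs hij h0 hymin (hconj l hl)
  have hne : y * cs.simple k * y⁻¹ ≠ y * cs.simple l * y⁻¹ := fun h =>
    hkl (simple_injective cs (mul_left_cancel (mul_right_cancel h)))
  have hpow : ∀ n : ℕ, (cs.simple k * cs.simple l) ^ n = 1 ↔
      ((y * cs.simple k * y⁻¹) * (y * cs.simple l * y⁻¹)) ^ n = 1 := by
    intro n
    have : (y * cs.simple k * y⁻¹) * (y * cs.simple l * y⁻¹) =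
        y * (cs.simple k * cs.simple l) * y⁻¹ := by group
    rw [this, conj_pow, conj_eq_one_iff]
  have hord : orderOf (cs.simple k * cs.simple l) =
      orderOf ((y * cs.simple k * y⁻¹) * (y * cs.simple l * y⁻¹)) :=
    orderOf_eq_orderOf_iff.2 hpow
  have hmain : conjDihedral cs y k l = stdDihedral cs i j ∧ C k l = C i j := by
    rw [conjDihedral_eq_closure, stdDihedral, ← orderOf_simple_mul_simple cs hkl,
      ← orderOf_simple_mul_simple cs hij, hord]
    rcases hk' with h1 | h1 <;> rcases hl' with h2 | h2
    · exact absurd (h1.trans h2.symm) hne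
    · rw [h1, h2]; exact ⟨rfl, rfl⟩
    · rw [h1, h2, Set.pair_comm, orderOf_simple_mul_simple cs hij,
        orderOf_simple_mul_simple cs hij.symm]
      exact ⟨rfl, C.symmetric j i⟩
    · exact absurd (h1.trans h2.symm) hne
  refine ⟨?_, hmain.2⟩
  ext g
  have h1 : g ∈ conjDihedral cs v k l ↔ a * (u⁻¹ * g * u) * a⁻¹ ∈ conjDihedral cs y k l := by
    rw [mem_conjDihedral, mem_conjDihedral]
    have : v⁻¹ * g * v = y⁻¹ * (a * (u⁻¹ * g * u) * a⁻¹) * y := by rw [hv]; group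
    rw [this]
  rw [h1, hmain.1, mem_conjDihedral]
  constructor
  · intro h
    have := mul_mem (mul_mem (inv_mem ha) h) ha
    have e : a⁻¹ * (a * (u⁻¹ * g * u) * a⁻¹) * a = u⁻¹ * g * u := by group
    rwa [e] at this
  · intro h
    exact mul_mem (mul_mem ha h) (inv_mem ha)

end Dihedral

/-! ### Existence of sign functions. -/

section SignFunction

variable {B W : Type*} [Group W] {C : CoxeterMatrix B} (cs : CoxeterSystem C W)

/-- The conjugates of the standard dihedral subgroups of even type. -/
def IsEvenDihedral (H : Subgroup W) : Prop :=
  ∃ v k l, k ≠ l ∧ Even (C k l) ∧ H = conjDihedral cs v k l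

open Classical in
/-- A pair of generating reflections of a conjugate of a standard dihedral subgroup of even type. -/
noncomputable def dihedralPair (H : Subgroup W) : W × W :=
  if h : IsEvenDihedral cs H then
    (h.choose * cs.simple h.choose_spec.choose * h.choose⁻¹,
      h.choose * cs.simple h.choose_spec.choose_spec.choose * h.choose⁻¹)
  else (1, 1)

theorem dihedralPair_spec {H : Subgroup W} (h : IsEvenDihedral cs H) :
    ∃ v k l, k ≠ l ∧ Even (C k l) ∧ H = conjDihedral cs v k l ∧
      dihedralPair cs H = (v * cs.simple k * v⁻¹, v * cs.simple l * v⁻¹) := by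
  obtain ⟨h1, h2, h3⟩ := h.choose_spec.choose_spec.choose_spec
  exact ⟨_, _, _, h1, h2, h3, by rw [dihedralPair, dif_pos h]⟩

open Classical in
/-- The product over all dihedral subgroups of even type of the sign of the order in which a word
lists two fixed generating reflections. -/
noncomputable def canonicalSign [Finite W] (ω : List B) : ℤˣ :=
  letI := Fintype.ofFinite (Subgroup W)
  ∏ H ∈ Finset.univ.filter (IsEvenDihedral cs), orderSign (cs.leftInvSeq ω) (dihedralPair cs H)

theorem matrix_ne_zero_of_finite (cs : CoxeterSystem C W) [Finite W] {i j : B} (hij : i ≠ j) : C i j ≠ 0 := by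
  rw [← orderOf_simple_mul_simple cs hij]
  exact (orderOf_pos _).ne'

/-- A braid move after the prefix `a` reverses the block of reflections of one conjugate dihedral
subgroup. By rigidity the chosen pair of another subgroup does not lie in this block, so only the
factor of this subgroup can change; it is present iff `C i j` is even, which produces `(-1)^(C i j -
1)`. -/
theorem isBraidSign_canonicalSign [Finite W] (w : W) :
    IsBraidSign cs w (canonicalSign cs) := by
  classical
  intro i j a b hij hω
  have h0 := matrix_ne_zero_of_finite cs hij
  set u := cs.wordProd a with hu
  set X := (cs.leftInvSeq (altWord i j (C i j))).map (MulAut.conj u) with hX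
  set L₁ := cs.leftInvSeq a
  set L₂ := (cs.leftInvSeq b).map (MulAut.conj (cs.wordProd (a ++ altWord i j (C i j))))
  have e1 : cs.leftInvSeq (a ++ altWord i j (C i j) ++ b) = L₁ ++ X ++ L₂ := by
    rw [leftInvSeq_append, leftInvSeq_append]
  have e2 : cs.leftInvSeq (a ++ altWord j i (C i j) ++ b) = L₁ ++ X.reverse ++ L₂ := by
    rw [leftInvSeq_append, leftInvSeq_append, cs.wordProd_append, ← wordProd_altWord_comm,
      ← cs.wordProd_append, leftInvSeq_altWord_comm, List.map_reverse]
  have hnodup : (L₁ ++ X ++ L₂).Nodup := e1 ▸ hω.isReduced.nodup_leftInvSeq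
  have hXmem : ∀ t, cs.IsReflection t → (t ∈ X ↔ t ∈ conjDihedral cs u i j) := by
    intro t ht
    rw [hX, List.mem_map, mem_conjDihedral]
    constructor
    · rintro ⟨d, hd, rfl⟩
      have : u⁻¹ * MulAut.conj u d * u = d := by simp [mul_assoc]
      rw [this]
      exact mem_stdDihedral_of_mem_leftInvSeq cs hd
    · intro h
      refine ⟨u⁻¹ * t * u, mem_leftInvSeq_of_mem_stdDihedral cs hij h0 ?_ h, by simp [mul_assoc]⟩
      simpa using ht.conj u⁻¹
  have hterm : ∀ H, IsEvenDihedral cs H →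
      orderSign (L₁ ++ X.reverse ++ L₂) (dihedralPair cs H) =
        (if H = conjDihedral cs u i j then -1 else 1) *
          orderSign (L₁ ++ X ++ L₂) (dihedralPair cs H) := by
    intro H hH
    obtain ⟨v, k, l, hkl, heven, rfl, hpair⟩ := dihedralPair_spec cs hH
    have hr : ∀ c, cs.IsReflection (v * cs.simple c * v⁻¹) := fun c => ⟨v, c, rfl⟩
    have hne : v * cs.simple k * v⁻¹ ≠ v * cs.simple l * v⁻¹ := fun h =>
      hkl (simple_injective cs (mul_left_cancel (mul_right_cancel h)))
    rw [orderSign_reverse hnodup (by rwa [hpair]), hpair]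
    congr 2
    rw [eq_iff_iff, hXmem _ (hr k), hXmem _ (hr l)]
    constructor
    · exact fun h => (conjDihedral_rigid cs hij hkl h0 h.1 h.2).1
    · intro h
      rw [← h, conjDihedral_eq_closure]
      exact ⟨Subgroup.subset_closure (by simp), Subgroup.subset_closure (by simp)⟩
  have heven : IsEvenDihedral cs (conjDihedral cs u i j) ↔ Even (C i j) := by
    refine ⟨fun ⟨v, k, l, hkl, he, h⟩ => ?_, fun h => ⟨u, i, j, hij, h, rfl⟩⟩
    rw [← (conjDihedral_rigid cs hij hkl h0 (u := u) (v := v) ?_ ?_).2]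
    · exact he
    all_goals
      rw [h, conjDihedral_eq_closure]
      exact Subgroup.subset_closure (by simp)
  let _ := Fintype.ofFinite (Subgroup W)
  have hprod : canonicalSign cs (a ++ altWord j i (C i j) ++ b) =
      (∏ H ∈ Finset.univ.filter (IsEvenDihedral cs),
        if H = conjDihedral cs u i j then (-1 : ℤˣ) else 1) *
          canonicalSign cs (a ++ altWord i j (C i j) ++ b) := by
    rw [canonicalSign, canonicalSign, e1, e2, ← Finset.prod_mul_distrib]
    exact Finset.prod_congr rfl fun H hH => hterm H (Finset.mem_filter.1 hH).2
  rw [hprod, Finset.prod_ite_eq']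
  congr 1
  simp only [Finset.mem_filter, Finset.mem_univ, true_and, heven]
  obtain ⟨p, hp⟩ := Nat.exists_eq_add_one_of_ne_zero h0
  rw [hp, Nat.add_sub_cancel]
  split_ifs with h
  · rw [Nat.even_add_one, Nat.not_even_iff_odd] at h
    rw [h.neg_one_pow]
  · rw [Nat.even_add_one, not_not] at h
    rw [h.neg_one_pow]

/-- `altWord` fixes the first letter and `braidWord` the last one, so the parity of `C i j` decides
which of the two words is which. -/
theorem altWord_eq_braidWord (C : CoxeterMatrix B) (i j : B) :
    (altWord i j (C i j) = CoxeterSystem.braidWord C i j ∧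
        altWord j i (C i j) = CoxeterSystem.braidWord C j i) ∨
      (altWord i j (C i j) = CoxeterSystem.braidWord C j i ∧
        altWord j i (C i j) = CoxeterSystem.braidWord C i j) := by
  unfold CoxeterSystem.braidWord
  rw [C.symmetric j i, altWord_eq_alternatingWord, altWord_eq_alternatingWord]
  split_ifs <;> simp

/-- A function on words which behaves like a sign function on the reduced words restricts to a
sign function. -/
theorem isSignFunction_of_isBraidSign {w : W} {τ : List B → ℤˣ} (hτ : IsBraidSign cs w τ) :
    IsSignFunction cs w fun ω => τ ω.1 := by
  rintro i j ⟨ω, hω⟩ ⟨ω', hω'⟩ hij ⟨a, b, rfl, rfl⟩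
  have h1 : IsReducedWord cs w (a ++ CoxeterSystem.braidWord C i j ++ b) :=
    ⟨hω.2, by rw [← hω.2, hω.1.eq]⟩
  rcases altWord_eq_braidWord C i j with ⟨e, e'⟩ | ⟨e, e'⟩
  · have := hτ i j a b hij (by rw [e]; exact h1)
    rwa [e, e'] at this
  · have := hτ j i a b hij.symm (by rw [C.symmetric j i, e']; exact h1)
    rwa [C.symmetric j i, e, e'] at this

open Classical in
/-- The extension of a function on reduced expressions to all words. -/
noncomputable def extendSign {w : W} (σ : ReducedExpr cs w → ℤˣ) (ω : List B) : ℤˣ :=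
  if h : cs.IsReduced ω ∧ cs.wordProd ω = w then σ ⟨ω, h⟩ else 1

theorem isBraidSign_extendSign {w : W} {σ : ReducedExpr cs w → ℤˣ}
    (hσ : IsSignFunction cs w σ) : IsBraidSign cs w (extendSign cs σ) := by
  intro i j a b hij h
  have h1 : cs.IsReduced (a ++ altWord i j (C i j) ++ b) ∧
    cs.wordProd (a ++ altWord i j (C i j) ++ b) = w := ⟨h.isReduced, h.1⟩
  have hp : cs.wordProd (a ++ altWord j i (C i j) ++ b) =
      cs.wordProd (a ++ altWord i j (C i j) ++ b) := by
    simp only [cs.wordProd_append, wordProd_altWord_comm cs i j]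
  have h2 : cs.IsReduced (a ++ altWord j i (C i j) ++ b) ∧
    cs.wordProd (a ++ altWord j i (C i j) ++ b) = w :=
    ⟨isReduced_of_wordProd_eq h1.1 hp (by simp), hp.trans h1.2⟩
  rw [extendSign, extendSign, dif_pos h1, dif_pos h2]
  rcases altWord_eq_braidWord C i j with ⟨e, e'⟩ | ⟨e, e'⟩
  · exact hσ i j _ _ hij ⟨a, b, congrArg (a ++ · ++ b) e, congrArg (a ++ · ++ b) e'⟩
  · have := hσ j i ⟨_, h1⟩ ⟨_, h2⟩ hij.symm
      ⟨a, b, congrArg (a ++ · ++ b) e, congrArg (a ++ · ++ b) e'⟩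
    rwa [C.symmetric j i] at this

/-- Sign functions exist. -/
theorem exists_isSignFunction [Finite W] (w : W) :
    ∃ σ : ReducedExpr cs w → ℤˣ, IsSignFunction cs w σ :=
  ⟨_, isSignFunction_of_isBraidSign cs (isBraidSign_canonicalSign cs w)⟩

end SignFunction

end SubwordFan

namespace SubwordFan

/-! ### Exchange and flips of reduced subwords. -/

section Subwords

variable {B W : Type*} [Group W] {C : CoxeterMatrix B} (cs : CoxeterSystem C W)
variable {ι : Type*} [LinearOrder ι]

theorem sort_erase_of_sort_eq {P : Finset ι} {u v : List ι} {x : ι}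
    (h : P.sort = u ++ x :: v) : (P.erase x).sort = u ++ v := by
  have hnd : (u ++ x :: v).Nodup := h ▸ P.sort_nodup _
  have hsub : (u ++ v).Sublist (u ++ x :: v) := (List.sublist_cons_self x v).append_left u
  have hp : (u ++ v).Pairwise (· ≤ ·) := (h ▸ P.pairwise_sort (· ≤ ·)).sublist hsub
  refine List.Perm.eq_of_pairwise' (Finset.pairwise_sort _ _) hp ?_
  rw [List.perm_ext_iff_of_nodup (Finset.sort_nodup _ _) (hnd.sublist hsub)]
  intro a
  have hx := List.nodup_middle.1 hnd
  rw [Finset.mem_sort, Finset.mem_erase, ← Finset.mem_sort (· ≤ ·), h]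
  constructor
  · rintro ⟨h1, h2⟩; simpa [h1] using h2
  · intro h2
    refine ⟨?_, hsub.subset h2⟩
    rintro rfl
    exact (List.nodup_cons.1 hx).1 h2

theorem lt_of_sort_eq {P : Finset ι} {u v : List ι} (h : P.sort = u ++ v) {a b : ι}
    (ha : a ∈ u) (hb : b ∈ v) : a < b := by
  have h1 := P.pairwise_sort (· ≤ ·)
  have h2 := P.sort_nodup (· ≤ ·)
  rw [h] at h1 h2
  exact lt_of_le_of_ne ((List.pairwise_append.1 h1).2.2 a ha b hb)
    ((List.nodup_append.1 h2).2.2 a ha b hb)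

/-- The product of the letters of `Q` at the positions in `S`. -/
noncomputable def subwordProd (Q : ι → B) (S : Finset ι) : W := cs.wordProd (S.sort.map Q)

/-- The positions in `S` spell a reduced word for `w`. -/
def IsReducedSubword (Q : ι → B) (w : W) (S : Finset ι) : Prop :=
  IsReducedWord cs w (S.sort.map Q)

variable {cs} {Q : ι → B} {w : W}

theorem isReducedSubword_iff {S : Finset ι} :
    IsReducedSubword cs Q w S ↔ subwordProd cs Q S = w ∧ S.card = cs.length w := by
  simp [IsReducedSubword, IsReducedWord, subwordProd]

/-- Inserting a letter into a reduced word for the longest element, another letter can be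
deleted. -/
theorem exists_exchange {w₀ : W} (hw₀ : IsLongest cs w₀) {P : Finset ι} {x : ι} (hx : x ∈ P)
    (h : IsReducedSubword cs Q w₀ (P.erase x)) :
    ∃ y ∈ P, y ≠ x ∧ IsReducedSubword cs Q w₀ (P.erase y) := by
  have hx' : x ∈ P.sort := (Finset.mem_sort _).2 hx
  obtain ⟨u, v, huv⟩ := List.append_of_mem hx'
  have herase := sort_erase_of_sort_eq huv
  have hcard := (isReducedSubword_iff.1 h).2
  rw [IsReducedSubword, herase] at h
  -- Inserting the letter at `x` multiplies `w₀` on the left by the reflection `t`. As `w₀` is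
  -- longest, `t` shortens it, so by strong exchange the same multiplication also deletes a letter
  -- `y`; insertion and deletion together give `t * t * w₀`.
  set t := cs.wordProd (u.map Q) * cs.simple (Q x) * (cs.wordProd (u.map Q))⁻¹ with ht
  have htr : cs.IsReflection t := ⟨_, _, rfl⟩
  have hlt : cs.length (t * cs.wordProd ((u ++ v).map Q)) <
      cs.length (cs.wordProd ((u ++ v).map Q)) := by
    rw [h.1]
    exact lt_of_le_of_ne (hw₀ _) (htr.length_mul_right_ne w₀)
  obtain ⟨u₁, c, v₁, hw, hprod, htc⟩ := exists_eraseIdx_of_length_lt cs htr _ hlt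
  have hnd : (u ++ x :: v).Nodup := huv ▸ P.sort_nodup _
  have hxuv : x ∉ u ++ v := (List.nodup_cons.1 (List.nodup_middle.1 hnd)).1
  obtain ⟨p, q, hpq, rfl, hq⟩ := List.map_eq_append_iff.1 hw
  obtain ⟨y, q, rfl, rfl, rfl⟩ := List.map_eq_cons_iff.1 hq
  have hyuv : y ∈ u ++ v := by rw [hpq]; simp
  have hyx : y ≠ x := fun h => hxuv (h ▸ hyuv)
  have hyP : y ∈ P := by
    rw [← Finset.mem_sort (· ≤ ·), huv]
    simp only [List.mem_append, List.mem_cons] at hyuv ⊢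
    tauto
  refine ⟨y, hyP, hyx, isReducedSubword_iff.2 ⟨?_, ?_⟩⟩
  swap
  · rw [← hcard, Finset.card_erase_of_mem hyP, Finset.card_erase_of_mem hx]
  have htt : t * t = 1 := htr.mul_self
  have hw0 : cs.wordProd (u.map Q) * cs.wordProd (v.map Q) = w₀ := by
    rw [← h.1, List.map_append, cs.wordProd_append]
  rw [subwordProd]
  -- If `y` stands before `x`, deleting it turns the product of `u` into `t` times it, which is that
  -- product times `s_x`; this factor cancels with the letter at `x`.
  have case1 : ∀ m, u = p ++ y :: m → q = m ++ v →
      cs.wordProd ((P.erase y).sort.map Q) = w₀ := by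
    rintro m rfl rfl
    have e : P.sort = p ++ y :: (m ++ x :: v) := by rw [huv]; simp
    rw [sort_erase_of_sort_eq e]
    have e2 : cs.wordProd (p.map Q) * cs.wordProd (m.map Q) =
        t * cs.wordProd ((p ++ y :: m).map Q) := by
      rw [htc]
      simp [cs.wordProd_append, cs.wordProd_cons, mul_assoc]
    have e3 : t * cs.wordProd ((p ++ y :: m).map Q) =
        cs.wordProd ((p ++ y :: m).map Q) * cs.simple (Q x) := by rw [ht]; group
    rw [← hw0]
    simp only [List.map_append, List.map_cons, cs.wordProd_append, cs.wordProd_cons]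
    rw [← mul_assoc, e2, e3, ← mul_assoc, cs.simple_mul_simple_cancel_right]
    simp [cs.wordProd_append, cs.wordProd_cons]
  rcases List.append_eq_append_iff.1 hpq with ⟨as, h1, h2⟩ | ⟨bs, h1, h2⟩
  · have e : P.sort = (u ++ x :: as) ++ y :: q := by rw [huv, h2]; simp
    rw [sort_erase_of_sort_eq e]
    have e2 : t * w₀ = cs.wordProd (u.map Q) * cs.wordProd ((as ++ q).map Q) := by
      rw [← h.1, hprod, h1]
      simp [cs.wordProd_append]
    have e3 : cs.wordProd ((u ++ x :: as ++ q).map Q) =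
        t * (cs.wordProd (u.map Q) * cs.wordProd ((as ++ q).map Q)) := by
      rw [ht]
      simp [cs.wordProd_append, cs.wordProd_cons, mul_assoc]
    rw [e3, ← e2, ← mul_assoc, htt, one_mul]
  · rcases bs with _ | ⟨c', bs⟩
    · have e : P.sort = (u ++ x :: []) ++ y :: q := by
        rw [huv]
        simp only [List.nil_append] at h2
        rw [h2]; simp
      have h1' : p = u := by simpa using h1.symm
      rw [sort_erase_of_sort_eq e]
      have e2 : t * w₀ = cs.wordProd (u.map Q) * cs.wordProd (q.map Q) := by
        rw [← h.1, hprod, h1']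
        simp [cs.wordProd_append]
      have e3 : cs.wordProd ((u ++ x :: [] ++ q).map Q) =
          t * (cs.wordProd (u.map Q) * cs.wordProd (q.map Q)) := by
        rw [ht]
        simp [cs.wordProd_append, cs.wordProd_cons, mul_assoc]
      rw [e3, ← e2, ← mul_assoc, htt, one_mul]
    · obtain ⟨rfl, rfl⟩ : y = c' ∧ q = bs ++ v := by simpa using h2
      exact case1 bs h1 rfl

/-- This is the uniqueness of exchange. Comparing the deletions of `x` and `y` shows that `s_x`
passes through the factor up to `y` and becomes `s_y`. Inserted into the comparison of `x` and `z`,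
this lets two letters cancel from a factor of a reduced word. -/
theorem not_three_erase {P : Finset ι} {x y z : ι} (hxy : x < y) (hyz : y < z)
    (hx : x ∈ P) (hy : y ∈ P) (hz : z ∈ P) (h1 : IsReducedSubword cs Q w (P.erase x))
    (h2 : IsReducedSubword cs Q w (P.erase y)) (h3 : IsReducedSubword cs Q w (P.erase z)) :
    False := by
  obtain ⟨u, v, e1⟩ := List.append_of_mem ((Finset.mem_sort (· ≤ ·)).2 hx)
  have hyv : y ∈ v := by
    have : y ∈ u ++ x :: v := e1 ▸ (Finset.mem_sort (· ≤ ·)).2 hy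
    rcases List.mem_append.1 this with h | h
    · exact absurd (lt_of_sort_eq e1 h (by simp)) hxy.not_gt
    · exact (List.mem_cons.1 h).resolve_left hxy.ne'
  obtain ⟨v₁, v₂, rfl⟩ := List.append_of_mem hyv
  have e2 : P.sort = (u ++ x :: v₁) ++ y :: v₂ := by rw [e1]; simp
  have hzv : z ∈ v₂ := by
    have : z ∈ (u ++ x :: v₁) ++ y :: v₂ := e2 ▸ (Finset.mem_sort (· ≤ ·)).2 hz
    rcases List.mem_append.1 this with h | h
    · exact absurd (lt_of_sort_eq e2 h (by simp)) hyz.not_gt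
    · exact (List.mem_cons.1 h).resolve_left hyz.ne'
  obtain ⟨v₃, v₄, rfl⟩ := List.append_of_mem hzv
  have e3 : P.sort = (u ++ x :: v₁ ++ y :: v₃) ++ z :: v₄ := by rw [e1]; simp
  rw [IsReducedSubword, sort_erase_of_sort_eq e1] at h1
  rw [IsReducedSubword, sort_erase_of_sort_eq e2] at h2
  rw [IsReducedSubword, sort_erase_of_sort_eq e3] at h3
  have p1 := h1.1.trans h2.1.symm
  have p2 := h1.1.trans h3.1.symm
  simp only [List.map_append, List.map_cons, cs.wordProd_append, cs.wordProd_cons, mul_assoc,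
    mul_right_inj] at p1 p2
  have hred : cs.IsReduced ((v₁ ++ y :: (v₃ ++ z :: v₄)).map Q) := by
    have := h1.isReduced
    rw [List.map_append] at this
    exact isReduced_of_append_right this
  have hprod : cs.wordProd ((v₁ ++ y :: (v₃ ++ z :: v₄)).map Q) =
      cs.wordProd ((v₁ ++ v₃ ++ v₄).map Q) := by
    have q1 : cs.wordProd (v₁.map Q) * cs.simple (Q y) =
        cs.simple (Q x) * cs.wordProd (v₁.map Q) := by
      simp only [← mul_assoc] at p1
      exact mul_right_cancel (mul_right_cancel (mul_right_cancel p1))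
    simp only [List.map_append, List.map_cons, cs.wordProd_append, cs.wordProd_cons, mul_assoc]
    rw [p2, ← mul_assoc (cs.wordProd (v₁.map Q)), q1, mul_assoc,
      cs.simple_mul_simple_cancel_left]
  have h' := cs.length_wordProd_le ((v₁ ++ v₃ ++ v₄).map Q)
  rw [← hprod, hred.eq] at h'
  simp at h'

/-- On complements: every ridge of the spherical subword complex lies in exactly two facets. -/
theorem existsUnique_exchange {w₀ : W} (hw₀ : IsLongest cs w₀) {P : Finset ι} {x : ι}
    (hx : x ∈ P) (h : IsReducedSubword cs Q w₀ (P.erase x)) :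
    ∃! y, y ∈ P ∧ y ≠ x ∧ IsReducedSubword cs Q w₀ (P.erase y) := by
  obtain ⟨y, hy, hyx, hyr⟩ := exists_exchange hw₀ hx h
  refine ⟨y, ⟨hy, hyx, hyr⟩, ?_⟩
  rintro z ⟨hz, hzx, hzr⟩
  by_contra hzy
  rcases lt_or_gt_of_ne hyx with h1 | h1 <;> rcases lt_or_gt_of_ne hzx with h2 | h2 <;>
    rcases lt_or_gt_of_ne hzy with h3 | h3
  · exact not_three_erase h3 h1 hz hy hx hzr hyr h
  · exact not_three_erase h3 h2 hy hz hx hyr hzr h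
  · exact absurd (h3.trans h1) h2.not_gt
  · exact not_three_erase h1 h2 hy hx hz hyr h hzr
  · exact not_three_erase h2 h1 hz hx hy hzr h hyr
  · exact absurd (h3.trans h2) h1.not_gt
  · exact not_three_erase h2 h3 hx hz hy h hzr hyr
  · exact not_three_erase h1 h3 hx hy hz h hyr hzr

variable (cs Q) in
/-- Two reduced subwords for `w` inside `U` differ in one letter. -/
def FlipAdj (U : Finset ι) (w : W) (S T : Finset ι) : Prop :=
  (S ⊆ U ∧ IsReducedSubword cs Q w S) ∧ (T ⊆ U ∧ IsReducedSubword cs Q w T) ∧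
    ∃ x ∈ S, ∃ y ∈ T, S.erase x = T.erase y

theorem FlipAdj.symm {U S T : Finset ι} (h : FlipAdj cs Q U w S T) : FlipAdj cs Q U w T S := by
  obtain ⟨h1, h2, x, hx, y, hy, e⟩ := h
  exact ⟨h2, h1, y, hy, x, hx, e.symm⟩

theorem sort_insert_min {U S : Finset ι} {a : ι} (ha : ∀ x ∈ U, a < x) (hS : S ⊆ U) :
    (insert a S).sort = a :: S.sort :=
  Finset.sort_insert _ (fun b hb => (ha b (hS hb)).le) fun h => (ha a (hS h)).false

theorem isReducedSubword_insert_min {U S : Finset ι} {a : ι} (ha : ∀ x ∈ U, a < x) (hS : S ⊆ U)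
    (hd : cs.IsLeftDescent w (Q a)) :
    IsReducedSubword cs Q w (insert a S) ↔ IsReducedSubword cs Q (cs.simple (Q a) * w) S := by
  have hl := cs.isLeftDescent_iff.1 hd
  rw [IsReducedSubword, sort_insert_min ha hS, IsReducedSubword, IsReducedWord, IsReducedWord,
    List.map_cons, cs.wordProd_cons, List.length_cons]
  refine and_congr ⟨?_, ?_⟩ ⟨?_, ?_⟩
  · rintro rfl; simp
  · intro h; rw [h]; simp
  · intro h; omega
  · intro h; omega

theorem isLeftDescent_of_isReducedSubword_insert {U S : Finset ι} {a : ι} (ha : ∀ x ∈ U, a < x)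
    (hS : S ⊆ U) (h : IsReducedSubword cs Q w (insert a S)) : cs.IsLeftDescent w (Q a) := by
  rw [IsReducedSubword, sort_insert_min ha hS, List.map_cons] at h
  have := isLeftDescent_of_isReduced_cons h.isReduced
  rwa [h.1] at this

/-- The reduced subwords of a word for a fixed element are connected by flips. -/
theorem reflTransGen_flipAdj (U : Finset ι) : ∀ (w : W) (S T : Finset ι), S ⊆ U → T ⊆ U →
    IsReducedSubword cs Q w S → IsReducedSubword cs Q w T →
    Relation.ReflTransGen (FlipAdj cs Q U w) S T := by
  induction U using Finset.induction_on_min with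
  | empty =>
    intro w S T hS hT _ _
    rw [Finset.subset_empty] at hS hT
    rw [hS, hT]
  | insert a U ha ih =>
    intro w S T hS hT hSr hTr
    have hsub : ∀ {S : Finset ι}, S ⊆ insert a U → a ∉ S → S ⊆ U := fun h h' =>
      (Finset.subset_insert_iff_of_notMem h').1 h
    have hsub' : ∀ {S : Finset ι}, S ⊆ insert a U → S.erase a ⊆ U := fun h =>
      Finset.subset_insert_iff.1 h
    have haU : a ∉ U := fun h => (ha a h).false
    -- If both subwords use the first position, it is stripped and the induction applies to the
    -- shorter element `s_a * w`; this is why `w` varies in the statement.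
    have both : ∀ {S T : Finset ι}, S ⊆ insert a U → T ⊆ insert a U →
        IsReducedSubword cs Q w S → IsReducedSubword cs Q w T → a ∈ S → a ∈ T →
        Relation.ReflTransGen (FlipAdj cs Q (insert a U) w) S T := by
      intro S T hS hT hSr hTr haS haT
      rw [← Finset.insert_erase haS] at hSr
      rw [← Finset.insert_erase haT] at hTr
      have hd := isLeftDescent_of_isReducedSubword_insert ha (hsub' hS) hSr
      have := ih (cs.simple (Q a) * w) (S.erase a) (T.erase a) (hsub' hS) (hsub' hT)
        ((isReducedSubword_insert_min ha (hsub' hS) hd).1 hSr)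
        ((isReducedSubword_insert_min ha (hsub' hT) hd).1 hTr)
      have := this.lift (p := FlipAdj cs Q (insert a U) w) (insert a) ?_
      · rw [Function.onFun] at this
        rwa [Finset.insert_erase haS, Finset.insert_erase haT] at this
      · rintro S' T' ⟨⟨h1, h1'⟩, ⟨h2, h2'⟩, x, hx, y, hy, e⟩
        refine ⟨⟨Finset.insert_subset_insert _ h1, (isReducedSubword_insert_min ha h1 hd).2 h1'⟩,
          ⟨Finset.insert_subset_insert _ h2, (isReducedSubword_insert_min ha h2 hd).2 h2'⟩,
          x, Finset.mem_insert_of_mem hx, y, Finset.mem_insert_of_mem hy, ?_⟩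
        rw [Finset.erase_insert_of_ne (ha x (h1 hx)).ne,
          Finset.erase_insert_of_ne (ha y (h2 hy)).ne, e]
    -- If only `T` uses the first position, its letter is a left descent of `w`. Exchanging it into
    -- `S` is a single flip to a subword that uses it.
    have mixed : ∀ {S T : Finset ι}, S ⊆ insert a U → T ⊆ insert a U →
        IsReducedSubword cs Q w S → IsReducedSubword cs Q w T → a ∉ S → a ∈ T →
        Relation.ReflTransGen (FlipAdj cs Q (insert a U) w) S T := by
      intro S T hS hT hSr hTr haS haT
      have hd : cs.IsLeftDescent w (Q a) := by
        rw [← Finset.insert_erase haT] at hTr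
        exact isLeftDescent_of_isReducedSubword_insert ha (hsub' hT) hTr
      have hdS : cs.length (cs.simple (Q a) * cs.wordProd (S.sort.map Q)) <
          cs.length (cs.wordProd (S.sort.map Q)) := by rw [hSr.1]; exact hd
      obtain ⟨u, c, v, hw, hprod, -⟩ :=
        exists_eraseIdx_of_length_lt cs (cs.isReflection_simple (Q a)) _ hdS
      obtain ⟨p, q, hpq, rfl, hq⟩ := List.map_eq_append_iff.1 hw
      obtain ⟨y, q, rfl, rfl, rfl⟩ := List.map_eq_cons_iff.1 hq
      have hy : y ∈ S := by
        rw [← Finset.mem_sort (· ≤ ·), hpq]; simp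
      have hSU := hsub hS haS
      have hS'U : S.erase y ⊆ U := (Finset.erase_subset _ _).trans hSU
      have hS' : IsReducedSubword cs Q w (insert a (S.erase y)) := by
        rw [isReducedSubword_insert_min ha hS'U hd, isReducedSubword_iff, subwordProd,
          sort_erase_of_sort_eq hpq, List.map_append, ← hprod, hSr.1]
        refine ⟨rfl, ?_⟩
        have h1 := (isReducedSubword_iff.1 hSr).2
        have h2 := cs.isLeftDescent_iff.1 hd
        rw [Finset.card_erase_of_mem hy]
        omega
      refine Relation.ReflTransGen.head
        ⟨⟨hS, hSr⟩, ⟨Finset.insert_subset_insert _ hS'U, hS'⟩, y, hy, a,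
          Finset.mem_insert_self _ _, ?_⟩
        (both (Finset.insert_subset_insert _ hS'U) hT hS' hTr (Finset.mem_insert_self _ _) haT)
      rw [Finset.erase_insert fun h => haU (hS'U h)]
    by_cases haS : a ∈ S <;> by_cases haT : a ∈ T
    · exact both hS hT hSr hTr haS haT
    · have : Std.Symm (FlipAdj cs Q (insert a U) w) := ⟨fun _ _ h => h.symm⟩
      exact Relation.ReflTransGen.stdSymm.symm _ _ (mixed hT hS hTr hSr haT haS)
    · exact mixed hS hT hSr hTr haS haT
    · refine Relation.ReflTransGen.mono ?_ _ _ (ih w S T (hsub hS haS) (hsub hT haT) hSr hTr)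
      rintro S' T' ⟨⟨h1, h1'⟩, ⟨h2, h2'⟩, h3⟩
      exact ⟨⟨h1.trans (Finset.subset_insert _ _), h1'⟩,
        ⟨h2.trans (Finset.subset_insert _ _), h2'⟩, h3⟩

end Subwords

end SubwordFan

namespace SubwordFan

/-! ### Covering degree of a system of simplicial cones closed under flips. -/

section FlipSystem

open Filter Topology

variable {E ι : Type*} [NormedAddCommGroup E] [NormedSpace ℝ E] [DecidableEq ι]

/-- A family `𝓕` of bases, taken from the vectors `m`, with coordinate functionals `c`, such that
each vector of each basis can be exchanged in exactly one way, and such that exchanged vectors lie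
on opposite sides of their common wall. -/
structure IsFlipSystem (m : ι → E) (𝓕 : Finset (Finset ι)) (c : Finset ι → ι → E →ₗ[ℝ] ℝ) :
    Prop where
  repr : ∀ F ∈ 𝓕, ∀ x, ∑ k ∈ F, c F k x • m k = x
  dual : ∀ F ∈ 𝓕, ∀ k ∈ F, ∀ l ∈ F, c F k (m l) = if k = l then 1 else 0
  flip : ∀ F ∈ 𝓕, ∀ k ∈ F, ∃! k', k' ∉ F ∧ insert k' (F.erase k) ∈ 𝓕
  opp : ∀ F ∈ 𝓕, ∀ k ∈ F, ∀ k' ∉ F, insert k' (F.erase k) ∈ 𝓕 → c F k (m k') < 0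

/-- A point off all walls. -/
def IsGeneric (𝓕 : Finset (Finset ι)) (c : Finset ι → ι → E →ₗ[ℝ] ℝ) (y : E) : Prop :=
  ∀ F ∈ 𝓕, ∀ k ∈ F, c F k y ≠ 0

/-- The segment between `y` and `z` does not meet two walls of the same cone at once. -/
def IsTransversal (𝓕 : Finset (Finset ι)) (c : Finset ι → ι → E →ₗ[ℝ] ℝ) (y z : E) : Prop :=
  ∀ F ∈ 𝓕, ∀ k ∈ F, ∀ l ∈ F, k ≠ l → c F l y * c F k z ≠ c F k y * c F l z

open Classical in
/-- The weight of `p` in the cone of `F`: two in the interior, one on the boundary, zero outside. -/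
noncomputable def coneWeight (c : Finset ι → ι → E →ₗ[ℝ] ℝ) (F : Finset ι) (p : E) : ℤ :=
  if ∀ k ∈ F, 0 < c F k p then 2 else if ∀ k ∈ F, 0 ≤ c F k p then 1 else 0

/-- The points with positive coordinates at `I` in all the cones of the star of `I`. -/
def starRegion (𝓕 : Finset (Finset ι)) (c : Finset ι → ι → E →ₗ[ℝ] ℝ) (I : Finset ι) : Set E :=
  {y | ∀ F ∈ 𝓕, I ⊆ F → ∀ k ∈ I, 0 < c F k y}

variable {m : ι → E} {𝓕 : Finset (Finset ι)} {c : Finset ι → ι → E →ₗ[ℝ] ℝ}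

omit [DecidableEq ι] in
theorem coneWeight_nonneg (F : Finset ι) (p : E) : 0 ≤ coneWeight c F p := by
  unfold coneWeight; split_ifs <;> norm_num

omit [DecidableEq ι] in
theorem coneWeight_of_pos {F : Finset ι} {p : E} (h : ∀ k ∈ F, 0 < c F k p) :
    coneWeight c F p = 2 := if_pos h

omit [DecidableEq ι] in
theorem coneWeight_of_neg {F : Finset ι} {p : E} {k : ι} (hk : k ∈ F) (h : c F k p < 0) :
    coneWeight c F p = 0 := by
  unfold coneWeight
  rw [if_neg fun h' => (h' k hk).not_gt h, if_neg fun h' => (h' k hk).not_gt h]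

omit [DecidableEq ι] in
theorem coneWeight_of_zero {F : Finset ι} {p : E} {k : ι} (hk : k ∈ F) (h0 : c F k p = 0)
    (h : ∀ k ∈ F, 0 ≤ c F k p) : coneWeight c F p = 1 := by
  unfold coneWeight
  rw [if_neg fun h' => (h' k hk).ne' h0, if_pos h]

/-- Near a relatively interior point of a wall, the weight differs from its value one on the wall by
the sign of the wall coordinate. The signs of the two adjacent cones are opposite, so their total
weight is constant even on the wall itself. -/
theorem coneWeight_sub_one {F : Finset ι} {p : E} {k : ι} (hk : k ∈ F)
    (h : ∀ l ∈ F, l ≠ k → 0 < c F l p) :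
    coneWeight c F p - 1 = SignType.sign (c F k p) := by
  rcases lt_trichotomy (c F k p) 0 with h0 | h0 | h0
  · rw [coneWeight_of_neg hk h0, sign_neg h0]; rfl
  · rw [coneWeight_of_zero hk h0, h0]
    · simp
    · intro l hl
      by_cases hlk : l = k
      · rw [hlk, h0]
      · exact (h l hl hlk).le
  · rw [coneWeight_of_pos, sign_pos h0]
    · rfl
    · intro l hl
      by_cases hlk : l = k
      · rwa [hlk]
      · exact h l hl hlk

theorem IsFlipSystem.coord_sum (h : IsFlipSystem m 𝓕 c) {F I : Finset ι} (hF : F ∈ 𝓕)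
    (hI : I ⊆ F) (a : ι → ℝ) {k : ι} (hk : k ∈ F) :
    c F k (∑ l ∈ I, a l • m l) = if k ∈ I then a k else 0 := by
  rw [map_sum]
  have : ∀ l ∈ I, c F k (a l • m l) = if k = l then a l else 0 := by
    intro l hl
    rw [map_smul, h.dual F hF k hk l (hI hl), smul_eq_mul, mul_ite, mul_one, mul_zero]
  rw [Finset.sum_congr rfl this, Finset.sum_ite_eq]

/-- Both claims come from expanding `x` in the flipped basis and applying the functionals of `F`:
the wall coordinates are proportional, by a negative factor, and on the wall the remaining
coordinates agree. -/
theorem IsFlipSystem.coord_flip (h : IsFlipSystem m 𝓕 c) {F : Finset ι} (hF : F ∈ 𝓕) {k k' : ι}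
    (hk : k ∈ F) (hk' : k' ∉ F) (hF' : insert k' (F.erase k) ∈ 𝓕) (x : E) :
    c F k x = c F k (m k') * c (insert k' (F.erase k)) k' x ∧
      (c F k x = 0 → ∀ l ∈ F.erase k, c (insert k' (F.erase k)) l x = c F l x) := by
  set F' := insert k' (F.erase k) with hF'def
  have hk'' : k' ∉ F.erase k := fun h => hk' (Finset.mem_of_mem_erase h)
  have hx : ∀ l ∈ F, c F l x = c F' k' x * c F l (m k') +
      if l ∈ F.erase k then c F' l x else 0 := by
    intro l hl
    conv_lhs => rw [← h.repr F' hF' x, hF'def, Finset.sum_insert hk'', ← hF'def]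
    rw [map_add, map_smul, smul_eq_mul,
      h.coord_sum hF (Finset.erase_subset k F) (fun l => c F' l x) hl]
  have h1 : c F k x = c F k (m k') * c F' k' x := by
    rw [hx k hk]; simp [mul_comm]
  refine ⟨h1, fun h0 l hl => ?_⟩
  have h2 : c F' k' x = 0 := by
    rw [h0] at h1
    exact (mul_eq_zero.1 h1.symm).resolve_left (h.opp F hF k hk k' hk' hF').ne
  rw [hx l (Finset.mem_of_mem_erase hl), h2, if_pos hl]
  simp

theorem sign_eq_neg_sign_of_eq_mul {a b γ : ℝ} (hγ : γ < 0) (h : a = γ * b) :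
    (SignType.sign a : ℤ) + SignType.sign b = 0 := by
  rw [h, sign_mul, sign_neg hγ]
  rcases lt_trichotomy b 0 with h0 | h0 | h0
  · rw [sign_neg h0]; rfl
  · rw [h0]; simp
  · rw [sign_pos h0]; rfl

/-- The total weight of the star of `I` is locally constant at the points of its region which lie
on at most one wall of each cone. -/
theorem IsFlipSystem.eventually_sum_coneWeight_eq [FiniteDimensional ℝ E]
    (h : IsFlipSystem m 𝓕 c) {I : Finset ι} {p₀ : E} (hp₀ : p₀ ∈ starRegion 𝓕 c I)
    (hone : ∀ F ∈ 𝓕, ∀ k ∈ F, ∀ l ∈ F, c F k p₀ = 0 → c F l p₀ = 0 → k = l) :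
    ∀ᶠ p in 𝓝 p₀, ∑ F ∈ 𝓕 with I ⊆ F, coneWeight c F p =
      ∑ F ∈ 𝓕 with I ⊆ F, coneWeight c F p₀ := by
  classical
  have hcont : ∀ F k, Continuous (c F k) := fun F k => (c F k).continuous_of_finiteDimensional
  have hev : ∀ᶠ p in 𝓝 p₀, ∀ F ∈ 𝓕, ∀ k ∈ F,
      (0 < c F k p₀ → 0 < c F k p) ∧ (c F k p₀ < 0 → c F k p < 0) := by
    rw [Filter.eventually_all_finset]
    intro F _
    rw [Filter.eventually_all_finset]
    intro k _
    refine Filter.Eventually.and ?_ ?_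
    · by_cases h0 : 0 < c F k p₀
      · filter_upwards [(hcont F k).continuousAt.eventually (lt_mem_nhds h0)] with p hp _ using hp
      · exact .of_forall fun p hp => absurd hp h0
    · by_cases h0 : c F k p₀ < 0
      · filter_upwards [(hcont F k).continuousAt.eventually (gt_mem_nhds h0)] with p hp _ using hp
      · exact .of_forall fun p hp => absurd hp h0
  filter_upwards [hev] with p hp
  rw [← sub_eq_zero, ← Finset.sum_sub_distrib]
  set 𝓢 := 𝓕.filter (I ⊆ ·) with h𝓢
  set P : Finset ι → Prop := fun F => (∀ l ∈ F, 0 ≤ c F l p₀) ∧ ∃ k ∈ F, c F k p₀ = 0 with hP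
  have hsplit : ∑ F ∈ 𝓢, (coneWeight c F p - coneWeight c F p₀) =
      ∑ F ∈ 𝓢.filter P, (coneWeight c F p - coneWeight c F p₀) := by
    refine (Finset.sum_filter_of_ne fun F hF hne => ?_).symm
    have hF𝓕 := (Finset.mem_filter.1 hF).1
    by_contra hn
    apply hne
    rw [sub_eq_zero]
    by_cases h1 : ∀ l ∈ F, 0 ≤ c F l p₀
    · have h2 : ∀ l ∈ F, 0 < c F l p₀ := fun l hl =>
        lt_of_le_of_ne (h1 l hl) fun h0 => hn ⟨h1, l, hl, h0.symm⟩
      rw [coneWeight_of_pos h2, coneWeight_of_pos fun l hl => (hp F hF𝓕 l hl).1 (h2 l hl)]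
    · push Not at h1
      obtain ⟨l, hl, hneg⟩ := h1
      rw [coneWeight_of_neg hl hneg, coneWeight_of_neg hl ((hp F hF𝓕 l hl).2 hneg)]
  rw [hsplit]
  -- Only cones with `p₀` on their boundary can change weight. Each has a single vanishing
  -- coordinate, hence a single neighbour across that wall. This coordinate is not in `I`, as `p₀`
  -- lies in `starRegion`, so the neighbour is again in the star of `I`.
  set R : Finset ι → Finset ι → Prop := fun F F' =>
    F' ∈ 𝓢.filter P ∧ ∃ k ∈ F, c F k p₀ = 0 ∧ ∃ k' ∉ F, F' = insert k' (F.erase k) with hR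
  have hpos : ∀ F ∈ 𝓢.filter P, ∀ k ∈ F, c F k p₀ = 0 → ∀ l ∈ F, l ≠ k → 0 < c F l p₀ := by
    intro F hF k hk h0 l hl hlk
    obtain ⟨hF1, hF2⟩ := Finset.mem_filter.1 hF
    refine lt_of_le_of_ne (hF2.1 l hl) fun h' => hlk ?_
    exact hone F (Finset.mem_filter.1 hF1).1 l hl k hk h'.symm h0
  have hex : ∀ F ∈ 𝓢.filter P, ∃! F', R F F' := by
    intro F hF
    obtain ⟨hF1, hF2, k, hk, h0⟩ := Finset.mem_filter.1 hF
    obtain ⟨hF𝓕, hIF⟩ := Finset.mem_filter.1 hF1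
    obtain ⟨k', ⟨hk', hF'⟩, huniq⟩ := h.flip F hF𝓕 k hk
    obtain ⟨e1, e2⟩ := h.coord_flip hF𝓕 hk hk' hF' p₀
    have hz : c (insert k' (F.erase k)) k' p₀ = 0 := by
      rw [h0] at e1
      exact (mul_eq_zero.1 e1.symm).resolve_left (h.opp F hF𝓕 k hk k' hk' hF').ne
    refine ⟨insert k' (F.erase k), ⟨?_, k, hk, h0, k', hk', rfl⟩, ?_⟩
    · refine Finset.mem_filter.2 ⟨Finset.mem_filter.2 ⟨hF', fun i hi => ?_⟩, fun l hl => ?_,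
        k', Finset.mem_insert_self _ _, hz⟩
      · refine Finset.mem_insert_of_mem (Finset.mem_erase.2 ⟨?_, hIF hi⟩)
        rintro rfl
        exact (hp₀ F hF𝓕 hIF i hi).ne' h0
      · rcases Finset.mem_insert.1 hl with rfl | hl
        · exact hz.ge
        · rw [e2 h0 l hl]
          exact hF2 l (Finset.mem_of_mem_erase hl)
    · rintro F'' ⟨hF'', l, hl, hl0, l', hl', rfl⟩
      obtain rfl := hone F hF𝓕 k hk l hl h0 hl0
      rw [huniq l' ⟨hl', (Finset.mem_filter.1 (Finset.mem_filter.1 hF'').1).1⟩]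
  have hsymm : ∀ F ∈ 𝓢.filter P, ∀ F', R F F' → R F' F := by
    rintro F hF F' ⟨hF', k, hk, h0, k', hk', rfl⟩
    obtain ⟨hF1, -⟩ := Finset.mem_filter.1 hF
    have hF𝓕 := (Finset.mem_filter.1 hF1).1
    have hF'𝓕 := (Finset.mem_filter.1 (Finset.mem_filter.1 hF').1).1
    have e1 := (h.coord_flip hF𝓕 hk hk' hF'𝓕 p₀).1
    rw [h0] at e1
    refine ⟨hF, k', Finset.mem_insert_self _ _,
      (mul_eq_zero.1 e1.symm).resolve_left (h.opp F hF𝓕 k hk k' hk' hF'𝓕).ne, k, ?_, ?_⟩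
    · rw [Finset.mem_insert, not_or]
      exact ⟨fun e => hk' (e ▸ hk), Finset.notMem_erase k F⟩
    · rw [Finset.erase_insert fun e => hk' (Finset.mem_of_mem_erase e), Finset.insert_erase hk]
  choose! g hg hguniq using hex
  refine Finset.sum_involution (fun F _ => g F) ?_ ?_ (fun F hF => (hg F hF).1) ?_
  · intro F hF
    obtain ⟨hF', k, hk, h0, k', hk', hgF⟩ := hg F hF
    have hF𝓕 := (Finset.mem_filter.1 (Finset.mem_filter.1 hF).1).1
    have hF'𝓕 := (Finset.mem_filter.1 (Finset.mem_filter.1 hF').1).1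
    obtain ⟨-, hk'F', h0', -⟩ := hsymm F hF _ (hg F hF)
    rw [hgF] at hF' hF'𝓕 ⊢
    have e1 := (h.coord_flip hF𝓕 hk hk' hF'𝓕 p).1
    have e2 := (h.coord_flip hF𝓕 hk hk' hF'𝓕 p₀).1
    have hz : c (insert k' (F.erase k)) k' p₀ = 0 := by
      rw [h0] at e2
      exact (mul_eq_zero.1 e2.symm).resolve_left (h.opp F hF𝓕 k hk k' hk' hF'𝓕).ne
    have hk'mem : k' ∈ insert k' (F.erase k) := Finset.mem_insert_self _ _
    have w1 := coneWeight_of_zero hk h0 (Finset.mem_filter.1 hF).2.1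
    have w2 := coneWeight_of_zero hk'mem hz (Finset.mem_filter.1 hF').2.1
    have w3 := coneWeight_sub_one (p := p) hk fun l hl hlk =>
      (hp F hF𝓕 l hl).1 (hpos F hF k hk h0 l hl hlk)
    have w4 := coneWeight_sub_one (p := p) hk'mem fun l hl hlk =>
      (hp _ hF'𝓕 l hl).1 (hpos _ hF' k' hk'mem hz l hl hlk)
    rw [w1, w2, w3, w4]
    exact sign_eq_neg_sign_of_eq_mul (h.opp F hF𝓕 k hk k' hk' hF'𝓕) e1
  · intro F hF _ heq
    obtain ⟨-, k, hk, -, k', hk', hgF⟩ := hg F hF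
    rw [heq] at hgF
    exact hk' (hgF ▸ Finset.mem_insert_self _ _)
  · intro F hF
    exact (hguniq (g F) (hg F hF).1 F (hsymm F hF _ (hg F hF))).symm

/-- The total weight is an integer-valued, locally constant function on the segment, which stays in
the convex region. Two walls of one cone are never met at once: at `y` by genericity, elsewhere by
transversality. -/
theorem IsFlipSystem.sum_coneWeight_eq_of_isTransversal [FiniteDimensional ℝ E]
    (h : IsFlipSystem m 𝓕 c) {I : Finset ι} {y z : E} (hy : y ∈ starRegion 𝓕 c I)
    (hz : z ∈ starRegion 𝓕 c I) (hyg : IsGeneric 𝓕 c y) (hyz : IsTransversal 𝓕 c y z) :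
    ∑ F ∈ 𝓕 with I ⊆ F, coneWeight c F y = ∑ F ∈ 𝓕 with I ⊆ F, coneWeight c F z := by
  set p : ℝ → E := fun t => (1 - t) • y + t • z with hp
  have hpc : ∀ F k t, c F k (p t) = (1 - t) * c F k y + t * c F k z := by
    intro F k t
    simp [hp]
  have hcont : ContinuousOn (fun t => ∑ F ∈ 𝓕 with I ⊆ F, coneWeight c F (p t))
      (Set.Icc (0 : ℝ) 1) := by
    intro t ht
    refine ContinuousAt.continuousWithinAt ?_
    have hpt : Continuous p := by fun_prop
    have hreg : p t ∈ starRegion 𝓕 c I := by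
      intro F hF hIF k hk
      have h1 := hy F hF hIF k hk
      have h2 := hz F hF hIF k hk
      rw [hpc]
      rcases eq_or_lt_of_le ht.1 with h0 | h0
      · rw [← h0]; simpa using h1
      · have := mul_nonneg (sub_nonneg.2 ht.2) h1.le
        have := mul_pos h0 h2
        linarith
    have hone : ∀ F ∈ 𝓕, ∀ k ∈ F, ∀ l ∈ F, c F k (p t) = 0 → c F l (p t) = 0 → k = l := by
      intro F hF k hk l hl h1 h2
      by_contra hkl
      rw [hpc] at h1 h2
      have ht0 : t ≠ 0 := by
        rintro rfl
        simp only [sub_zero, one_mul, zero_mul, add_zero] at h1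
        exact hyg F hF k hk h1
      refine hyz F hF k hk l hl hkl (mul_left_cancel₀ ht0 ?_)
      linear_combination (c F l y) * h1 - (c F k y) * h2
    have := hpt.continuousAt.eventually (h.eventually_sum_coneWeight_eq hreg hone)
    exact continuousAt_const.congr (this.mono fun s hs => hs.symm)
  have := isPreconnected_Icc.constant hcont (Set.left_mem_Icc.2 zero_le_one)
    (Set.right_mem_Icc.2 zero_le_one)
  simpa [hp] using this

theorem eventually_residual_ne_zero [FiniteDimensional ℝ E] {g : E →ₗ[ℝ] ℝ} (hg : g ≠ 0) :
    ∀ᶠ z in residual E, g z ≠ 0 := by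
  refine residual_of_dense_open
    (isOpen_ne.preimage g.continuous_of_finiteDimensional) ?_
  have : {z | g z ≠ 0} = (LinearMap.ker g : Set E)ᶜ := by ext; simp
  change Dense {z | g z ≠ 0}
  rw [this, ← interior_eq_empty_iff_dense_compl]
  by_contra hne
  have := Submodule.eq_top_of_nonempty_interior' _ (Set.nonempty_iff_ne_empty.2 hne)
  exact hg (LinearMap.ker_eq_top.1 this)

variable [FiniteDimensional ℝ E]

theorem IsFlipSystem.eventually_isGeneric (h : IsFlipSystem m 𝓕 c) :
    ∀ᶠ z in residual E, IsGeneric 𝓕 c z := by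
  unfold IsGeneric
  simp only [Filter.eventually_all_finset]
  intro F hF k hk
  refine eventually_residual_ne_zero fun h0 => ?_
  have := h.dual F hF k hk k hk
  simp [h0] at this

theorem IsFlipSystem.eventually_isTransversal (h : IsFlipSystem m 𝓕 c) {y : E}
    (hy : IsGeneric 𝓕 c y) : ∀ᶠ z in residual E, IsTransversal 𝓕 c y z := by
  unfold IsTransversal
  simp only [Filter.eventually_all_finset]
  intro F hF k hk l hl
  by_cases hkl : k = l
  · exact .of_forall fun z hne => absurd hkl hne
  have : c F l y • c F k - c F k y • c F l ≠ 0 := by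
    intro h0
    have h1 := congrArg (fun g => g (m k)) h0
    simp only [LinearMap.sub_apply, LinearMap.smul_apply, h.dual F hF k hk k hk,
      h.dual F hF l hl k hk, smul_eq_mul, if_true, if_neg (Ne.symm hkl), LinearMap.zero_apply,
      mul_one, mul_zero, sub_zero] at h1
    exact hy F hF l hl h1
  filter_upwards [eventually_residual_ne_zero this] with z hz _ heq
  apply hz
  simp only [LinearMap.sub_apply, LinearMap.smul_apply, smul_eq_mul]
  linarith

theorem exists_mem_of_eventually_residual {P : E → Prop} (hP : ∀ᶠ z in residual E, P z)
    {V : Set E} (hV : IsOpen V) (hne : V.Nonempty) : ∃ z ∈ V, P z := by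
  have : CompleteSpace E := FiniteDimensional.complete ℝ E
  obtain ⟨z, hz1, hz2⟩ := (dense_of_mem_residual hP).inter_open_nonempty V hV hne
  exact ⟨z, hz1, hz2⟩

omit [DecidableEq ι] in
theorem isOpen_forall_pos (F I : Finset ι) : IsOpen {x | ∀ k ∈ I, 0 < c F k x} := by
  have : {x | ∀ k ∈ I, 0 < c F k x} = ⋂ k ∈ I, {x | 0 < c F k x} := by ext; simp
  rw [this]
  exact isOpen_biInter_finset fun k _ =>
    isOpen_lt continuous_const (c F k).continuous_of_finiteDimensional

omit [DecidableEq ι] in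
theorem isOpen_starRegion (I : Finset ι) : IsOpen (starRegion 𝓕 c I) := by
  have : starRegion 𝓕 c I = ⋂ F ∈ 𝓕, ⋂ (_ : I ⊆ F), {x | ∀ k ∈ I, 0 < c F k x} := by
    ext; simp [starRegion]
  rw [this]
  exact isOpen_biInter_finset fun F _ => isOpen_iInter_of_finite fun _ => isOpen_forall_pos F I

theorem IsFlipSystem.sum_coneWeight_eq (h : IsFlipSystem m 𝓕 c) {I : Finset ι} {y z : E}
    (hy : y ∈ starRegion 𝓕 c I) (hz : z ∈ starRegion 𝓕 c I) (hyg : IsGeneric 𝓕 c y)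
    (hzg : IsGeneric 𝓕 c z) :
    ∑ F ∈ 𝓕 with I ⊆ F, coneWeight c F y = ∑ F ∈ 𝓕 with I ⊆ F, coneWeight c F z := by
  -- The segment from `y` to `z` may be degenerate, so the comparison passes through an intermediate
  -- point transversal to both.
  obtain ⟨x, hx, hxy, hxz⟩ := exists_mem_of_eventually_residual
    ((h.eventually_isTransversal hyg).and (h.eventually_isTransversal hzg))
    (isOpen_starRegion I) ⟨y, hy⟩
  rw [h.sum_coneWeight_eq_of_isTransversal hy hx hyg hxy,
    h.sum_coneWeight_eq_of_isTransversal hz hx hzg hxz]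

omit [FiniteDimensional ℝ E] in
theorem IsFlipSystem.exists_coord_pos (h : IsFlipSystem m 𝓕 c) {F : Finset ι} (hF : F ∈ 𝓕) :
    ∀ k ∈ F, 0 < c F k (∑ l ∈ F, m l) := by
  intro k hk
  have := h.coord_sum hF subset_rfl (fun _ => (1 : ℝ)) hk
  simp only [one_smul, if_pos hk] at this
  rw [this]
  exact one_pos

/-- If the interior of one cone meets no other cone, then the interiors of the cones cover every
generic point exactly once. -/
theorem IsFlipSystem.sum_coneWeight_eq_two (h : IsFlipSystem m 𝓕 c) {F₀ : Finset ι}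
    (hF₀ : F₀ ∈ 𝓕) (hinj : ∀ F ∈ 𝓕, F ≠ F₀ → ∀ x, (∀ k ∈ F₀, 0 < c F₀ k x) →
      ¬ ∀ k ∈ F, 0 ≤ c F k x) {y : E} (hy : IsGeneric 𝓕 c y) :
    ∑ F ∈ 𝓕, coneWeight c F y = 2 := by
  obtain ⟨z, hz, hzg⟩ := exists_mem_of_eventually_residual h.eventually_isGeneric
    (isOpen_forall_pos (c := c) F₀ F₀) ⟨_, h.exists_coord_pos hF₀⟩
  have key := h.sum_coneWeight_eq (I := ∅) (y := y) (z := z) (by simp [starRegion])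
    (by simp [starRegion]) hy hzg
  simp only [Finset.empty_subset, Finset.filter_true] at key
  rw [key, Finset.sum_eq_single_of_mem F₀ hF₀, coneWeight_of_pos hz]
  intro F hF hne
  have := hinj F hF hne z hz
  push Not at this
  obtain ⟨k, hk, hneg⟩ := this
  exact coneWeight_of_neg hk hneg

section Injective

variable (h : IsFlipSystem m 𝓕 c) (hsum : ∀ y, IsGeneric 𝓕 c y → ∑ F ∈ 𝓕, coneWeight c F y = 2)

omit [FiniteDimensional ℝ E] in
include hsum in
theorem eq_of_coord_pos {F G : Finset ι} (hF : F ∈ 𝓕) (hG : G ∈ 𝓕) {y : E}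
    (hy : IsGeneric 𝓕 c y) (hFy : ∀ k ∈ F, 0 < c F k y) (hGy : ∀ k ∈ G, 0 < c G k y) : F = G := by
  by_contra hne
  have h1 := hsum y hy
  have h2 : ∑ H ∈ ({F, G} : Finset (Finset ι)), coneWeight c H y ≤ ∑ H ∈ 𝓕, coneWeight c H y := by
    refine Finset.sum_le_sum_of_subset_of_nonneg ?_ fun _ _ _ => coneWeight_nonneg _ _
    intro H hH
    rcases Finset.mem_insert.1 hH with rfl | hH
    · exact hF
    · rwa [Finset.mem_singleton.1 hH]
  rw [Finset.sum_pair hne, coneWeight_of_pos hFy, coneWeight_of_pos hGy, h1] at h2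
  norm_num at h2

-- The union of the closed cones is closed. A nonempty complement would be open and contain a
-- generic point of total weight zero.
include h hsum in
theorem IsFlipSystem.exists_coord_nonneg (x : E) : ∃ F ∈ 𝓕, ∀ k ∈ F, 0 ≤ c F k x := by
  have hclosed : IsClosed {x : E | ∃ F ∈ 𝓕, ∀ k ∈ F, 0 ≤ c F k x} := by
    have : {x : E | ∃ F ∈ 𝓕, ∀ k ∈ F, 0 ≤ c F k x} = ⋃ F ∈ 𝓕, ⋂ k ∈ F, {x | 0 ≤ c F k x} := by
      ext; simp
    rw [this]
    refine isClosed_biUnion_finset fun F _ => isClosed_biInter fun k _ => ?_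
    exact isClosed_le continuous_const (c F k).continuous_of_finiteDimensional
  by_contra hx
  obtain ⟨z, hz, hzg⟩ := exists_mem_of_eventually_residual h.eventually_isGeneric
    hclosed.isOpen_compl ⟨x, hx⟩
  have h2 := hsum z hzg
  obtain ⟨F, hF, hne⟩ := Finset.exists_ne_zero_of_sum_ne_zero (by rw [h2]; norm_num)
  refine hz ⟨F, hF, fun k hk => ?_⟩
  by_contra hneg
  exact hne (coneWeight_of_neg hk (not_le.1 hneg))

include h hsum in
/-- A point determines the support of its expression as a positive combination. -/
theorem IsFlipSystem.eq_of_sum_eq_sum {F G I J : Finset ι} (hF : F ∈ 𝓕) (hG : G ∈ 𝓕)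
    (hI : I ⊆ F) (hJ : J ⊆ G) {a b : ι → ℝ} (ha : ∀ k ∈ I, 0 < a k) (hb : ∀ k ∈ J, 0 < b k)
    (hab : ∑ k ∈ I, a k • m k = ∑ k ∈ J, b k • m k) : I = J := by
  set x := ∑ k ∈ I, a k • m k with hx
  have hxI : ∀ H ∈ 𝓕, I ⊆ H → ∀ k ∈ H, c H k x = if k ∈ I then a k else 0 := fun H hH hIH k hk =>
    h.coord_sum hH hIH a hk
  have hxreg : x ∈ starRegion 𝓕 c I := by
    intro H hH hIH k hk
    rw [hxI H hH hIH k (hIH hk), if_pos hk]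
    exact ha k hk
  -- A small step from `x` towards the interior of `H`, followed by a generic perturbation, stays in
  -- the open star region of `I`.
  have near : ∀ H ∈ 𝓕, (∀ k ∈ H, 0 ≤ c H k x) →
      ∃ z, z ∈ starRegion 𝓕 c I ∧ (∀ k ∈ H, 0 < c H k z) ∧ IsGeneric 𝓕 c z := by
    intro H hH hnn
    set e := ∑ l ∈ H, m l with he
    have hlim : Tendsto (fun ε : ℝ => x + ε • e) (𝓝[>] 0) (𝓝 x) := by
      have : Continuous fun ε : ℝ => x + ε • e := by fun_prop
      have := this.tendsto 0
      simp only [zero_smul, add_zero] at this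
      exact this.mono_left nhdsWithin_le_nhds
    have hev := hlim.eventually ((isOpen_starRegion I).mem_nhds hxreg)
    obtain ⟨ε, hε, hε0⟩ := (hev.and self_mem_nhdsWithin).exists
    have hpos : ∀ k ∈ H, 0 < c H k (x + ε • e) := by
      intro k hk
      rw [map_add, map_smul, smul_eq_mul]
      have := mul_pos hε0 (h.exists_coord_pos hH k hk)
      linarith [hnn k hk]
    obtain ⟨z, hz, hzg⟩ := exists_mem_of_eventually_residual h.eventually_isGeneric
      ((isOpen_starRegion (𝓕 := 𝓕) (c := c) I).inter (isOpen_forall_pos (c := c) H H))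
      ⟨_, hε, hpos⟩
    exact ⟨z, hz.1, hz.2, hzg⟩
  have hGx : ∀ k ∈ G, c G k x = if k ∈ J then b k else 0 := fun k hk => by
    rw [hab]; exact h.coord_sum hG hJ b hk
  obtain ⟨y, hyreg, hyF, hyg⟩ := near F hF fun k hk => by
    rw [hxI F hF hI k hk]; split_ifs with hkI
    · exact (ha k hkI).le
    · exact le_rfl
  obtain ⟨z, hzreg, hzG, hzg⟩ := near G hG fun k hk => by
    rw [hGx k hk]; split_ifs with hkJ
    · exact (hb k hkJ).le
    · exact le_rfl
  -- The point `y` inside `F` shows that the star of `I` has weight at least two throughout its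
  -- region, so some cone of the star contains `z`. As `z` is interior to `G`, that cone is `G`, and
  -- the coordinates of `x` in `G` identify both supports.
  have heq := h.sum_coneWeight_eq hyreg hzreg hyg hzg
  have hFmem : F ∈ 𝓕.filter (I ⊆ ·) := Finset.mem_filter.2 ⟨hF, hI⟩
  have hge : 2 ≤ ∑ H ∈ 𝓕 with I ⊆ H, coneWeight c H y := by
    rw [← coneWeight_of_pos hyF]
    exact Finset.single_le_sum (f := fun H => coneWeight c H y)
      (fun H _ => coneWeight_nonneg H y) hFmem
  obtain ⟨H, hH, hne⟩ := Finset.exists_ne_zero_of_sum_ne_zero (s := 𝓕.filter (I ⊆ ·))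
    (f := fun H => coneWeight c H z) (by rw [← heq]; intro h0; rw [h0] at hge; norm_num at hge)
  obtain ⟨hH𝓕, hIH⟩ := Finset.mem_filter.1 hH
  have hHz : ∀ k ∈ H, 0 < c H k z := by
    intro k hk
    refine lt_of_le_of_ne ?_ (hzg H hH𝓕 k hk).symm
    by_contra hneg
    exact hne (coneWeight_of_neg hk (not_le.1 hneg))
  obtain rfl := eq_of_coord_pos hsum hH𝓕 hG hzg hHz hzG
  ext k
  constructor
  · intro hk
    have h1 := hxI H hH𝓕 hIH k (hIH hk)
    rw [hGx k (hIH hk), if_pos hk] at h1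
    by_contra hkJ
    rw [if_neg hkJ] at h1
    exact (ha k hk).ne h1
  · intro hk
    have h1 := hxI H hH𝓕 hIH k (hJ hk)
    rw [hGx k (hJ hk), if_pos hk] at h1
    by_contra hkI
    rw [if_neg hkI] at h1
    exact (hb k hk).ne' h1

end Injective

end FlipSystem

end SubwordFan

namespace SubwordFan

/-! ### Gale duality: bases and circuits of the columns as minors of the dual matrix. -/

section Circuits

variable {d N r : ℕ} {M : Matrix (Fin d) (Fin r) ℝ} {MG : Matrix (Fin N) (Fin r) ℝ}

open Matrix

theorem sum_smul_col (M : Matrix (Fin d) (Fin r) ℝ) (g : Fin r → ℝ) :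
    ∑ k, g k • M.col k = M *ᵥ g := by
  ext i
  simp [Matrix.mulVec, dotProduct, Finset.sum_apply, mul_comm]

theorem IsGaleDual.sum_smul_col_eq_zero_iff (h : IsGaleDual M MG) (g : Fin r → ℝ) :
    ∑ k, g k • M.col k = 0 ↔ ∃ y, y ᵥ* MG = g := by
  have h2 : g ∈ Submodule.span ℝ (Set.range MG.row) ↔ g ∈ LinearMap.ker M.mulVecLin := by rw [h.2]
  rw [sum_smul_col, ← Matrix.mulVecLin_apply, ← LinearMap.mem_ker, ← h2,
    Submodule.mem_span_range_iff_exists_fun]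
  simp only [Matrix.row_def, Matrix.vecMul_eq_sum]

theorem sum_smul_eq_sum_univ {E : Type*} [AddCommGroup E] [Module ℝ E] {F : Finset (Fin r)}
    {g : Fin r → ℝ} (v : Fin r → E) (hg : ∀ k ∉ F, g k = 0) :
    ∑ k ∈ F, g k • v k = ∑ k, g k • v k :=
  Finset.sum_subset (Finset.subset_univ F) fun k _ hk => by rw [hg k hk, zero_smul]

/-- The relations among the columns of `M` are the vectors `y ᵥ* MG`. One supported off the
positions of `f` is the same as a `y` in the left kernel of the minor, and distinct `y` give
distinct relations. -/
theorem IsGaleDual.linearIndepOn_compl_iff (h : IsGaleDual M MG) (f : Fin N ↪o Fin r) :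
    LinearIndepOn ℝ M.col ((Finset.univ.map f.toEmbedding)ᶜ : Finset (Fin r)) ↔
      (MG.submatrix id f).det ≠ 0 := by
  have hsub : ∀ (y : Fin N → ℝ) (i : Fin N), (y ᵥ* MG.submatrix id f) i = (y ᵥ* MG) (f i) :=
    fun y i => rfl
  constructor
  · intro hli hdet
    obtain ⟨y, hy0, hy⟩ := Matrix.exists_vecMul_eq_zero_iff.2 hdet
    have hg := (h.sum_smul_col_eq_zero_iff _).2 ⟨y, rfl⟩
    have hz : ∀ k ∉ (Finset.univ.map f.toEmbedding)ᶜ, (y ᵥ* MG) k = 0 := by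
      intro k hk
      simp only [Finset.mem_compl, not_not, Finset.mem_map, Finset.mem_univ, true_and] at hk
      obtain ⟨i, rfl⟩ := hk
      exact congrFun hy i
    rw [← sum_smul_eq_sum_univ _ hz] at hg
    have hall := linearIndepOn_finset_iff.1 hli _ hg
    have h0 : y ᵥ* MG = 0 := by
      ext k
      by_cases hk : k ∈ (Finset.univ.map f.toEmbedding)ᶜ
      · exact hall k hk
      · exact hz k hk
    exact hy0 (Matrix.vecMul_injective_iff.2 h.1 (h0.trans (Matrix.zero_vecMul _).symm))
  · intro hdet
    rw [linearIndepOn_finset_iff]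
    intro g hg i hi
    classical
    let g' : Fin r → ℝ := fun k => if k ∈ (Finset.univ.map f.toEmbedding)ᶜ then g k else 0
    have hg' : ∑ k, g' k • M.col k = 0 := by
      rw [← sum_smul_eq_sum_univ (F := (Finset.univ.map f.toEmbedding)ᶜ), ← hg]
      · exact Finset.sum_congr rfl fun k hk => by simp only [g', if_pos hk]
      · exact fun k hk => if_neg hk
    obtain ⟨y, hy⟩ := (h.sum_smul_col_eq_zero_iff _).1 hg'
    have hy0 : y = 0 := by
      by_contra hne
      refine hdet (Matrix.exists_vecMul_eq_zero_iff.1 ⟨y, hne, ?_⟩)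
      ext k
      rw [hsub, hy]
      exact if_neg (by simp)
    have : g' i = 0 := by rw [← hy, hy0, Matrix.zero_vecMul]; rfl
    simpa only [g', if_pos hi] using this

theorem comp_succAbove_eq {n : ℕ} {f g : Fin (n + 1) ↪o Fin r} {a b : Fin (n + 1)}
    (h : (Finset.univ.map f.toEmbedding).erase (f a) =
      (Finset.univ.map g.toEmbedding).erase (g b)) (j : Fin n) :
    f (a.succAbove j) = g (b.succAbove j) := by
  have hr : ∀ (f : Fin (n + 1) ↪o Fin r) (a : Fin (n + 1)),
      Set.range (f ∘ a.succAbove) = ((Finset.univ.map f.toEmbedding).erase (f a) : Finset _) := by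
    intro f a
    rw [Set.range_comp, Fin.range_succAbove]
    ext x
    simp only [Set.mem_image, Set.mem_compl_iff, Set.mem_singleton_iff, Finset.coe_erase,
      Finset.coe_map, Set.mem_sdiff, Finset.coe_univ, Set.image_univ, Set.mem_range]
    constructor
    · rintro ⟨i, hi, rfl⟩
      exact ⟨⟨i, rfl⟩, fun h => hi (f.injective h)⟩
    · rintro ⟨⟨i, rfl⟩, hi⟩
      exact ⟨i, fun h => hi (by rw [h]; rfl), rfl⟩
  have hm : ∀ (f : Fin (n + 1) ↪o Fin r) (a : Fin (n + 1)), StrictMono (f ∘ a.succAbove) :=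
    fun f a => f.strictMono.comp a.strictMono_succAbove
  exact congrFun (((hm f a).range_inj (hm g b)).1 (by rw [hr, hr, h])) j

/-- Two embeddings which differ in one position define a circuit of the columns of `M`. -/
theorem IsGaleDual.exists_circuit (h : IsGaleDual M MG) {f g : Fin N ↪o Fin r} {a b : Fin N}
    (hfg : (Finset.univ.map f.toEmbedding).erase (f a) =
      (Finset.univ.map g.toEmbedding).erase (g b)) :
    ∃ c : Fin r → ℝ, ∑ k, c k • M.col k = 0 ∧
      (∀ k ∈ (Finset.univ.map f.toEmbedding).erase (f a), c k = 0) ∧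
      c (f a) = (-1) ^ (a : ℕ) * (MG.submatrix id f).det ∧
      c (g b) = (-1) ^ (b : ℕ) * (MG.submatrix id g).det := by
  cases N with
  | zero => exact a.elim0
  | succ n =>
    have hs := comp_succAbove_eq hfg
    -- `y` consists of the signed maximal minors of the `n` common columns. So `(y ᵥ* MG) k` is the
    -- determinant with column `k` placed before them: it vanishes on the common columns, and moving
    -- the column back to its place costs `(-1)^a` or `(-1)^b`.
    let y : Fin (n + 1) → ℝ := fun i =>
      (-1) ^ (i : ℕ) * (MG.submatrix i.succAbove fun j => f (a.succAbove j)).det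
    have hupd : ∀ k, (-1) ^ (a : ℕ) * ((MG.submatrix id f).updateCol a (MG.col k)).det =
        (y ᵥ* MG) k := by
      intro k
      rw [Matrix.det_succ_column _ a, Finset.mul_sum]
      change _ = ∑ i, y i * MG i k
      refine Finset.sum_congr rfl fun i _ => ?_
      rw [Matrix.updateCol_self, Matrix.submatrix_updateCol_succAbove, Matrix.submatrix_submatrix,
        Matrix.col_apply]
      have h1 : ((-1 : ℝ) ^ (a : ℕ)) * (-1) ^ (a : ℕ) = 1 := by
        rw [← mul_pow]; simp
      simp only [y, pow_add]
      rw [show (MG.submatrix (id ∘ i.succAbove) (f ∘ a.succAbove)).det =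
        (MG.submatrix i.succAbove fun j => f (a.succAbove j)).det from rfl]
      linear_combination ((-1) ^ (i : ℕ) * MG i k *
        (MG.submatrix i.succAbove fun j => f (a.succAbove j)).det) * h1
    refine ⟨y ᵥ* MG, (h.sum_smul_col_eq_zero_iff _).2 ⟨y, rfl⟩, ?_, ?_, ?_⟩
    · intro k hk
      simp only [Finset.mem_erase, Finset.mem_map, Finset.mem_univ, true_and] at hk
      obtain ⟨hk1, i, rfl⟩ := hk
      have hi : i ≠ a := fun h => hk1 (by rw [h]; rfl)
      rw [← hupd, Matrix.det_zero_of_column_eq hi, mul_zero]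
      intro j
      rw [Matrix.updateCol_ne hi, Matrix.updateCol_self]
      rfl
    · rw [← hupd]
      congr 2
      exact Matrix.updateCol_eq_self _ _
    · change ∑ i, y i * MG i (g b) = _
      rw [Matrix.det_succ_column _ b, Finset.mul_sum]
      refine Finset.sum_congr rfl fun i _ => ?_
      have h1 : ((-1 : ℝ) ^ (b : ℕ)) * (-1) ^ (b : ℕ) = 1 := by
        rw [← mul_pow]; simp
      simp only [y, pow_add, hs, Matrix.submatrix_submatrix]
      rw [show (MG.submatrix (id ∘ i.succAbove) (g ∘ b.succAbove)).det =
        (MG.submatrix i.succAbove fun j => g (b.succAbove j)).det from rfl]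
      rw [Matrix.submatrix_apply, id_eq]
      linear_combination (-(-1) ^ (i : ℕ) * MG i (g b) *
        (MG.submatrix i.succAbove fun j => g (b.succAbove j)).det) * h1

end Circuits

/-! ### Occurrences as sets of positions, and circuits with sign-corrected coefficients. -/

section Occurrences

variable {B W : Type*} [Group W] {C : CoxeterMatrix B} {cs : CoxeterSystem C W} {r : ℕ}
  {Q : Fin r → B} {w : W}

theorem eraseIdx_ofFn {α : Type*} {n : ℕ} (f : Fin (n + 1) → α) (a : Fin (n + 1)) :
    (List.ofFn f).eraseIdx a = List.ofFn fun j => f (a.succAbove j) := by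
  apply List.ext_getElem
  · rw [List.length_eraseIdx_of_lt (by simpa using a.is_le)]; simp
  · intro i h1 h2
    rw [List.getElem_eraseIdx, List.getElem_ofFn]
    simp only [List.length_ofFn] at h2
    split
    · rename_i h
      rw [List.getElem_ofFn, Fin.succAbove_of_castSucc_lt]
      · rfl
      · exact h
    · rename_i h
      rw [List.getElem_ofFn, List.getElem_ofFn, Fin.succAbove_of_le_castSucc]
      · rfl
      · exact not_lt.1 h

theorem eraseIdx_ofFn_eq_of_erase_eq {n : ℕ} {f g : Fin n ↪o Fin r} {a b : Fin n}
    (h : (Finset.univ.map f.toEmbedding).erase (f a) =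
      (Finset.univ.map g.toEmbedding).erase (g b)) :
    (List.ofFn f).eraseIdx a = (List.ofFn g).eraseIdx b := by
  cases n with
  | zero => exact a.elim0
  | succ n => rw [eraseIdx_ofFn, eraseIdx_ofFn, funext (comp_succAbove_eq h)]

/-- The words differ by moving one letter from index `a` to index `b`, through a factor of length
`|b - a|`. The resulting sign matches the position signs of the minors in
`IsGaleDual.exists_circuit`. -/
theorem IsBraidSign.eraseIdx_eq {τ : List B → ℤˣ} (hτ : IsBraidSign cs w τ) {L L' : List B}
    (hL : IsReducedWord cs w L) (hL' : IsReducedWord cs w L') {a b : ℕ} (ha : a < L.length)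
    (hb : b < L'.length) (hab : L.eraseIdx a = L'.eraseIdx b) :
    (-1) ^ a * τ L = (-1) ^ b * τ L' := by
  wlog h : a ≤ b generalizing a b L L'
  · exact (this hL' hL hb ha hab.symm (le_of_not_ge h)).symm
  obtain ⟨m, rfl⟩ := Nat.exists_eq_add_of_le h
  have e1 : L = L.take a ++ L[a] :: L.drop (a + 1) := by simp
  have e2 : L' = L'.take (a + m) ++ L'[a + m] :: L'.drop (a + m + 1) := by
    rw [List.cons_getElem_drop_succ, List.take_append_drop]
  have hab' : L.take a ++ L.drop (a + 1) = L'.take (a + m) ++ L'.drop (a + m + 1) := by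
    rw [← List.eraseIdx_eq_take_drop_succ, ← List.eraseIdx_eq_take_drop_succ, hab]
  obtain ⟨v, hv1, hv2⟩ : ∃ v, L'.take (a + m) = L.take a ++ v ∧
      L.drop (a + 1) = v ++ L'.drop (a + m + 1) := by
    rcases List.append_eq_append_iff.1 hab' with ⟨v, h1, h2⟩ | ⟨v, h1, h2⟩
    · exact ⟨v, h1, h2⟩
    · have hl := congrArg List.length h1
      simp only [List.length_take, List.length_append] at hl
      have : v = [] := List.eq_nil_of_length_eq_zero (by omega)
      subst this
      exact ⟨[], by simpa using h1.symm, by simpa using h2.symm⟩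
  have hvl : v.length = m := by
    have hl := congrArg List.length hv1
    simp only [List.length_take, List.length_append] at hl
    omega
  rw [hv2] at e1
  rw [hv1] at e2
  generalize L.take a = u at *
  generalize L'.drop (a + m + 1) = z at *
  generalize L[a] = s at *
  generalize L'[a + m] = s' at *
  subst e1 e2
  have hp := hL.1.trans hL'.1.symm
  simp only [cs.wordProd_append, cs.wordProd_cons] at hp
  have hc : cs.simple s * cs.wordProd v = cs.wordProd v * cs.simple s' := by
    have hp' : cs.wordProd u * (cs.simple s * cs.wordProd v) * cs.wordProd z =
      cs.wordProd u * (cs.wordProd v * cs.simple s') * cs.wordProd z := by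
      simpa only [mul_assoc] using hp
    exact mul_left_cancel (mul_right_cancel hp')
  have hf := hτ.flip v s s' u z hc (by simpa using hL)
  simp only [List.append_assoc, List.cons_append, List.nil_append] at hf ⊢
  rw [hf, hvl, ← mul_assoc, pow_add]

/-- The positions used by an occurrence. -/
noncomputable def Occurrence.support (f : Occurrence cs w Q) : Finset (Fin r) :=
  Finset.univ.map f.1.toEmbedding

theorem Occurrence.sort_support (f : Occurrence cs w Q) : f.support.sort = List.ofFn f.1 := by
  refine List.Perm.eq_of_pairwise' (r := (· ≤ ·)) (Finset.pairwise_sort _ _) ?_ ?_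
  · rw [List.pairwise_ofFn]
    exact fun i j hij => f.1.monotone hij.le
  · rw [List.perm_ext_iff_of_nodup (Finset.sort_nodup _ _) (List.nodup_ofFn.2 f.1.injective)]
    intro x
    simp [Occurrence.support, List.mem_ofFn]

theorem Occurrence.isReducedSubword (f : Occurrence cs w Q) :
    IsReducedSubword cs Q w f.support := by
  have hmap : f.support.sort.map Q = List.ofFn (Q ∘ f.1) := by
    rw [f.sort_support, List.map_ofFn]
  exact ⟨by rw [hmap]; exact f.2, by rw [hmap, List.length_ofFn]⟩

theorem Occurrence.isReducedWord (f : Occurrence cs w Q) :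
    IsReducedWord cs w (List.ofFn (Q ∘ f.1)) := ⟨f.2, List.length_ofFn⟩

theorem Occurrence.card_support (f : Occurrence cs w Q) : f.support.card = cs.length w := by
  simp [Occurrence.support]

theorem exists_support_eq {S : Finset (Fin r)} (h : IsReducedSubword cs Q w S) :
    ∃ f : Occurrence cs w Q, f.support = S := by
  have hc : S.card = cs.length w := (isReducedSubword_iff.1 h).2
  have hsort : S.sort = List.ofFn (S.orderEmbOfFin hc) := by
    refine List.Perm.eq_of_pairwise' (r := (· ≤ ·)) (Finset.pairwise_sort _ _) ?_ ?_
    · rw [List.pairwise_ofFn]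
      exact fun i j hij => (S.orderEmbOfFin hc).monotone hij.le
    · rw [List.perm_ext_iff_of_nodup (Finset.sort_nodup _ _)
        (List.nodup_ofFn.2 (S.orderEmbOfFin hc).injective)]
      intro x
      rw [Finset.mem_sort, List.mem_ofFn, ← Set.mem_range, Finset.range_orderEmbOfFin, Finset.mem_coe]
  refine ⟨⟨S.orderEmbOfFin hc, ?_⟩, ?_⟩
  · rw [← List.map_ofFn, ← hsort]
    exact h.1
  · ext x
    simp [Occurrence.support]

theorem Occurrence.mem_support {f : Occurrence cs w Q} {x : Fin r} :
    x ∈ f.support ↔ ∃ i, f.1 i = x := by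
  simp [Occurrence.support]

/-- The number whose positivity is required of a signature matrix. -/
noncomputable def Occurrence.signedDet (σ : ReducedExpr cs w → ℤˣ)
    (D : Matrix (Fin (cs.length w)) (Fin r) ℝ) (f : Occurrence cs w Q) : ℝ :=
  (((σ f.word : ℤˣ) : ℤ) : ℝ) * (D.submatrix id f.1).det

theorem Occurrence.signedDet_ne_zero_iff (σ : ReducedExpr cs w → ℤˣ)
    (D : Matrix (Fin (cs.length w)) (Fin r) ℝ) (f : Occurrence cs w Q) :
    f.signedDet σ D ≠ 0 ↔ (D.submatrix id f.1).det ≠ 0 := by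
  have h : (((σ f.word : ℤˣ) : ℤ) : ℝ) ≠ 0 := by
    rcases Int.units_eq_one_or (σ f.word) with h | h <;> simp [h]
  simp [Occurrence.signedDet, h]

/-- Rescaling the circuit of minors by `(-1)^a * σ f.word`, which equals `(-1)^b * σ g.word`, clears
the position signs. Positivity of the signed determinants thus becomes equality of the circuit's
signs at the two exchanged vertices. -/
theorem IsSignFunction.exists_circuit {d : ℕ} {M : Matrix (Fin d) (Fin r) ℝ}
    {MG : Matrix (Fin (cs.length w)) (Fin r) ℝ} (h : IsGaleDual M MG)
    {σ : ReducedExpr cs w → ℤˣ} (hσ : IsSignFunction cs w σ) {f g : Occurrence cs w Q}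
    {x y : Fin r} (hx : x ∈ f.support) (hy : y ∈ g.support)
    (hfg : f.support.erase x = g.support.erase y) :
    ∃ c : Fin r → ℝ, ∑ k, c k • M.col k = 0 ∧ (∀ k ∈ f.support.erase x, c k = 0) ∧
      c x = f.signedDet σ MG ∧ c y = g.signedDet σ MG := by
  obtain ⟨a, rfl⟩ := Occurrence.mem_support.1 hx
  obtain ⟨b, rfl⟩ := Occurrence.mem_support.1 hy
  obtain ⟨c, hc0, hcz, hca, hcb⟩ := h.exists_circuit (f := f.1) (g := g.1) hfg
  have hτ := isBraidSign_extendSign cs hσ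
  have hext : ∀ f : Occurrence cs w Q, extendSign cs σ (List.ofFn (Q ∘ f.1)) = σ f.word := by
    intro f
    have hh : cs.IsReduced (List.ofFn (Q ∘ f.1)) ∧ cs.wordProd (List.ofFn (Q ∘ f.1)) = w :=
      ⟨f.isReducedWord.isReduced, f.2⟩
    unfold extendSign
    rw [dif_pos hh]
    rfl
  have herase : (List.ofFn (Q ∘ f.1)).eraseIdx a = (List.ofFn (Q ∘ g.1)).eraseIdx b := by
    rw [← List.map_ofFn, ← List.map_ofFn, List.eraseIdx_map, List.eraseIdx_map]
    exact congrArg (List.map Q) (eraseIdx_ofFn_eq_of_erase_eq hfg)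
  have hsg := hτ.eraseIdx_eq f.isReducedWord g.isReducedWord (a := a) (b := b)
    (by simp) (by simp) herase
  rw [hext, hext] at hsg
  have hsgR : ((-1 : ℝ)) ^ (a : ℕ) * (((σ f.word : ℤˣ) : ℤ) : ℝ) =
      (-1) ^ (b : ℕ) * (((σ g.word : ℤˣ) : ℤ) : ℝ) := by
    have := congrArg (fun u : ℤˣ => ((u : ℤ) : ℝ)) hsg
    simpa using this
  have hsq : ∀ n : ℕ, ((-1 : ℝ)) ^ n * (-1) ^ n = 1 := fun n => by rw [← mul_pow]; simp
  refine ⟨fun k => (-1) ^ (a : ℕ) * (((σ f.word : ℤˣ) : ℤ) : ℝ) * c k, ?_, ?_, ?_, ?_⟩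
  · simp only [mul_smul, ← Finset.smul_sum, hc0, smul_zero]
  · intro k hk
    simp only [hcz k hk, mul_zero]
  · simp only [hca, Occurrence.signedDet]
    linear_combination ((((σ f.word : ℤˣ) : ℤ) : ℝ) * (MG.submatrix id f.1).det) * hsq a
  · simp only [hcb, Occurrence.signedDet, hsgR]
    linear_combination ((((σ g.word : ℤˣ) : ℤ) : ℝ) * (MG.submatrix id g.1).det) * hsq b

end Occurrences

end SubwordFan

namespace SubwordFan

/-! ### Faces of finitely generated and simplicial cones. -/

section Cones

open PointedCone

variable {ι E : Type*} [AddCommGroup E] [Module ℝ E] {v : ι → E} {I : Finset ι} {x : E}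

theorem mem_hull_image_iff :
    x ∈ hull ℝ (v '' (I : Set ι)) ↔
      ∃ a : ι → ℝ, (∀ k ∈ I, 0 ≤ a k) ∧ ∑ k ∈ I, a k • v k = x := by
  constructor
  · intro h
    obtain ⟨c, hc⟩ := Submodule.mem_span_image_finset_iff_exists_fun' _ |>.1 h
    exact ⟨fun k => c k, fun k _ => (c k).2, hc⟩
  · rintro ⟨a, ha, rfl⟩
    exact Submodule.sum_mem _ fun k hk =>
      PointedCone.smul_mem _ (ha k hk) (subset_hull ⟨k, hk, rfl⟩)

theorem exists_pos_of_mem_hull_image (h : x ∈ hull ℝ (v '' (I : Set ι))) :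
    ∃ L ⊆ I, ∃ a : ι → ℝ, (∀ k ∈ L, 0 < a k) ∧ ∑ k ∈ L, a k • v k = x := by
  classical
  obtain ⟨a, ha, rfl⟩ := mem_hull_image_iff.1 h
  refine ⟨I.filter fun k => 0 < a k, Finset.filter_subset _ _, a, by simp, ?_⟩
  refine Finset.sum_subset (Finset.filter_subset _ _) fun k hk hk' => ?_
  have : a k = 0 := le_antisymm (by simpa [hk] using hk') (ha k hk)
  rw [this, zero_smul]

/-- A face contains every generator that occurs with a positive coefficient in one of its points, so
it is spanned by the generators it contains. -/
theorem exists_eq_hull_of_isFaceOf {τ : PointedCone ℝ E} (h : τ.IsFaceOf (hull ℝ (v '' (I : Set ι)))) :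
    ∃ L ⊆ I, τ = hull ℝ (v '' (L : Set ι)) := by
  classical
  refine ⟨I.filter fun k => v k ∈ τ, Finset.filter_subset _ _, le_antisymm ?_ ?_⟩
  · intro x hx
    obtain ⟨L, hL, a, ha, rfl⟩ := exists_pos_of_mem_hull_image (h.le hx)
    refine mem_hull_image_iff.2 ⟨fun k => if k ∈ L then a k else 0, fun k _ => ?_, ?_⟩
    · dsimp only
      split_ifs with hk
      exacts [(ha k hk).le, le_rfl]
    · have hLτ : ∀ k ∈ L, v k ∈ τ := by
        intro k hk
        have hs : a k • v k + ∑ l ∈ L.erase k, a l • v l ∈ τ := by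
          rwa [Finset.add_sum_erase L (fun l => a l • v l) hk]
        refine h.mem_of_smul_add_mem (subset_hull ⟨k, hL hk, rfl⟩) ?_ (ha k hk) hs
        exact Submodule.sum_mem _ fun l hl => PointedCone.smul_mem _
          (ha l (Finset.mem_of_mem_erase hl)).le
          (subset_hull ⟨l, hL (Finset.mem_of_mem_erase hl), rfl⟩)
      symm
      refine (Finset.sum_congr rfl fun k hk => by simp only [if_pos hk]).trans
        (Finset.sum_subset (fun k hk => ?_) fun k _ hk => by simp only [if_neg hk, zero_smul])
      exact Finset.mem_filter.2 ⟨hL hk, hLτ k hk⟩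
  · refine Submodule.span_le.2 ?_
    rintro _ ⟨k, hk, rfl⟩
    exact (Finset.mem_filter.1 hk).2

theorem isFaceOf_hull_of_linearIndepOn (hli : LinearIndepOn ℝ v (I : Set ι)) {L : Finset ι}
    (hL : L ⊆ I) : (hull ℝ (v '' (L : Set ι))).IsFaceOf (hull ℝ (v '' (I : Set ι))) := by
  classical
  refine ⟨Submodule.span_mono (Set.image_mono hL), ?_⟩
  intro x y t hx hy ht hxy
  obtain ⟨a, ha, rfl⟩ := mem_hull_image_iff.1 hx
  obtain ⟨b, hb, rfl⟩ := mem_hull_image_iff.1 hy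
  obtain ⟨e, he, hs⟩ := mem_hull_image_iff.1 hxy
  have hz : ∀ k ∈ I, (t * a k + b k - if k ∈ L then e k else 0) = 0 := by
    refine linearIndepOn_finset_iff.1 hli _ ?_
    have h2 : ∑ k ∈ I, (if k ∈ L then e k else 0) • v k = ∑ k ∈ L, e k • v k := by
      symm
      exact (Finset.sum_congr rfl fun k hk => by rw [if_pos hk]).trans
        (Finset.sum_subset hL fun k _ hk => by rw [if_neg hk, zero_smul])
    simp only [sub_smul, add_smul, mul_smul, Finset.sum_sub_distrib, Finset.sum_add_distrib,
      ← Finset.smul_sum]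
    rw [h2, hs, sub_self]
  refine mem_hull_image_iff.2 ⟨a, fun k hk => ha k (hL hk), ?_⟩
  refine Finset.sum_subset hL fun k hk hkL => ?_
  have h1 := hz k hk
  rw [if_neg hkL, sub_zero] at h1
  have h2 := mul_nonneg ht.le (ha k hk)
  have h3 : t * a k = 0 := by linarith [hb k hk]
  rw [(mul_eq_zero.1 h3).resolve_left ht.ne', zero_smul]

/-- The generators of a simplicial cone are independent if none of them can be spared. -/
theorem linearIndepOn_of_isSimplicial (h : (hull ℝ (v '' (I : Set ι))).IsSimplicial)
    (hmin : ∀ L ⊆ I, hull ℝ (v '' (I : Set ι)) ≤ hull ℝ (v '' (L : Set ι)) → L = I) :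
    LinearIndepOn ℝ v (I : Set ι) := by
  classical
  obtain ⟨s, hs, hli, hsI⟩ := h
  lift s to Finset E using hs
  have himg : hull ℝ (id '' (s : Set E)) = hull ℝ (s : Set E) := by rw [Set.image_id]
  -- Each independent generator `b` spans a face, so in an expression of `b` through the `v k` all
  -- terms lie on its ray, and some `v k` is a positive multiple of `b`. The indices chosen in this
  -- way already generate the cone, so by minimality they exhaust `I`, whence `I.card ≤ s.card`.
  have key : ∀ b ∈ s, ∃ k ∈ I, ∃ t : ℝ, t • v k = b ∧ 0 ≤ t := by
    intro b hb
    have hface := isFaceOf_hull_of_linearIndepOn hli (Finset.singleton_subset_iff.2 hb)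
    rw [himg, hsI] at hface
    have hbI : b ∈ hull ℝ (v '' (I : Set ι)) := hsI ▸ subset_hull hb
    have hb0 : b ≠ 0 := hli.ne_zero hb
    obtain ⟨L, hL, a, ha, hab⟩ := exists_pos_of_mem_hull_image hbI
    have hmem : ∀ k ∈ L, ∃ t : ℝ, 0 ≤ t ∧ t • b = v k := by
      intro k hk
      have hs' : a k • v k + ∑ l ∈ L.erase k, a l • v l ∈
          hull ℝ (id '' (({b} : Finset E) : Set E)) := by
        rw [Finset.add_sum_erase L (fun l => a l • v l) hk, hab]
        exact subset_hull ⟨b, by simp⟩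
      have := hface.mem_of_smul_add_mem (subset_hull ⟨k, hL hk, rfl⟩)
        (Submodule.sum_mem _ fun l hl => PointedCone.smul_mem _
          (ha l (Finset.mem_of_mem_erase hl)).le
          (subset_hull ⟨l, hL (Finset.mem_of_mem_erase hl), rfl⟩)) (ha k hk) hs'
      obtain ⟨e, he, hs⟩ := mem_hull_image_iff.1 this
      exact ⟨e b, he b (by simp), by simpa using hs⟩
    by_contra hno
    push Not at hno
    refine hb0 ?_
    rw [← hab]
    refine Finset.sum_eq_zero fun k hk => ?_
    obtain ⟨t, ht, htb⟩ := hmem k hk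
    rcases ht.eq_or_lt with rfl | ht
    · rw [← htb, zero_smul, smul_zero]
    · have := hno k (hL hk) t⁻¹ (by rw [← htb, inv_smul_smul₀ ht.ne'])
      exact absurd this (not_lt.2 (inv_nonneg.2 ht.le))
  choose κ hκI t ht ht0 using key
  have hI : s.attach.image (fun b : s => κ b b.2) = I := by
    refine hmin _ (Finset.image_subset_iff.2 fun b _ => hκI b b.2) ?_
    rw [← hsI]
    refine Submodule.span_le.2 fun b hb => ?_
    rw [← ht b hb]
    exact PointedCone.smul_mem _ (ht0 b hb) (subset_hull ⟨κ b hb,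
      Finset.mem_coe.2 (Finset.mem_image.2 ⟨⟨b, hb⟩, Finset.mem_attach _ _, rfl⟩), rfl⟩)
  have hcard : I.card ≤ s.card := by
    rw [← hI]
    exact Finset.card_image_le.trans s.card_attach.le
  have hspan : Submodule.span ℝ (s : Set E) ≤ Submodule.span ℝ (v '' (I : Set ι)) :=
    Submodule.span_le.2 fun b hb => hull_le_span ℝ _ (hsI ▸ subset_hull hb)
  have hfin : FiniteDimensional ℝ (Submodule.span ℝ (v '' (I : Set ι))) :=
    FiniteDimensional.span_of_finite ℝ (I.finite_toSet.image v)
  have hr := Submodule.finrank_mono hspan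
  rw [finrank_span_finset_eq_card hli] at hr
  rw [LinearIndepOn, linearIndependent_iff_card_le_finrank_span, Set.finrank,
    Set.range_comp', Subtype.range_coe]
  simpa using hcard.trans hr

theorem isSimplicial_hull_of_linearIndepOn (hli : LinearIndepOn ℝ v (I : Set ι)) :
    (hull ℝ (v '' (I : Set ι))).IsSimplicial :=
  .hull (I.finite_toSet.image v) hli.id_image

theorem exists_dual_of_linearIndepOn [FiniteDimensional ℝ E] [DecidableEq ι]
    (hli : LinearIndepOn ℝ v (I : Set ι)) (hcard : I.card = Module.finrank ℝ E) :
    ∃ c : ι → E →ₗ[ℝ] ℝ, (∀ x, ∑ k ∈ I, c k x • v k = x) ∧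
      ∀ k ∈ I, ∀ l ∈ I, c k (v l) = if k = l then 1 else 0 := by
  have hc : Fintype.card (I : Set ι) = Module.finrank ℝ E := by simpa using hcard
  rcases isEmpty_or_nonempty (I : Set ι) with he | hne
  · have hI : I = ∅ := by simpa using he
    subst hI
    have : Subsingleton E := Module.finrank_zero_iff.1 (by simpa using hcard.symm)
    exact ⟨fun _ => 0, fun x => Subsingleton.elim _ _, by simp⟩
  let b := basisOfLinearIndependentOfCardEqFinrank hli hc
  have hb : ∀ k, b k = v k := fun k => by simp [b]
  refine ⟨fun k => if h : k ∈ I then b.coord ⟨k, h⟩ else 0, fun x => ?_, fun k hk l hl => ?_⟩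
  · conv_rhs => rw [← b.sum_repr x]
    rw [← Finset.sum_attach I]
    refine Finset.sum_congr rfl fun k _ => ?_
    simp only [dif_pos k.2, hb]
    rfl
  · simp only [dif_pos hk]
    rw [← hb ⟨l, hl⟩]
    simp [Finsupp.single_apply, eq_comm]

/-- For `z` in the cone and small `t > 0`, the interior point `y` is the sum of `t • z` and a point
of the cone, so the face containing `y` contains `z`. -/
theorem le_of_isFaceOf_of_mem_interior {E : Type*} [NormedAddCommGroup E] [NormedSpace ℝ E]
    {σ τ : PointedCone ℝ E} (h : τ.IsFaceOf σ) {y : E} (hy : y ∈ interior (σ : Set E))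
    (hyτ : y ∈ τ) : σ ≤ τ := by
  intro z hz
  have hcont : Filter.Tendsto (fun t : ℝ => y - t • z) (nhdsWithin 0 (Set.Ioi 0)) (nhds y) := by
    have : Continuous fun t : ℝ => y - t • z := by fun_prop
    simpa using (this.tendsto 0).mono_left nhdsWithin_le_nhds
  obtain ⟨t, ht, ht0⟩ := ((hcont.eventually (mem_interior_iff_mem_nhds.1 hy)).and
    self_mem_nhdsWithin).exists
  exact h.mem_of_smul_add_mem hz ht ht0 (by simpa using hyτ)

end Cones

end SubwordFan

namespace SubwordFan

/-! ### The two implications of the theorem. -/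

section Assembly

open PointedCone

variable {B W : Type*} [Group W] {C : CoxeterMatrix B} {cs : CoxeterSystem C W} {r : ℕ}
  {Q : Fin r → B} {w : W}

theorem mem_subwordComplex_iff {I : Finset (Fin r)} :
    I ∈ subwordComplex cs w Q ↔ ∃ f : Occurrence cs w Q, I ⊆ f.supportᶜ := by
  refine exists_congr fun f => ⟨fun h x hx => ?_, fun h k hk => ?_⟩
  · rw [Finset.mem_compl, Occurrence.mem_support]
    rintro ⟨k, rfl⟩
    exact h k hx
  · exact Finset.mem_compl.1 (h hk) (Occurrence.mem_support.2 ⟨k, rfl⟩)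

theorem Occurrence.compl_support_mem (f : Occurrence cs w Q) :
    f.supportᶜ ∈ subwordComplex cs w Q := mem_subwordComplex_iff.2 ⟨f, le_rfl⟩

theorem Occurrence.card_compl_support (f : Occurrence cs w Q) :
    f.supportᶜ.card = r - cs.length w := by
  rw [Finset.card_compl, f.card_support, Fintype.card_fin]

theorem Occurrence.isFacet_compl_support (f : Occurrence cs w Q) :
    IsFacet (subwordComplex cs w Q) f.supportᶜ := by
  refine ⟨f.compl_support_mem, fun J hJ hle => ?_⟩
  obtain ⟨g, hg⟩ := mem_subwordComplex_iff.1 hJ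
  have hle' : f.supportᶜ ⊆ J := hle
  rw [Finset.eq_of_subset_of_card_le hle' ((Finset.card_le_card hg).trans
    (g.card_compl_support.trans f.card_compl_support.symm).le)]

theorem exists_eq_compl_support {I : Finset (Fin r)} (h : IsFacet (subwordComplex cs w Q) I) :
    ∃ f : Occurrence cs w Q, I = f.supportᶜ := by
  obtain ⟨f, hf⟩ := mem_subwordComplex_iff.1 h.1
  exact ⟨f, h.eq_of_le f.compl_support_mem hf⟩

theorem notMem_of_erase_eq {S T : Finset (Fin r)} {x y : Fin r} (hy : y ∈ T)
    (h : S.erase x = T.erase y) (hne : S ≠ T) (hx : x ∈ S) : y ∉ S ∧ x ∉ T := by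
  have hxy : x ≠ y := by
    rintro rfl
    exact hne (by rw [← Finset.insert_erase hx, h, Finset.insert_erase hy])
  constructor
  · intro hyS
    have : y ∈ T.erase y := h ▸ Finset.mem_erase.2 ⟨hxy.symm, hyS⟩
    exact Finset.notMem_erase y T this
  · intro hxT
    have : x ∈ S.erase x := h ▸ Finset.mem_erase.2 ⟨hxy, hxT⟩
    exact Finset.notMem_erase x S this

section Forward

variable {d : ℕ} {M : Matrix (Fin d) (Fin r) ℝ} {K : Set (Finset (Fin r))}

theorem IsCompleteSimplicialFanRealization.linearIndepOn (hK : IsLowerSet K)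
    (h : IsCompleteSimplicialFanRealization K M) {I : Finset (Fin r)} (hI : I ∈ K) :
    LinearIndepOn ℝ M.col (I : Set (Fin r)) := by
  refine linearIndepOn_of_isSimplicial (h.fan.simplicial _ ⟨I, hI, rfl⟩) fun L hL hle => ?_
  exact hL.antisymm ((h.realizes I hI L (hK hL hI)).1 hle)

/-- The two facets containing a common ridge lie on opposite sides of it. -/
theorem IsCompleteSimplicialFanRealization.circuit_pos (hK : IsLowerSet K)
    (h : IsCompleteSimplicialFanRealization K M) {F G : Finset (Fin r)} (hF : F ∈ K) (hG : G ∈ K)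
    {x y : Fin r} (hxF : x ∉ F) (hyF : y ∈ F) (hxG : x ∈ G)
    (hFG : F.erase y = G.erase x) {c : Fin r → ℝ} (hc : ∑ k, c k • M.col k = 0)
    (hcz : ∀ k ∉ F, k ≠ x → c k = 0) (hx0 : c x ≠ 0) (hy0 : c y ≠ 0) : 0 < c x * c y := by
  by_contra hneg
  have hneg : c x * c y < 0 := lt_of_le_of_ne (not_lt.1 hneg) (mul_ne_zero hx0 hy0)
  have hsum : c x • M.col x + (c y • M.col y + ∑ k ∈ G.erase x, c k • M.col k) = 0 := by
    rw [← hFG, Finset.add_sum_erase F (fun k => c k • M.col k) hyF,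
      ← Finset.sum_insert (f := fun k => c k • M.col k) hxF, ← hc]
    refine sum_smul_eq_sum_univ _ fun k hk => ?_
    rw [Finset.mem_insert, not_or] at hk
    exact hcz k hk.2 hk.1
  -- If the signs at `x` and `y` differed, adding enough of the common generators to the column of
  -- `x` would give a point of both cones. The intersection is a face of the cone of `G`, so the
  -- column of `x` would lie in the cone of `F`, contradicting `x ∉ F` by the poset isomorphism.
  set e : Fin r → ℝ := fun k => |c k / c x| with he
  have heq : M.col x + ∑ k ∈ G.erase x, e k • M.col k =
      (-(c y / c x)) • M.col y + ∑ k ∈ F.erase y, (e k - c k / c x) • M.col k := by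
    rw [hFG]
    have h1 := congrArg ((c x)⁻¹ • ·) hsum
    simp only [smul_add, Finset.smul_sum, smul_smul, smul_zero, inv_mul_cancel₀ hx0,
      one_smul] at h1
    simp only [sub_smul, Finset.sum_sub_distrib, neg_smul, div_eq_inv_mul]
    rw [eq_comm, ← sub_eq_zero]
    rw [← neg_eq_zero, ← h1]
    abel
  have hxmem : M.col x ∈ colCone M G := subset_hull ⟨x, hxG, rfl⟩
  have hrest : ∑ k ∈ G.erase x, e k • M.col k ∈ colCone M G :=
    Submodule.sum_mem _ fun k hk => PointedCone.smul_mem _ (abs_nonneg _)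
      (subset_hull ⟨k, Finset.mem_of_mem_erase hk, rfl⟩)
  have hpF : M.col x + ∑ k ∈ G.erase x, e k • M.col k ∈ colCone M F := by
    rw [heq]
    refine Submodule.add_mem _ (PointedCone.smul_mem _ ?_ (subset_hull ⟨y, hyF, rfl⟩)) ?_
    · rw [neg_nonneg, div_nonpos_iff]
      rcases mul_neg_iff.1 hneg with ⟨h1, h2⟩ | ⟨h1, h2⟩
      exacts [Or.inr ⟨h2.le, h1.le⟩, Or.inl ⟨h2.le, h1.le⟩]
    · exact Submodule.sum_mem _ fun k hk => PointedCone.smul_mem _ (sub_nonneg.2 (le_abs_self _))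
        (subset_hull ⟨k, Finset.mem_of_mem_erase hk, rfl⟩)
  have hface := (h.fan.inter_isFaceOf _ ⟨F, hF, rfl⟩ _ ⟨G, hG, rfl⟩).2
  have hxF' : M.col x ∈ colCone M F :=
    (hface.mem_of_add_mem_left hxmem hrest
      ⟨hpF, Submodule.add_mem _ hxmem hrest⟩).1
  have hsing : ({x} : Finset (Fin r)) ∈ K := hK (Finset.singleton_subset_iff.2 hxG) hG
  have hle : colCone M {x} ≤ colCone M F := by
    refine Submodule.span_le.2 ?_
    rintro _ ⟨k, hk, rfl⟩
    rw [Finset.mem_coe, Finset.mem_singleton] at hk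
    rw [hk]
    exact hxF'
  exact hxF (Finset.singleton_subset_iff.1 ((h.realizes _ hsing _ hF).1 hle))

theorem IsCompleteSimplicialFanRealization.disjoint_interior
    (h : IsCompleteSimplicialFanRealization K M) {F J : Finset (Fin r)} (hF : IsFacet K F)
    (hJ : J ∈ K) (hne : J ≠ F) :
    Disjoint (interior (colCone M F : Set (Fin d → ℝ))) (colCone M J : Set (Fin d → ℝ)) := by
  rw [Set.disjoint_left]
  intro y hyF hyJ
  have hface := (h.fan.inter_isFaceOf _ ⟨F, hF.1, rfl⟩ _ ⟨J, hJ, rfl⟩).1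
  have hle := le_of_isFaceOf_of_mem_interior hface hyF ⟨interior_subset hyF, hyJ⟩
  exact hne (hF.eq_of_le hJ ((h.realizes F hF.1 J hJ).1 fun z hz => (hle hz).2)).symm

/-- Signed determinants are nonzero because facets are independent, agree in sign across ridges by
`circuit_pos`, and hence all agree in sign by flip connectivity. -/
theorem IsCompleteSimplicialFanRealization.isSignatureMatrix [Finite W]
    {MG : Matrix (Fin (cs.length w)) (Fin r) ℝ} (hMG : IsGaleDual M MG)
    (hQ : Nonempty (Occurrence cs w Q))
    (h : IsCompleteSimplicialFanRealization (subwordComplex cs w Q) M) :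
    IsSignatureMatrix cs w Q MG := by
  have hK := isLowerSet_subwordComplex cs w Q
  obtain ⟨σ, hσ⟩ := exists_isSignFunction cs w
  obtain ⟨f₀⟩ := hQ
  have hne : ∀ f : Occurrence cs w Q, f.signedDet σ MG ≠ 0 := fun f =>
    (f.signedDet_ne_zero_iff σ MG).2 ((hMG.linearIndepOn_compl_iff f.1).1
      (h.linearIndepOn hK f.compl_support_mem))
  have heq : ∀ f g : Occurrence cs w Q, f.support = g.support → f = g := by
    intro f g hS
    refine Subtype.ext (DFunLike.coe_injective (List.ofFn_injective ?_))
    rw [← f.sort_support, ← g.sort_support, hS]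
  have hadj : ∀ f g : Occurrence cs w Q, ∀ x ∈ f.support, ∀ y ∈ g.support,
      f.support.erase x = g.support.erase y → 0 < f.signedDet σ MG * g.signedDet σ MG := by
    intro f g x hx y hy hfg
    by_cases hS : f.support = g.support
    · rw [heq f g hS]
      exact mul_self_pos.2 (hne g)
    · obtain ⟨hyf, hxg⟩ := notMem_of_erase_eq hy hfg hS hx
      obtain ⟨c, hc, hcz, hcx, hcy⟩ := hσ.exists_circuit hMG hx hy hfg
      rw [← hcx, ← hcy]
      refine h.circuit_pos hK f.compl_support_mem g.compl_support_mem (by simpa) (by simpa)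
        (by simpa) ?_ hc ?_ (hcx ▸ hne f) (hcy ▸ hne g)
      · rw [← Finset.compl_insert, ← Finset.compl_insert]
        congr 1
        rw [← Finset.insert_erase hx, ← Finset.insert_erase hy, hfg, Finset.insert_comm]
      · intro k hk hkx
        exact hcz k (Finset.mem_erase.2 ⟨hkx, by simpa using hk⟩)
  have hall : ∀ f : Occurrence cs w Q, 0 < f₀.signedDet σ MG * f.signedDet σ MG := by
    suffices H : ∀ S, IsReducedSubword cs Q w S → ∀ f : Occurrence cs w Q, f.support = S →
        0 < f₀.signedDet σ MG * f.signedDet σ MG from fun f => H _ f.isReducedSubword f rfl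
    intro S hS
    have hrel := reflTransGen_flipAdj (cs := cs) (Q := Q) Finset.univ w f₀.support S
      (Finset.subset_univ _) (Finset.subset_univ _) f₀.isReducedSubword hS
    clear hS
    induction hrel with
    | refl =>
      intro f hf
      rw [heq f f₀ hf]
      exact mul_self_pos.2 (hne f₀)
    | tail _ hadj' ih =>
      intro f hf
      obtain ⟨⟨-, hT⟩, -, x, hx, y, hy, hxy⟩ := hadj'
      obtain ⟨g, rfl⟩ := exists_support_eq hT
      subst hf
      have h1 := ih g rfl
      have h2 := hadj g f x hx y hy hxy
      have h3 := mul_self_pos.2 (hne g)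
      refine pos_of_mul_pos_right (b := f₀.signedDet σ MG * f.signedDet σ MG) ?_ h3.le
      convert mul_pos h1 h2 using 1
      ring
  rcases (hne f₀).lt_or_gt with h0 | h0
  -- If the common sign is negative, the opposite sign function serves.
  · refine ⟨fun ω => -σ ω, fun i j ω ω' hij hm => ?_, fun f => ?_⟩
    · simp only [hσ i j ω ω' hij hm, mul_neg]
    · have := neg_pos.2 (neg_of_mul_pos_right (hall f) h0.le)
      simpa [Occurrence.signedDet] using this
  · exact ⟨σ, hσ, fun f => pos_of_mul_pos_right (hall f) h0.le⟩

end Forward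

section Backward

variable {w₀ : W} {M : Matrix (Fin (r - cs.length w₀)) (Fin r) ℝ}

-- Nonzero minors give the bases, unique exchange gives the flips, and applying a coordinate
-- functional of `F` to the circuit across a ridge, whose coefficients at `k` and `k'` are positive,
-- gives the opposite sides.
open Classical in
theorem exists_isFlipSystem (hw₀ : IsLongest cs w₀)
    {MG : Matrix (Fin (cs.length w₀)) (Fin r) ℝ} (hMG : IsGaleDual M MG)
    (hsig : IsSignatureMatrix cs w₀ Q MG) :
    ∃ c : Finset (Fin r) → Fin r → (Fin (r - cs.length w₀) → ℝ) →ₗ[ℝ] ℝ,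
      IsFlipSystem M.col (Finset.univ.filter fun F => IsReducedSubword cs Q w₀ Fᶜ) c := by
  obtain ⟨σ, hσ, hpos⟩ := hsig
  have hpos' : ∀ f : Occurrence cs w₀ Q, 0 < f.signedDet σ MG := hpos
  have hbasis : ∀ F : Finset (Fin r), IsReducedSubword cs Q w₀ Fᶜ →
      ∃ c : Fin r → (Fin (r - cs.length w₀) → ℝ) →ₗ[ℝ] ℝ, (∀ x, ∑ k ∈ F, c k x • M.col k = x) ∧
        ∀ k ∈ F, ∀ l ∈ F, c k (M.col l) = if k = l then 1 else 0 := by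
    intro F hF
    obtain ⟨f, hf⟩ := exists_support_eq hF
    have hFf : F = f.supportᶜ := by rw [hf, compl_compl]
    subst hFf
    refine exists_dual_of_linearIndepOn ((hMG.linearIndepOn_compl_iff f.1).2
      ((f.signedDet_ne_zero_iff σ MG).1 (hpos' f).ne')) ?_
    rw [f.card_compl_support, Module.finrank_fin_fun]
  choose! c hrepr hdual using hbasis
  have hcompl : ∀ (F : Finset (Fin r)) (k k' : Fin r), k ≠ k' →
      (insert k' (F.erase k))ᶜ = (insert k Fᶜ).erase k' := by
    intro F k k' hkk'
    ext z
    simp only [Finset.mem_compl, Finset.mem_insert, Finset.mem_erase]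
    tauto
  refine ⟨c, ⟨?_, ?_, ?_, ?_⟩⟩
  · exact fun F hF => hrepr F (Finset.mem_filter.1 hF).2
  · exact fun F hF => hdual F (Finset.mem_filter.1 hF).2
  · intro F hF k hk
    have hF' := (Finset.mem_filter.1 hF).2
    have hkc : k ∉ Fᶜ := by simpa using hk
    obtain ⟨k', ⟨hk'1, hk'2, hk'3⟩, huniq⟩ := existsUnique_exchange (P := insert k Fᶜ) (x := k)
      hw₀ (Finset.mem_insert_self _ _) (by rwa [Finset.erase_insert hkc])
    have hiff : ∀ z, (z ∉ F ∧ insert z (F.erase k) ∈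
        Finset.univ.filter fun F => IsReducedSubword cs Q w₀ Fᶜ) ↔
        z ∈ insert k Fᶜ ∧ z ≠ k ∧ IsReducedSubword cs Q w₀ ((insert k Fᶜ).erase z) := by
      intro z
      by_cases hzk : z = k
      · subst hzk; simp [hk]
      · rw [Finset.mem_filter, hcompl F k z (Ne.symm hzk)]
        simp [hzk]
    exact ⟨k', (hiff k').2 ⟨hk'1, hk'2, hk'3⟩, fun z hz => huniq z ((hiff z).1 hz)⟩
  · intro F hF k hk k' hk' hG
    have hF' := (Finset.mem_filter.1 hF).2
    have hG' := (Finset.mem_filter.1 hG).2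
    have hkk' : k ≠ k' := fun h => hk' (h ▸ hk)
    rw [hcompl F k k' hkk'] at hG'
    obtain ⟨f, hf⟩ := exists_support_eq hF'
    obtain ⟨g, hg⟩ := exists_support_eq hG'
    have hkc : k ∉ Fᶜ := by simpa using hk
    obtain ⟨e, he, hez, hex, hey⟩ := hσ.exists_circuit hMG (f := f) (g := g) (x := k') (y := k)
      (by rw [hf]; simpa using hk') (by rw [hg]; simp [hkk'])
      (by rw [hf, hg, Finset.erase_right_comm, Finset.erase_insert hkc])
    have h0 := congrArg (c F k) he
    rw [map_sum, map_zero] at h0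
    have h1 : e k' * c F k (M.col k') + e k = 0 := by
      rw [← h0, ← Finset.sum_subset (Finset.subset_univ {k', k}), Finset.sum_pair hkk'.symm]
      · simp [hdual F hF' k hk k hk]
      · intro z _ hz
        simp only [Finset.mem_insert, Finset.mem_singleton, not_or] at hz
        rw [map_smul, smul_eq_mul]
        by_cases hzF : z ∈ F
        · rw [hdual F hF' k hk z hzF, if_neg (Ne.symm hz.2), mul_zero]
        · rw [hez z (Finset.mem_erase.2 ⟨hz.1, by rw [hf]; simpa using hzF⟩), zero_mul]
    have h2 : 0 < e k' := hex ▸ hpos' f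
    have h3 : 0 < e k := hey ▸ hpos' g
    by_contra hnn
    have := mul_nonneg h2.le (not_lt.1 hnn)
    linarith

theorem isCompleteSimplicialFanRealization_of_isSignatureMatrix (hw₀ : IsLongest cs w₀)
    {MG : Matrix (Fin (cs.length w₀)) (Fin r) ℝ} (hMG : IsGaleDual M MG)
    (hsig : IsSignatureMatrix cs w₀ Q MG)
    (hinj : HasInjectiveFacet (subwordComplex cs w₀ Q) M) :
    IsCompleteSimplicialFanRealization (subwordComplex cs w₀ Q) M := by
  classical
  have hK := isLowerSet_subwordComplex cs w₀ Q
  obtain ⟨c, h⟩ := exists_isFlipSystem hw₀ hMG hsig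
  set 𝓕 : Finset (Finset (Fin r)) := Finset.univ.filter fun F => IsReducedSubword cs Q w₀ Fᶜ
    with h𝓕
  have hmem : ∀ f : Occurrence cs w₀ Q, f.supportᶜ ∈ 𝓕 := fun f => by
    simpa [h𝓕] using f.isReducedSubword
  have hmemK : ∀ F ∈ 𝓕, F ∈ subwordComplex cs w₀ Q := by
    intro F hF
    obtain ⟨f, hf⟩ := exists_support_eq (Finset.mem_filter.1 hF).2
    exact mem_subwordComplex_iff.2 ⟨f, by rw [hf, compl_compl]⟩
  have hfacet : ∀ I ∈ subwordComplex cs w₀ Q, ∃ F ∈ 𝓕, I ⊆ F := by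
    intro I hI
    obtain ⟨f, hf⟩ := mem_subwordComplex_iff.1 hI
    exact ⟨_, hmem f, hf⟩
  have hcone : ∀ F ∈ 𝓕, ∀ x, (∀ k ∈ F, 0 ≤ c F k x) → x ∈ colCone M F := fun F hF x hx =>
    mem_hull_image_iff.2 ⟨fun k => c F k x, hx, h.repr F hF x⟩
  -- This is the only use of the injective facet: it fixes the covering degree to be one.
  have hsum : ∀ y, IsGeneric 𝓕 c y → ∑ F ∈ 𝓕, coneWeight c F y = 2 := by
    obtain ⟨F₀, hF₀, hdisj⟩ := hinj
    obtain ⟨f₀, rfl⟩ := exists_eq_compl_support hF₀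
    intro y hy
    refine h.sum_coneWeight_eq_two (hmem f₀) (fun F hF hne x hx hx' => ?_) hy
    refine Set.disjoint_left.1 (hdisj F (hmemK F hF) hne) ?_ (hcone F hF x hx')
    refine interior_maximal (fun z hz => ?_) (isOpen_forall_pos (c := c) f₀.supportᶜ f₀.supportᶜ) hx
    exact hcone _ (hmem f₀) z fun k hk => (hz k hk).le
  have hli : ∀ I ∈ subwordComplex cs w₀ Q, LinearIndepOn ℝ M.col (I : Set (Fin r)) := by
    intro I hI
    obtain ⟨F, hF, hIF⟩ := hfacet I hI
    refine LinearIndepOn.mono ?_ (Finset.coe_subset.2 hIF)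
    refine linearIndepOn_finset_iff.2 fun a ha k hk => ?_
    have := h.coord_sum hF le_rfl a hk
    rw [ha, map_zero, if_pos hk] at this
    exact this.symm
  have hinter : ∀ I ∈ subwordComplex cs w₀ Q, ∀ J ∈ subwordComplex cs w₀ Q,
      colCone M I ⊓ colCone M J = colCone M (I ∩ J) := by
    intro I hI J hJ
    obtain ⟨F, hF, hIF⟩ := hfacet I hI
    obtain ⟨G, hG, hJG⟩ := hfacet J hJ
    refine le_antisymm ?_ (le_inf (Submodule.span_mono (Set.image_mono ?_))
      (Submodule.span_mono (Set.image_mono ?_)))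
    · rintro x ⟨hxI, hxJ⟩
      obtain ⟨L, hL, a, ha, rfl⟩ := exists_pos_of_mem_hull_image hxI
      obtain ⟨L', hL', b, hb, hab⟩ := exists_pos_of_mem_hull_image hxJ
      have hLL' := h.eq_of_sum_eq_sum hsum hF hG (hL.trans hIF) (hL'.trans hJG) ha hb hab.symm
      subst hLL'
      exact Submodule.sum_mem _ fun k hk => PointedCone.smul_mem _ (ha k hk).le
        (subset_hull ⟨k, Finset.mem_coe.2 (Finset.mem_inter.2 ⟨hL hk, hL' hk⟩), rfl⟩)
    · exact Finset.coe_subset.2 Finset.inter_subset_left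
    · exact Finset.coe_subset.2 Finset.inter_subset_right
  refine ⟨⟨(Set.toFinite _).image _, ?_, ?_, ?_, ?_⟩, ?_⟩
  · rintro _ ⟨I, hI, rfl⟩
    exact isSimplicial_hull_of_linearIndepOn (hli I hI)
  · rintro _ ⟨I, hI, rfl⟩ τ hτ
    obtain ⟨L, hL, rfl⟩ := exists_eq_hull_of_isFaceOf hτ
    exact ⟨L, hK hL hI, rfl⟩
  · rintro _ ⟨I, hI, rfl⟩ _ ⟨J, hJ, rfl⟩
    rw [hinter I hI J hJ]
    exact ⟨isFaceOf_hull_of_linearIndepOn (hli I hI) Finset.inter_subset_left,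
      isFaceOf_hull_of_linearIndepOn (hli J hJ) Finset.inter_subset_right⟩
  · intro x
    obtain ⟨F, hF, hx⟩ := h.exists_coord_nonneg hsum x
    exact ⟨_, ⟨F, hmemK F hF, rfl⟩, hcone F hF x hx⟩
  · intro I hI J hJ
    refine ⟨fun hle => ?_, fun hIJ => Submodule.span_mono (Set.image_mono (Finset.coe_subset.2 hIJ))⟩
    obtain ⟨F, hF, hIF⟩ := hfacet I hI
    obtain ⟨G, hG, hJG⟩ := hfacet J hJ
    -- The sum of the generators of `I` has support exactly `I`, while its expression in the cone of
    -- `J` has support inside `J`; supports are unique.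
    have hx : ∑ k ∈ I, (1 : ℝ) • M.col k ∈ colCone M J :=
      hle (mem_hull_image_iff.2 ⟨fun _ => 1, fun _ _ => zero_le_one, rfl⟩)
    obtain ⟨L, hL, b, hb, hab⟩ := exists_pos_of_mem_hull_image hx
    rw [h.eq_of_sum_eq_sum hsum hF hG hIF (hL.trans hJG) (fun _ _ => zero_lt_one) hb hab.symm]
    exact hL

end Backward

end Assembly

end SubwordFan

theorem theorem5p1 {B W : Type*} [Group W] [Finite W] {C : CoxeterMatrix B}
    (cs : CoxeterSystem C W) (w₀ : W) (hw₀ : SubwordFan.IsLongest cs w₀)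
    {r : ℕ} (Q : Fin r → B) (hQ : Nonempty (SubwordFan.Occurrence cs w₀ Q))
    (M : Matrix (Fin (r - cs.length w₀)) (Fin r) ℝ) (hM : M.rank = r - cs.length w₀)
    (MG : Matrix (Fin (cs.length w₀)) (Fin r) ℝ) (hMG : SubwordFan.IsGaleDual M MG) :
    SubwordFan.IsCompleteSimplicialFanRealization (SubwordFan.subwordComplex cs w₀ Q) M ↔
      SubwordFan.IsSignatureMatrix cs w₀ Q MG ∧
        SubwordFan.HasInjectiveFacet (SubwordFan.subwordComplex cs w₀ Q) M := by
  constructor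
  · intro h
    obtain ⟨f⟩ := hQ
    exact ⟨h.isSignatureMatrix hMG ⟨f⟩, _, f.isFacet_compl_support,
      fun J hJ hne => h.disjoint_interior f.isFacet_compl_support hJ hne⟩
  · rintro ⟨hsig, hinj⟩
    exact SubwordFan.isCompleteSimplicialFanRealization_of_isSignatureMatrix hw₀ hMG hsig hinj
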